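/- **Setting.** Let $\mathbb L\subset\mathbb R^3$ be a Bravais lattice with unit cell $\Omega$, $\mathbb L^*$ its reciprocal lattice with basis $b_1^*,b_2^*,b_3^*$, and $\Omega^*$ the Brillouin zone (a unit cell of $\mathbb L^*$). There are $n_{\rm occ}$ occupied bands $i,j,k,l$ and $n_{\rm vir}$ virtual bands $a,b,c,d$. The orbitals $\psi_{n\mathbf k}(\mathbf r)=e^{i\mathbf k\cdot\mathbf r}u_{n\mathbf k}(\mathbf r)$, with $u_{n\mathbf k}$ $\mathbb L$-periodic in $\mathbf r$, are orthonormal over $\Omega$ for each $\mathbf k$, $\mathbb L^*$-periodic in $\mathbf k$, and smooth in $\mathbf k$ (with all $\mathbf k$-derivatives of $u_{n\mathbf k}(\mathbf r)$ continuous in $(\mathbf k,\mathbf r)$); the real orbital energies $\varepsilon_{n\mathbf k}$ are smooth and $\mathbb L^*$-periodic in $\mathbf k$, and $\varepsilon_{i\mathbf k}<\varepsilon_{a\mathbf k'}$ for all $i,a,\mathbf k,\mathbf k'$. With $\hat\varrho_{n'\mathbf k',n\mathbf k}(\mathbf G)=\int_\Omega\overline{\psi_{n'\mathbf k'}}\,e^{i(\mathbf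 k'-\mathbf k-\mathbf G)\cdot\mathbf r}\psi_{n\mathbf k}\,d\mathbf r$ and $\mathbf q=\mathbf k_3-\mathbf k_1$, the electron repulsion integrals (ERIs) are $$\langle n_1\mathbf k_1,n_2\mathbf k_2|n_3\mathbf k_3,n_4\mathbf k_4\rangle=\frac{4\pi}{|\Omega|}\sum_{\mathbf G\in\mathbb L^*,\ \mathbf q+\mathbf G\ne 0}\frac{\hat\varrho_{n_1\mathbf k_1,n_3(\mathbf k_1+\mathbf q)}(\mathbf G)\,\hat\varrho_{n_2\mathbf k_2,n_4(\mathbf k_2-\mathbf q)}(-\mathbf G)}{|\mathbf q+\mathbf G|^2},$$ where $\mathbf k_1+\mathbf k_2-\mathbf k_3-\mathbf k_4\in\mathbb L^*$ always. A function $f(\mathbf x,\mathbf y)$ has *algebraic singularity of order $\gamma$* at $\mathbf x=\mathbf x_0$ if for some $\delta>0$ it is smooth for $0<|\mathbf x-\mathbf x_0|<\delta$ (all $\mathbf y$), and for all multi-indices $\alpha,\beta$ there is $C_{\alpha,\beta}$ with $|\partial_{\mathbf x}^\alpha\partial_{\mathbf y}^\beta f(\mathbf x,\mathbf y)|\le C_{\alpha,\beta}|\mathbf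 x-\mathbf x_0|^{\gamma-|\alpha|}$ for all such $\mathbf x$ and all $\mathbf y$. The space $\mathbb T(\Omega^*)$ consists of the functions $f(\mathbf k_i,\mathbf k_j,\mathbf k_a)$ that are $\mathbb L^*$-periodic in each variable, smooth wherever $\mathbf k_a-\mathbf k_i\notin\mathbb L^*$, have algebraic singularity of order $0$ at $\mathbf q=\mathbf k_a-\mathbf k_i=0$ as functions of $\mathbf q$ and $(\mathbf k_i,\mathbf k_j)$, and are such that $(\mathbf k_i,\mathbf k_j)\mapsto f(\mathbf k_i,\mathbf k_j,\mathbf k_i)$ is smooth. For a uniform $m\times m\times m$ mesh $\mathcal K=\{\mathbf k_0+\sum_s (n_s/m)b_s^* : 0\le n_s<m\}$ (modulo $\mathbb L^*$), $N_{\mathbf k}=m^3$, with any offset $\mathbf k_0$, let $\mathcal M_{\mathcal K}$ be sampling of amplitudes $t=(t_{ijab}(\mathbf k_i,\mathbf k_j,\mathbf k_a))$ on $\mathcal K^3$ and $\|\cdot\|_\infty$ the entrywise max norm. Write $I=(i,\mathbf k_i)$, etc., $t_{IJ}^{AB}=t_{ijab}(\mathbf k_i,\mathbf k_j,\mathbf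 k_a)$, $\varepsilon_{IJ}^{AB}=\varepsilon_I+\varepsilon_J-\varepsilon_A-\varepsilon_B$, $\mathcal P(X)_{IJ}^{AB}=X_{IJ}^{AB}+X_{JI}^{BA}$. The CCD iteration map $\mathcal F_{N_{\mathbf k}}$ is $$\mathcal F_{N_{\mathbf k}}(t)_{IJ}^{AB}=\frac1{\varepsilon_{IJ}^{AB}}\Big[\langle AB|IJ\rangle+\mathcal P\Big(\sum_C\kappa_C^At_{IJ}^{CB}-\sum_K\kappa_I^Kt_{KJ}^{AB}\Big)+\frac1{N_{\mathbf k}}\sum_{KL}\chi_{IJ}^{KL}t_{KL}^{AB}+\frac1{N_{\mathbf k}}\sum_{CD}\langle AB|CD\rangle t_{IJ}^{CD}$$ $$\qquad+\mathcal P\Big(\frac1{N_{\mathbf k}}\sum_{KC}\big[(2\chi_{IC}^{AK}-\chi_{CI}^{AK})t_{KJ}^{CB}-\chi_{IC}^{AK}t_{KJ}^{BC}-\chi_{CJ}^{AK}t_{KI}^{BC}\big]\Big)\Big],$$ $$\kappa_C^A=-\tfrac1{N_{\mathbf k}^2}\sum_{KLD}(2\langle KL|CD\rangle-\langle KL|DC\rangle)t_{KL}^{AD},\qquad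 \kappa_I^K=\tfrac1{N_{\mathbf k}^2}\sum_{LCD}(2\langle KL|CD\rangle-\langle KL|DC\rangle)t_{IL}^{CD},$$ $$\chi_{IJ}^{KL}=\langle KL|IJ\rangle+\tfrac1{N_{\mathbf k}}\sum_{CD}\langle KL|CD\rangle t_{IJ}^{CD},\qquad \chi_{CI}^{AK}=\langle AK|CI\rangle-\tfrac1{2N_{\mathbf k}}\sum_{LD}\langle LK|CD\rangle t_{IL}^{DA},$$ $$\chi_{IC}^{AK}=\langle AK|IC\rangle+\tfrac1{2N_{\mathbf k}}\sum_{LD}\big[(2\langle LK|DC\rangle-\langle LK|CD\rangle)t_{IL}^{AD}-\langle LK|DC\rangle t_{IL}^{DA}\big],$$ where sums run over bands and over momenta in $\mathcal K$ subject to crystal momentum conservation (in particular $\mathbf k_c=\mathbf k_a$ in $\kappa_C^A$ and $\mathbf k_k=\mathbf k_i$ in $\kappa_I^K$). $\mathcal F_{\rm TDL}$ is given by the same formulas with every averaged momentum sum $N_{\mathbf k}^{-1}\sum_{\mathbf k\in\mathcal K}$ replaced by $|\Omega^*|^{-1}\int_{\Omega^*}d\mathbf k$. The *ladder-type linear terms*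 $\mathcal L_{N_{\mathbf k}}(t)$ and, analogously, $\mathcal L_{\rm TDL}(t)$, are $$\frac1{\varepsilon_{IJ}^{AB}}\Big[\frac1{N_{\mathbf k}}\sum_{KL}\langle KL|IJ\rangle t_{KL}^{AB}+\frac1{N_{\mathbf k}}\sum_{CD}\langle AB|CD\rangle t_{IJ}^{CD}-\mathcal P\frac1{N_{\mathbf k}}\sum_{KC}\big(\langle AK|CI\rangle t_{KJ}^{CB}+\langle AK|CJ\rangle t_{KI}^{BC}\big)\Big].$$ **Lemma (amplitude error in a single iteration).** Let $t\in\mathbb T(\Omega^*)^{n_{\rm occ}\times n_{\rm occ}\times n_{\rm vir}\times n_{\rm vir}}$ be arbitrary. There is a constant $C$, depending on the system and on $t$ but not on $m\ge 1$ or on the offset $\mathbf k_0$ of the mesh, such that $$\big\|\mathcal M_{\mathcal K}\mathcal F_{\rm TDL}(t)-\mathcal F_{N_{\mathbf k}}(\mathcal M_{\mathcal K}t)\big\|_\infty\le C\,N_{\mathbf k}^{-1/3}.$$ The dominant error comes from the ladder-type linear terms: there is such a constant $C$ with $$\big\|\big(\mathcal M_{\mathcal K}\mathcal F_{\rm TDL}(t)-\mathcal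 F_{N_{\mathbf k}}(\mathcal M_{\mathcal K}t)\big)-\big(\mathcal M_{\mathcal K}\mathcal L_{\rm TDL}(t)-\mathcal L_{N_{\mathbf k}}(\mathcal M_{\mathcal K}t)\big)\big\|_\infty\le C\,N_{\mathbf k}^{-1}.$$ These terms contain ERIs with matching band indices, and for any bands $n_1,n_2$ the ERI $\langle n_1\mathbf k_1,n_2\mathbf k_2|n_1(\mathbf k_1+\mathbf q),n_2(\mathbf k_2-\mathbf q)\rangle$, as a function of $\mathbf q$ and $(\mathbf k_1,\mathbf k_2)$, has algebraic singularity of order $-2$ at $\mathbf q=0$, and of no order $\gamma>-2$. -/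

import Mathlib

open Module MeasureTheory
open scoped ContDiff ComplexConjugate

noncomputable section

namespace PeriodicCCD

/-- Three-dimensional Euclidean space: positions `r` and crystal momenta `k` both live here. -/
abbrev E3 : Type := EuclideanSpace ℝ (Fin 3)

/-! ### Lattices -/

/-- The bilinear form `(x, y) ↦ ⟪x, y⟫ / (2π)`. -/
def dotForm : LinearMap.BilinForm ℝ E3 := (2 * Real.pi)⁻¹ • innerₗ E3

theorem dotForm_apply (x y : E3) : dotForm x y = (2 * Real.pi)⁻¹ * inner ℝ x y := by
  simp [dotForm]

theorem dotForm_nondegenerate : dotForm.Nondegenerate := by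
  have h0 : (2 * Real.pi)⁻¹ ≠ 0 := by positivity
  constructor
  · intro x hx
    have h := hx x
    rw [dotForm_apply] at h
    exact inner_self_eq_zero.1 ((mul_eq_zero.1 h).resolve_left h0)
  · intro x hx
    have h := hx x
    rw [dotForm_apply] at h
    exact inner_self_eq_zero.1 ((mul_eq_zero.1 h).resolve_left h0)

/-- The reciprocal basis `b₁*, b₂*, b₃*` of a basis `A` of the Bravais lattice:
`⟪bᵢ*, Aⱼ⟫ = 2π δᵢⱼ`, see `inner_recipBasis`. -/
def recipBasis (A : Basis (Fin 3) ℝ E3) : Basis (Fin 3) ℝ E3 :=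
  dotForm.dualBasis dotForm_nondegenerate A

theorem inner_recipBasis (A : Basis (Fin 3) ℝ E3) (i j : Fin 3) :
    inner ℝ (recipBasis A i) (A j) = if j = i then 2 * Real.pi else 0 := by
  have h := LinearMap.BilinForm.apply_dualBasis_left dotForm_nondegenerate A i j
  rw [dotForm_apply] at h
  have h0 : (2 * Real.pi) ≠ 0 := by positivity
  unfold recipBasis
  split_ifs at h ⊢ with hij
  · field_simp at h
    linarith
  · exact (mul_eq_zero.1 h).resolve_left (inv_ne_zero h0)

/-- The Bravais lattice `𝕃`. -/
abbrev lattice (A : Basis (Fin 3) ℝ E3) : Submodule ℤ E3 :=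
  Submodule.span ℤ (Set.range A)

/-- The reciprocal lattice `𝕃*`. -/
abbrev recipLattice (A : Basis (Fin 3) ℝ E3) : Submodule ℤ E3 :=
  Submodule.span ℤ (Set.range (recipBasis A))

/-- The unit cell `Ω` of the Bravais lattice. -/
abbrev unitCell (A : Basis (Fin 3) ℝ E3) : Set E3 := ZSpan.fundamentalDomain A

/-- The Brillouin zone `Ω*`, a unit cell of the reciprocal lattice. -/
abbrev brillouinZone (A : Basis (Fin 3) ℝ E3) : Set E3 :=
  ZSpan.fundamentalDomain (recipBasis A)

/-! ### Orbitals, orbital energies and electron repulsion integrals -/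

/-- Band indices: `Sum.inl i` is an occupied band, `Sum.inr a` is a virtual band. -/
abbrev Band (nocc nvir : ℕ) : Type := Fin nocc ⊕ Fin nvir

/-- The Bloch orbital `exp(i k·r) u(k, r)` with cell-periodic part `u`. -/
def bloch (u : E3 → E3 → ℂ) (k r : E3) : ℂ :=
  Complex.exp (Complex.I * ((inner ℝ k r : ℝ) : ℂ)) * u k r

/-- Orbitals and orbital energies of an insulating periodic system with Bravais lattice basis `A`,
`nocc` occupied bands and `nvir` virtual bands. The orbitals are
`ψ_{nk}(r) = exp(i k·r) u_{nk}(r)`, normalized to one over a single unit cell. -/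
structure Insulator (A : Basis (Fin 3) ℝ E3) (nocc nvir : ℕ) where
  /-- the cell-periodic parts `u_{nk}(r)` -/
  u : Band nocc nvir → E3 → E3 → ℂ
  /-- the orbital energies `ε_{nk}` -/
  ε : Band nocc nvir → E3 → ℝ
  u_periodic : ∀ n k r, ∀ R ∈ lattice A, u n k (r + R) = u n k r
  orthonormal : ∀ n n' k,
    ∫ r in unitCell A, conj (bloch (u n) k r) * bloch (u n') k r = if n = n' then 1 else 0
  /-- the orbitals are periodic in the crystal momentum -/
  orbital_periodic : ∀ n k r, ∀ G ∈ recipLattice A, bloch (u n) (k + G) r = bloch (u n) k r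
  /-- the orbitals are smooth in the crystal momentum ... -/
  orbital_smooth : ∀ n r, ContDiff ℝ ∞ (fun k => u n k r)
  /-- ... with all derivatives in the momentum being continuous in momentum and position -/
  orbital_smooth_cont : ∀ n (p : ℕ),
    Continuous (fun x : E3 × E3 => iteratedFDeriv ℝ p (fun k => u n k x.2) x.1)
  energy_periodic : ∀ n k, ∀ G ∈ recipLattice A, ε n (k + G) = ε n k
  energy_smooth : ∀ n, ContDiff ℝ ∞ (ε n)
  /-- the gap between occupied and virtual bands -/
  gap : ∀ (i : Fin nocc) (a : Fin nvir) (k k' : E3), ε (Sum.inl i) k < ε (Sum.inr a) k'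

variable {A : Basis (Fin 3) ℝ E3} {nocc nvir : ℕ}

/-- The pair product `⟨ψ_{n'k'} | exp(i (k' - k - G)·r) | ψ_{nk}⟩`. -/
def Insulator.pairProduct (S : Insulator A nocc nvir) (n' : Band nocc nvir) (k' : E3)
    (n : Band nocc nvir) (k : E3) (G : E3) : ℂ :=
  ∫ r in unitCell A, conj (bloch (S.u n') k' r) *
    Complex.exp (Complex.I * ((inner ℝ (k' - k - G) r : ℝ) : ℂ)) * bloch (S.u n) k r

open Classical in
/-- The normalized electron repulsion integral `⟨n₁k₁, n₂k₂ | n₃k₃, n₄k₄⟩`, with momentum transfer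
`q = k₃ - k₁` and `k₄ = k₂ - q` given by crystal momentum conservation. The term with `q + G = 0`
is left out of the lattice sum. -/
def Insulator.eri (S : Insulator A nocc nvir) (n₁ n₂ n₃ n₄ : Band nocc nvir)
    (k₁ k₂ k₃ : E3) : ℂ :=
  ((4 * Real.pi / volume.real (unitCell A) : ℝ) : ℂ) *
    ∑' G : recipLattice A,
      if (k₃ - k₁) + (G : E3) = 0 then 0 else
        ((1 / ‖(k₃ - k₁) + (G : E3)‖ ^ 2 : ℝ) : ℂ) *
          S.pairProduct n₁ k₁ n₃ (k₁ + (k₃ - k₁)) G *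
          S.pairProduct n₂ k₂ n₄ (k₂ - (k₃ - k₁)) (-(G : E3))

/-! ### The right-hand side of the CCD amplitude equation

The formulas for a finite mesh and in the thermodynamic limit are the same, except that the averaged
sums `N⁻¹ ∑_{k ∈ 𝒦}` are replaced by averaged integrals `|Ω*|⁻¹ ∫_{Ω*}`. They are written once, for
an additive group `Q` of momenta, an averaging operation `avg` over `Q`, orbital energies `ε n k`
and ERIs `v n₁ n₂ n₃ n₄ k₁ k₂ k₃ = ⟨n₁k₁, n₂k₂ | n₃k₃, n₄k₄⟩` with `k₄ = k₁ + k₂ - k₃`; only the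
two instances `ccdFinite` and `ccdTDL` below are used. Band indices are `i j k l` (occupied) and
`a b c d` (virtual), and `xi, xj, ...` are the momenta that belong to the bands `i, j, ...`. -/

/-- Doubles amplitudes `t_{ijab}(k_i, k_j, k_a)`. -/
abbrev Amp (nocc nvir : ℕ) (Q : Type) : Type :=
  Fin nocc → Fin nocc → Fin nvir → Fin nvir → Q → Q → Q → ℂ

/-- The entrywise max norm of an amplitude tensor (the sup norm on the finite set of all entries). -/
def maxNorm {Q : Type} [Fintype Q] (T : Amp nocc nvir Q) : ℝ :=
  ‖fun p : (Fin nocc × Fin nocc × Fin nvir × Fin nvir) × (Q × Q × Q) =>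
    T p.1.1 p.1.2.1 p.1.2.2.1 p.1.2.2.2 p.2.1 p.2.2.1 p.2.2.2‖

section AmplitudeEquation

open Sum (inl inr)

variable {Q : Type} [AddCommGroup Q]

/-- The permutation operator `(𝒫 X)_{IJ}^{AB} = X_{IJ}^{AB} + X_{JI}^{BA}`. -/
def perm (X : Amp nocc nvir Q) : Amp nocc nvir Q := fun i j a b xi xj xa =>
  X i j a b xi xj xa + X j i b a xj xi (xi + xj - xa)

/-- `κ_C^A` (where `k_c = k_a`). -/
def kappaVir (avg : (Q → ℂ) → ℂ)
    (v : (n₁ n₂ n₃ n₄ : Band nocc nvir) → (k₁ k₂ k₃ : Q) → ℂ) (t : Amp nocc nvir Q)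
    (c a : Fin nvir) (xa : Q) : ℂ :=
  -avg fun xk => avg fun xl =>
    let xd := xk + xl - xa
    ∑ k, ∑ l, ∑ d,
      (2 * v (inl k) (inl l) (inr c) (inr d) xk xl xa - v (inl k) (inl l) (inr d) (inr c) xk xl xd) *
        t k l a d xk xl xa

/-- `κ_I^K` (where `k_k = k_i`). -/
def kappaOcc (avg : (Q → ℂ) → ℂ)
    (v : (n₁ n₂ n₃ n₄ : Band nocc nvir) → (k₁ k₂ k₃ : Q) → ℂ) (t : Amp nocc nvir Q)
    (i k : Fin nocc) (xi : Q) : ℂ :=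
  avg fun xc => avg fun xd =>
    let xl := xc + xd - xi
    ∑ l, ∑ c, ∑ d,
      (2 * v (inl k) (inl l) (inr c) (inr d) xi xl xc - v (inl k) (inl l) (inr d) (inr c) xi xl xd) *
        t i l c d xi xl xc

/-- `χ_{IJ}^{KL}` (where `k_l = k_i + k_j - k_k`). -/
def chiOO (avg : (Q → ℂ) → ℂ)
    (v : (n₁ n₂ n₃ n₄ : Band nocc nvir) → (k₁ k₂ k₃ : Q) → ℂ) (t : Amp nocc nvir Q)
    (i j k l : Fin nocc) (xi xj xk : Q) : ℂ :=
  let xl := xi + xj - xk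
  v (inl k) (inl l) (inl i) (inl j) xk xl xi +
    avg fun xc => ∑ c, ∑ d, v (inl k) (inl l) (inr c) (inr d) xk xl xc * t i j c d xi xj xc

/-- `χ_{IC}^{AK}` (where `k_c = k_a + k_k - k_i`). -/
def chiOV (avg : (Q → ℂ) → ℂ)
    (v : (n₁ n₂ n₃ n₄ : Band nocc nvir) → (k₁ k₂ k₃ : Q) → ℂ) (t : Amp nocc nvir Q)
    (i : Fin nocc) (c a : Fin nvir) (k : Fin nocc) (xi xa xk : Q) : ℂ :=
  let xc := xa + xk - xi
  v (inr a) (inl k) (inl i) (inr c) xa xk xi +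
    (1 / 2) * avg fun xl =>
      let xd := xi + xl - xa
      ∑ l, ∑ d,
        ((2 * v (inl l) (inl k) (inr d) (inr c) xl xk xd
            - v (inl l) (inl k) (inr c) (inr d) xl xk xc) * t i l a d xi xl xa
          - v (inl l) (inl k) (inr d) (inr c) xl xk xd * t i l d a xi xl xd)

/-- `χ_{CI}^{AK}` (where `k_c = k_a + k_k - k_i`). -/
def chiVO (avg : (Q → ℂ) → ℂ)
    (v : (n₁ n₂ n₃ n₄ : Band nocc nvir) → (k₁ k₂ k₃ : Q) → ℂ) (t : Amp nocc nvir Q)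
    (c : Fin nvir) (i : Fin nocc) (a : Fin nvir) (k : Fin nocc) (xi xa xk : Q) : ℂ :=
  let xc := xa + xk - xi
  v (inr a) (inl k) (inr c) (inl i) xa xk xc -
    (1 / 2) * avg fun xl =>
      let xd := xi + xl - xa
      ∑ l, ∑ d, v (inl l) (inl k) (inr c) (inr d) xl xk xc * t i l d a xi xl xd

/-- `ε_{IJ}^{AB} = ε_I + ε_J - ε_A - ε_B`. -/
def energyDenom (ε : Band nocc nvir → Q → ℝ) (i j : Fin nocc) (a b : Fin nvir) (xi xj xa : Q) : ℝ :=
  ε (inl i) xi + ε (inl j) xj - ε (inr a) xa - ε (inr b) (xi + xj - xa)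

/-- `∑_C κ_C^A t_{IJ}^{CB} - ∑_K κ_I^K t_{KJ}^{AB}`. -/
def kappaTerm (avg : (Q → ℂ) → ℂ)
    (v : (n₁ n₂ n₃ n₄ : Band nocc nvir) → (k₁ k₂ k₃ : Q) → ℂ) (t : Amp nocc nvir Q) :
    Amp nocc nvir Q := fun i j a b xi xj xa =>
  ∑ c, kappaVir avg v t c a xa * t i j c b xi xj xa -
    ∑ k, kappaOcc avg v t i k xi * t k j a b xi xj xa

/-- `avg_{KC} (2 χ_{IC}^{AK} - χ_{CI}^{AK}) t_{KJ}^{CB} - χ_{IC}^{AK} t_{KJ}^{BC}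
- χ_{CJ}^{AK} t_{KI}^{BC}`. -/
def ringTerm (avg : (Q → ℂ) → ℂ)
    (v : (n₁ n₂ n₃ n₄ : Band nocc nvir) → (k₁ k₂ k₃ : Q) → ℂ) (t : Amp nocc nvir Q) :
    Amp nocc nvir Q := fun i j a b xi xj xa =>
  avg fun xk =>
    let xc := xa + xk - xi
    let xb := xi + xj - xa
    ∑ k, ∑ c,
      ((2 * chiOV avg v t i c a k xi xa xk - chiVO avg v t c i a k xi xa xk) * t k j c b xk xj xc
        - chiOV avg v t i c a k xi xa xk * t k j b c xk xj xb
        - chiVO avg v t c j a k xj xa xk * t k i b c xk xi xb)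

/-- The right-hand side of the CCD amplitude equation, as a map on amplitudes. -/
def ccdMap (avg : (Q → ℂ) → ℂ) (ε : Band nocc nvir → Q → ℝ)
    (v : (n₁ n₂ n₃ n₄ : Band nocc nvir) → (k₁ k₂ k₃ : Q) → ℂ) (t : Amp nocc nvir Q) :
    Amp nocc nvir Q := fun i j a b xi xj xa =>
  let xb := xi + xj - xa
  ((energyDenom ε i j a b xi xj xa : ℝ) : ℂ)⁻¹ *
    (v (inr a) (inr b) (inl i) (inl j) xa xb xi
      + perm (kappaTerm avg v t) i j a b xi xj xa
      + (avg fun xk => ∑ k, ∑ l, chiOO avg v t i j k l xi xj xk * t k l a b xk (xi + xj - xk) xa)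
      + (avg fun xc => ∑ c, ∑ d, v (inr a) (inr b) (inr c) (inr d) xa xb xc * t i j c d xi xj xc)
      + perm (ringTerm avg v t) i j a b xi xj xa)

/-- The ladder-type linear terms of the right-hand side of the CCD amplitude equation,
`1/ε_{IJ}^{AB} [avg_{KL} ⟨KL|IJ⟩ t_{KL}^{AB} + avg_{CD} ⟨AB|CD⟩ t_{IJ}^{CD}
- 𝒫 avg_{KC} (⟨AK|CI⟩ t_{KJ}^{CB} + ⟨AK|CJ⟩ t_{KI}^{BC})]`. -/
def ladderMap (avg : (Q → ℂ) → ℂ) (ε : Band nocc nvir → Q → ℝ)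
    (v : (n₁ n₂ n₃ n₄ : Band nocc nvir) → (k₁ k₂ k₃ : Q) → ℂ) (t : Amp nocc nvir Q) :
    Amp nocc nvir Q := fun i j a b xi xj xa =>
  let xb := xi + xj - xa
  ((energyDenom ε i j a b xi xj xa : ℝ) : ℂ)⁻¹ *
    ((avg fun xk => ∑ k, ∑ l,
        v (inl k) (inl l) (inl i) (inl j) xk (xi + xj - xk) xi * t k l a b xk (xi + xj - xk) xa)
      + (avg fun xc => ∑ c, ∑ d, v (inr a) (inr b) (inr c) (inr d) xa xb xc * t i j c d xi xj xc)
      - perm (fun i j a b xi xj xa => avg fun xk => ∑ k, ∑ c,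
          (v (inr a) (inl k) (inr c) (inl i) xa xk (xa + xk - xi) * t k j c b xk xj (xa + xk - xi)
            + v (inr a) (inl k) (inr c) (inl j) xa xk (xa + xk - xj) *
              t k i b c xk xi (xi + xj - xa)))
        i j a b xi xj xa)

end AmplitudeEquation

/-! ### Finite mesh and thermodynamic limit -/

/-- Labels of the points of an `m × m × m` mesh. Addition of labels is addition of momenta modulo
the reciprocal lattice (up to the offset of the mesh). -/
abbrev Mesh (m : ℕ) : Type := Fin 3 → ZMod m

/-- The points `k₀ + ∑ᵢ (nᵢ/m) bᵢ*` of the Monkhorst-Pack mesh `𝒦` of size `N = m³` with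
offset `k₀`. -/
def meshPoint (A : Basis (Fin 3) ℝ E3) (m : ℕ) (k₀ : E3) (x : Mesh m) : E3 :=
  k₀ + ∑ s, (((x s).val : ℝ) / (m : ℝ)) • recipBasis A s

/-- Sampling on the mesh, `t ↦ 𝓜_𝒦 t`. -/
def sample (A : Basis (Fin 3) ℝ E3) (m : ℕ) (k₀ : E3) (t : Amp nocc nvir E3) :
    Amp nocc nvir (Mesh m) := fun i j a b xi xj xa =>
  t i j a b (meshPoint A m k₀ xi) (meshPoint A m k₀ xj) (meshPoint A m k₀ xa)

/-- The averaged sum `N⁻¹ ∑_{k ∈ 𝒦}`, with `N = m³`. -/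
def meshAvg (m : ℕ) [NeZero m] (f : Mesh m → ℂ) : ℂ := ((m ^ 3 : ℕ) : ℂ)⁻¹ * ∑ x, f x

/-- The averaged integral `|Ω*|⁻¹ ∫_{Ω*}`. -/
def zoneAvg (A : Basis (Fin 3) ℝ E3) (f : E3 → ℂ) : ℂ := ⨍ k in brillouinZone A, f k

/-- Orbital energies at the mesh points. -/
def Insulator.meshEnergy (S : Insulator A nocc nvir) (m : ℕ) (k₀ : E3)
    (n : Band nocc nvir) (x : Mesh m) : ℝ := S.ε n (meshPoint A m k₀ x)

/-- Electron repulsion integrals at the mesh points. -/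
def Insulator.meshEri (S : Insulator A nocc nvir) (m : ℕ) (k₀ : E3)
    (n₁ n₂ n₃ n₄ : Band nocc nvir) (x₁ x₂ x₃ : Mesh m) : ℂ :=
  S.eri n₁ n₂ n₃ n₄ (meshPoint A m k₀ x₁) (meshPoint A m k₀ x₂) (meshPoint A m k₀ x₃)

/-- The CCD iteration map `𝓕_N` on the mesh of size `N = m³` with offset `k₀`. -/
def Insulator.ccdFinite (S : Insulator A nocc nvir) (m : ℕ) [NeZero m] (k₀ : E3)
    (T : Amp nocc nvir (Mesh m)) : Amp nocc nvir (Mesh m) :=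
  ccdMap (meshAvg m) (S.meshEnergy m k₀) (S.meshEri m k₀) T

/-- The CCD iteration map `𝓕_TDL` in the thermodynamic limit. -/
def Insulator.ccdTDL (S : Insulator A nocc nvir) (t : Amp nocc nvir E3) : Amp nocc nvir E3 :=
  ccdMap (zoneAvg A) S.ε S.eri t

/-- The ladder-type linear terms of `𝓕_N`. -/
def Insulator.ladderFinite (S : Insulator A nocc nvir) (m : ℕ) [NeZero m] (k₀ : E3)
    (T : Amp nocc nvir (Mesh m)) : Amp nocc nvir (Mesh m) :=
  ladderMap (meshAvg m) (S.meshEnergy m k₀) (S.meshEri m k₀) T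

/-- The ladder-type linear terms of `𝓕_TDL`. -/
def Insulator.ladderTDL (S : Insulator A nocc nvir) (t : Amp nocc nvir E3) : Amp nocc nvir E3 :=
  ladderMap (zoneAvg A) S.ε S.eri t

/-! ### Algebraic singularities and the amplitude space -/

/-- `f x y` is smooth near (but not at) `x = x₀`, for all `y`, with algebraic singularity of order
`γ` with respect to `x` at `x₀`:
`|∂_x^α ∂_y^β f(x, y)| ≤ C_{α,β} |x - x₀|^(γ - |α|)` for `0 < |x - x₀| < δ` and all `y`. All partial
derivatives with `|α| = a` and `|β| = b` are collected in an iterated Fréchet derivative. -/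
def HasAlgebraicSingularity {X Y : Type} [NormedAddCommGroup X] [NormedSpace ℝ X]
    [NormedAddCommGroup Y] [NormedSpace ℝ Y] (γ : ℝ) (f : X → Y → ℂ) (x₀ : X) : Prop :=
  ∃ δ > 0,
    ContDiffOn ℝ ∞ (fun p : X × Y => f p.1 p.2) {p | 0 < ‖p.1 - x₀‖ ∧ ‖p.1 - x₀‖ < δ} ∧
    ∀ a b : ℕ, ∃ C : ℝ, ∀ x y, 0 < ‖x - x₀‖ → ‖x - x₀‖ < δ →
      ‖iteratedFDeriv ℝ a (fun x' => iteratedFDeriv ℝ b (fun y' => f x' y') y) x‖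
        ≤ C * ‖x - x₀‖ ^ (γ - (a : ℝ))

/-- Membership of `f(k_i, k_j, k_a)` in the space `𝕋(Ω*)`. -/
structure InAmplitudeSpace (A : Basis (Fin 3) ℝ E3) (f : E3 → E3 → E3 → ℂ) : Prop where
  periodic_i : ∀ ki kj ka, ∀ G ∈ recipLattice A, f (ki + G) kj ka = f ki kj ka
  periodic_j : ∀ ki kj ka, ∀ G ∈ recipLattice A, f ki (kj + G) ka = f ki kj ka
  periodic_a : ∀ ki kj ka, ∀ G ∈ recipLattice A, f ki kj (ka + G) = f ki kj ka
  /-- smooth except at `k_a = k_i` and its periodic images -/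
  smooth_off : ContDiffOn ℝ ∞ (fun p : E3 × E3 × E3 => f p.1 p.2.1 p.2.2)
    {p | p.2.2 - p.1 ∉ recipLattice A}
  /-- algebraic singularity of order `0` at `q = k_a - k_i = 0`, with smooth variables `k_i, k_j` -/
  singular : HasAlgebraicSingularity 0 (fun (q : E3) (k : E3 × E3) => f k.1 k.2 (k.1 + q)) 0
  /-- smooth in `k_i, k_j` at the nonsmooth points `k_a = k_i` -/
  smooth_on : ContDiff ℝ ∞ (fun k : E3 × E3 => f k.1 k.2 k.1)

end PeriodicCCD

end

open Module MeasureTheory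
open scoped ContDiff ComplexConjugate

noncomputable section

namespace PeriodicCCD

variable {A : Basis (Fin 3) ℝ E3} {nocc nvir : ℕ}

/-! The theorem reduces to the accuracy of averaged mesh sums for periodic functions with point
singularities.

Quadrature. The mesh mean of `F (· + y)`, averaged over all `y`, is the exact zone average, and
translation by a mesh vector permutes the mesh modulo the reciprocal lattice. Hence the quadrature
error is bounded by mesh means of `F (· + z) - F` with `|z| = O(1/m)`. Such a difference has zero
zone average, so the argument repeats, and after four rounds only fourth differences remain. At
distance `d` from singularities of order 0 these are `O((m d)⁻⁴)`; as 4 exceeds the dimension 3,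
their sum over the mesh is bounded uniformly in `m`, the offset and the position of the
singularities. The error is therefore `O(m⁻³) = O(1/N)` (`exists_quadrature_bound`). For a
singularity of order -2 at a mesh point, times a function of order 0, the integrand is cut at radius
`1/(2m)`. The outer part is `O(m²)` in size, so the same estimate gives `O(m⁻¹)`; in the inner part
the mesh values are `O(m²)`, carry weight `m⁻³` and are few, and the integral of `|x|⁻²` is `O(1/m)`
(`exists_doublePole_quadrature_bound`).

Integrals. Near `q = 0` an ERI is `|q|⁻²` times a smooth function of `(q, k₁, k₂)`. The term `G = 0`
contributes a product of two charges; the rest of the lattice sum is an `ℓ²` inner product of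
Fourier coefficients with a multiplier that is smooth into `ℓ^∞`. By orthonormality the charges at
`q = 0` are Kronecker deltas. If both pairs consist of different bands, the numerator vanishes to
second order and the ERI has order 0 (`eri_singular_zero`). In general the order is -2
(`eri_singular_two`), and for matching bands the numerator tends to `4π/|Ω| ≠ 0`, so no better order
is possible (`eri_not_singular`).

Iteration map. Outside the ladder terms, every ERI under an average pairs an occupied with a virtual
band twice, so all integrands have order 0 in each averaged momentum and the error is `O(1/N)`
(`exists_rest_bound`). In the ladder terms one factor has order -2, with its pole at an external
momentum, which lies on the mesh; this gives `O(N^(-1/3))` (`exists_ladder_bound`). -/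

/-! ### Distance to the reciprocal lattice -/

/-- The distance to the reciprocal lattice. -/
def latDist (A : Basis (Fin 3) ℝ E3) (q : E3) : ℝ := Metric.infDist q (recipLattice A : Set E3)

theorem isClosed_recipLattice (A : Basis (Fin 3) ℝ E3) :
    IsClosed (recipLattice A : Set E3) :=
  AddSubgroup.isClosed_of_discrete (H := (recipLattice A).toAddSubgroup)

theorem recipLattice_nonempty (A : Basis (Fin 3) ℝ E3) :
    (recipLattice A : Set E3).Nonempty := ⟨0, zero_mem _⟩

theorem latDist_nonneg (q : E3) : 0 ≤ latDist A q := Metric.infDist_nonneg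

theorem continuous_latDist : Continuous (latDist A) := Metric.continuous_infDist_pt _

theorem latDist_le (q : E3) {G : E3} (hG : G ∈ recipLattice A) : latDist A q ≤ ‖q - G‖ := by
  rw [← dist_eq_norm]
  exact Metric.infDist_le_dist_of_mem hG

theorem latDist_le_norm (q : E3) : latDist A q ≤ ‖q‖ := by
  simpa using latDist_le (A := A) q (zero_mem _)

theorem exists_nearest (A : Basis (Fin 3) ℝ E3) (q : E3) :
    ∃ G ∈ recipLattice A, latDist A q = ‖q - G‖ := by
  obtain ⟨G, hG, h⟩ := (isClosed_recipLattice A).exists_infDist_eq_dist (recipLattice_nonempty A) q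
  exact ⟨G, hG, by rw [latDist, h, dist_eq_norm]⟩

theorem latDist_le_add (x y : E3) : latDist A x ≤ latDist A y + ‖x - y‖ := by
  rw [← dist_eq_norm]
  exact Metric.infDist_le_infDist_add_dist

theorem latDist_add (q : E3) {G : E3} (hG : G ∈ recipLattice A) :
    latDist A (q + G) = latDist A q := by
  apply le_antisymm
  · obtain ⟨G', hG', h⟩ := exists_nearest A q
    rw [h]
    refine (latDist_le _ (add_mem hG' hG)).trans_eq ?_
    congr 1
    abel
  · obtain ⟨G', hG', h⟩ := exists_nearest A (q + G)
    rw [h]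
    refine (latDist_le _ (sub_mem hG' hG)).trans_eq ?_
    congr 1
    abel

theorem latDist_neg (q : E3) : latDist A (-q) = latDist A q := by
  have key : ∀ q : E3, latDist A (-q) ≤ latDist A q := by
    intro q
    obtain ⟨G, hG, h⟩ := exists_nearest A q
    rw [h]
    refine (latDist_le _ (neg_mem hG)).trans_eq ?_
    rw [← norm_neg]
    congr 1
    abel
  refine le_antisymm (key q) ?_
  simpa using key (-q)

theorem latDist_pos_iff {q : E3} : 0 < latDist A q ↔ q ∉ recipLattice A :=
  ((isClosed_recipLattice A).notMem_iff_infDist_pos (recipLattice_nonempty A)).symm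

theorem latDist_eq_zero {q : E3} (h : q ∈ recipLattice A) : latDist A q = 0 := by
  by_contra h'
  exact latDist_pos_iff.1 (lt_of_le_of_ne (latDist_nonneg q) (Ne.symm h')) h

/-- A bound for the diameter of the Brillouin zone. -/
def zoneBound (A : Basis (Fin 3) ℝ E3) : ℝ := 1 + ∑ i, ‖recipBasis A i‖

theorem zoneBound_pos : 1 ≤ zoneBound A := by
  have : 0 ≤ ∑ i, ‖recipBasis A i‖ := Finset.sum_nonneg fun _ _ => norm_nonneg _
  unfold zoneBound
  linarith

theorem exists_reduce (A : Basis (Fin 3) ℝ E3) (q : E3) :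
    ∃ G ∈ recipLattice A, ‖q - G‖ ≤ zoneBound A := by
  refine ⟨ZSpan.floor (recipBasis A) q, (ZSpan.floor (recipBasis A) q).2, ?_⟩
  have := ZSpan.norm_fract_le (recipBasis A) q
  rw [ZSpan.fract_apply] at this
  unfold zoneBound
  linarith

theorem exists_norm_lower_bound (A : Basis (Fin 3) ℝ E3) :
    ∃ l : ℝ, 0 < l ∧ ∀ G ∈ recipLattice A, G ≠ 0 → l ≤ ‖G‖ := by
  have h : IsOpen ({0} : Set (recipLattice A)) := isOpen_discrete _
  obtain ⟨l, hl, hl'⟩ := Metric.isOpen_iff.1 h 0 rfl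
  refine ⟨l, hl, fun G hG hG0 => ?_⟩
  by_contra hlt
  push Not at hlt
  have : (⟨G, hG⟩ : recipLattice A) ∈ ({0} : Set (recipLattice A)) := by
    apply hl'
    rw [Metric.mem_ball, dist_zero_right]
    exact hlt
  exact hG0 (congrArg Subtype.val this)

/-! ### Lattice sums -/

/-- The exponent 4 exceeds the dimension 3. Uniformity in the centre: `c` lies within `zoneBound A`
of a lattice vector, and moving the centre there costs a factor `(1 + D) ^ 4`. -/
theorem exists_lattice_sum_bound (A : Basis (Fin 3) ℝ E3) :
    ∃ C : ℝ, 0 ≤ C ∧ ∀ (c : E3) (s : Finset (recipLattice A)),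
      ∑ y ∈ s, ((1 + ‖(y : E3) - c‖) ^ 4)⁻¹ ≤ C := by
  have hsum : Summable fun y : recipLattice A => ((1 + ‖(y : E3)‖) ^ 4)⁻¹ := by
    have h := ZLattice.summable_norm_sub_inv_pow (recipLattice A) 4
      (by rw [ZLattice.rank ℝ]; simp) 0
    -- At `y = 0` the inverse power is 0 by convention while the summand to be dominated is 1; this
    -- indicator makes up for it.
    have h0 : Summable (fun y : recipLattice A => if y = 0 then (1 : ℝ) else 0) :=
      (hasSum_ite_eq 0 1).summable
    refine Summable.of_nonneg_of_le (fun y => by positivity) (fun y => ?_) (h.add h0)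
    by_cases hy : y = 0
    · simp [hy]
    · have hy' : 0 < ‖(y : E3)‖ := by simpa using hy
      simp only [hy, if_false, add_zero, sub_zero]
      rw [inv_pow]
      gcongr
      linarith
  set D := zoneBound A
  have hD : 0 ≤ D := zero_le_one.trans zoneBound_pos
  refine ⟨(1 + D) ^ 4 * ∑' y : recipLattice A, ((1 + ‖(y : E3)‖) ^ 4)⁻¹,
    mul_nonneg (by positivity) (tsum_nonneg fun y => by positivity), fun c s => ?_⟩
  obtain ⟨g, hc⟩ : ∃ g : recipLattice A, ‖c - (g : E3)‖ ≤ D := by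
    obtain ⟨G, hG, hc⟩ := exists_reduce A c
    exact ⟨⟨G, hG⟩, hc⟩
  have hsum' : Summable fun y : recipLattice A => ((1 + ‖((y - g : recipLattice A) : E3)‖) ^ 4)⁻¹ :=
    (Equiv.subRight g).summable_iff.2 hsum
  have htsum : ∑' y : recipLattice A, ((1 + ‖((y - g : recipLattice A) : E3)‖) ^ 4)⁻¹ =
      ∑' y : recipLattice A, ((1 + ‖(y : E3)‖) ^ 4)⁻¹ :=
    (Equiv.subRight g).tsum_eq fun y : recipLattice A => ((1 + ‖(y : E3)‖) ^ 4)⁻¹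
  have hle : ∀ y : recipLattice A, ((1 + ‖(y : E3) - c‖) ^ 4)⁻¹ ≤
      (1 + D) ^ 4 * ((1 + ‖((y - g : recipLattice A) : E3)‖) ^ 4)⁻¹ := by
    intro y
    have h1 : 1 + ‖((y - g : recipLattice A) : E3)‖ ≤ (1 + D) * (1 + ‖(y : E3) - c‖) := by
      have h2 : ((y - g : recipLattice A) : E3) = ((y : E3) - c) + (c - (g : E3)) := by
        push_cast
        abel
      have h3 := norm_add_le ((y : E3) - c) (c - (g : E3))
      rw [← h2] at h3
      nlinarith [norm_nonneg ((y : E3) - c)]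
    rw [← div_eq_mul_inv, le_div_iff₀ (by positivity), inv_mul_le_iff₀ (by positivity), ← mul_pow,
      mul_comm]
    gcongr
  calc ∑ y ∈ s, ((1 + ‖(y : E3) - c‖) ^ 4)⁻¹
      ≤ ∑ y ∈ s, (1 + D) ^ 4 * ((1 + ‖((y - g : recipLattice A) : E3)‖) ^ 4)⁻¹ :=
        Finset.sum_le_sum fun y _ => hle y
    _ = (1 + D) ^ 4 * ∑ y ∈ s, ((1 + ‖((y - g : recipLattice A) : E3)‖) ^ 4)⁻¹ := by
        rw [Finset.mul_sum]
    _ ≤ _ := by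
        rw [← htsum]
        exact mul_le_mul_of_nonneg_left
          (Summable.sum_le_tsum s (fun y _ => by positivity) hsum') (by positivity)

/-! ### Meshes -/

theorem meshPoint_sub_mem (m : ℕ) [NeZero m] (k₀ : E3) (x y : Mesh m) :
    (m : ℝ) • (meshPoint A m k₀ x - meshPoint A m k₀ y) ∈ recipLattice A := by
  have hm : (m : ℝ) ≠ 0 := Nat.cast_ne_zero.2 (NeZero.ne m)
  have : (m : ℝ) • (meshPoint A m k₀ x - meshPoint A m k₀ y) =
      ∑ s, (((x s).val : ℤ) - ((y s).val : ℤ)) • recipBasis A s := by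
    simp only [meshPoint, add_sub_add_left_eq_sub, ← Finset.sum_sub_distrib, Finset.smul_sum]
    refine Finset.sum_congr rfl fun s _ => ?_
    rw [← sub_smul, smul_smul, ← Int.cast_smul_eq_zsmul ℝ]
    congr 1
    push_cast
    field_simp
  rw [this]
  exact Submodule.sum_mem _ fun s _ =>
    Submodule.smul_mem _ _ (Submodule.subset_span ⟨s, rfl⟩)

theorem sum_smul_mem_iff (c : Fin 3 → ℝ) :
    ∑ s, c s • recipBasis A s ∈ recipLattice A ↔ ∀ s, ∃ z : ℤ, (z : ℝ) = c s := by
  rw [Basis.mem_span_iff_repr_mem]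
  have h : ∀ s, (recipBasis A).repr (∑ s, c s • recipBasis A s) s = c s := fun s => by
    rw [Basis.repr_sum_self]
  simp only [h, Set.mem_range, algebraMap_int_eq, eq_intCast]

theorem meshPoint_injective_mod (m : ℕ) [NeZero m] (k₀ : E3) {x y : Mesh m}
    (h : meshPoint A m k₀ x - meshPoint A m k₀ y ∈ recipLattice A) : x = y := by
  have hm : (m : ℝ) ≠ 0 := Nat.cast_ne_zero.2 (NeZero.ne m)
  have h1 : meshPoint A m k₀ x - meshPoint A m k₀ y =
      ∑ s, ((((x s).val : ℝ) - (y s).val) / m) • recipBasis A s := by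
    simp only [meshPoint, add_sub_add_left_eq_sub, ← Finset.sum_sub_distrib, ← sub_smul, sub_div]
  rw [h1, sum_smul_mem_iff] at h
  funext s
  obtain ⟨z, hz⟩ := h s
  have h2 : ((x s).val : ℤ) - ((y s).val : ℤ) = m * z := by
    have : ((x s).val : ℝ) - (y s).val = m * z := by rw [hz]; field_simp
    exact_mod_cast this
  have h3 : (((x s).val : ℤ) : ZMod m) = (((y s).val : ℤ) : ZMod m) := by
    rw [ZMod.intCast_eq_intCast_iff_dvd_sub]
    exact ⟨-z, by linarith⟩
  simpa using h3

theorem meshPoint_add_mem (m : ℕ) [NeZero m] (k₀ : E3) (x n : Mesh m) :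
    meshPoint A m k₀ (x + n) - (meshPoint A m k₀ x + meshPoint A m 0 n) ∈ recipLattice A := by
  have hm : (m : ℝ) ≠ 0 := Nat.cast_ne_zero.2 (NeZero.ne m)
  have h1 : meshPoint A m k₀ (x + n) - (meshPoint A m k₀ x + meshPoint A m 0 n) =
      ∑ s, ((((x + n) s).val : ℝ) / m - (x s).val / m - (n s).val / m) • recipBasis A s := by
    simp only [meshPoint, sub_smul, Finset.sum_sub_distrib]
    abel
  rw [h1, sum_smul_mem_iff]
  intro s
  have h2 : (m : ℤ) ∣ ((x + n) s).val - ((x s).val + (n s).val) := by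
    rw [← ZMod.intCast_eq_intCast_iff_dvd_sub]
    simp
  obtain ⟨z, hz⟩ := h2
  refine ⟨z, ?_⟩
  have : (((x + n) s).val : ℝ) - ((x s).val + (n s).val) = m * z := by exact_mod_cast hz
  field_simp
  linarith

/-- The coefficients of `x + y - z` add up to one, so the offset appears equally often on both
sides. This is why crystal momentum conservation does not leave a mesh with an offset. -/
theorem meshPoint_comb_mem (m : ℕ) [NeZero m] (k₀ : E3) (x y z : Mesh m) :
    meshPoint A m k₀ (x + y - z) - (meshPoint A m k₀ x + meshPoint A m k₀ y - meshPoint A m k₀ z)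
      ∈ recipLattice A := by
  have h1 := meshPoint_add_mem (A := A) m k₀ (x + y - z) z
  have h2 := meshPoint_add_mem (A := A) m k₀ x y
  rw [sub_add_cancel] at h1
  have h3 : ∀ w, meshPoint A m 0 w = meshPoint A m k₀ w - k₀ := fun w => by simp [meshPoint]
  rw [h3] at h1 h2
  convert sub_mem h2 h1 using 1
  abel

/-- For a point `p`, the mesh points cluster around the translates of `p` no more than on the
scale of the mesh. -/
theorem exists_mesh_sum_bound (A : Basis (Fin 3) ℝ E3) :
    ∃ C : ℝ, 0 ≤ C ∧ ∀ (m : ℕ) [NeZero m] (k₀ p : E3),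
      ∑ x : Mesh m, ((1 + m * latDist A (meshPoint A m k₀ x - p)) ^ 4)⁻¹ ≤ C := by
  obtain ⟨C, hC0, hC⟩ := exists_lattice_sum_bound A
  refine ⟨C, hC0, fun m _ k₀ p => ?_⟩
  classical
  have hm : (m : ℝ) ≠ 0 := Nat.cast_ne_zero.2 (NeZero.ne m)
  choose G hG hGd using fun x : Mesh m => exists_nearest A (meshPoint A m k₀ x - p)
  have hmem : ∀ x : Mesh m, (m : ℝ) • (meshPoint A m k₀ x - meshPoint A m k₀ 0 - G x)
      ∈ recipLattice A := fun x => by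
    rw [smul_sub, Nat.cast_smul_eq_nsmul ℝ m (G x)]
    exact sub_mem (meshPoint_sub_mem m k₀ x 0) (Submodule.smul_of_tower_mem _ m (hG x))
  -- Each mesh point is moved to its representative nearest to `p` and scaled by `m`. This embeds
  -- the mesh into the lattice and turns `m * latDist` into a distance to one fixed centre, so the
  -- lattice bound applies.
  let Y : Mesh m → recipLattice A := fun x => ⟨_, hmem x⟩
  have hY : Function.Injective Y := by
    intro x y hxy
    have h1 : (m : ℝ) • (meshPoint A m k₀ x - meshPoint A m k₀ 0 - G x) =
        (m : ℝ) • (meshPoint A m k₀ y - meshPoint A m k₀ 0 - G y) := congrArg Subtype.val hxy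
    have h2 := smul_right_injective E3 hm h1
    apply meshPoint_injective_mod (A := A) m k₀
    have : meshPoint A m k₀ x - meshPoint A m k₀ y = G x - G y := by
      have h3 : meshPoint A m k₀ x - meshPoint A m k₀ 0 - G x =
        meshPoint A m k₀ y - meshPoint A m k₀ 0 - G y := h2
      have h4 := congrArg (· + meshPoint A m k₀ 0 + G x - meshPoint A m k₀ y) h3
      calc _ = meshPoint A m k₀ x - meshPoint A m k₀ 0 - G x + meshPoint A m k₀ 0 + G x
            - meshPoint A m k₀ y := by abel
        _ = _ := h4
        _ = _ := by abel
    rw [this]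
    exact sub_mem (hG x) (hG y)
  have hval : ∀ x, m * latDist A (meshPoint A m k₀ x - p) =
      ‖(Y x : E3) - (m : ℝ) • (p - meshPoint A m k₀ 0)‖ := by
    intro x
    rw [hGd, show (Y x : E3) = (m : ℝ) • (meshPoint A m k₀ x - meshPoint A m k₀ 0 - G x) from rfl,
      ← smul_sub, norm_smul, Real.norm_natCast]
    congr 2
    abel
  calc ∑ x : Mesh m, ((1 + m * latDist A (meshPoint A m k₀ x - p)) ^ 4)⁻¹
      = ∑ y ∈ Finset.univ.map ⟨Y, hY⟩,
          ((1 + ‖(y : E3) - (m : ℝ) • (p - meshPoint A m k₀ 0)‖) ^ 4)⁻¹ := by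
        rw [Finset.sum_map]
        simp only [hval, Function.Embedding.coeFn_mk]
    _ ≤ C := hC _ _

/-! ### Quadrature error of mesh means for periodic functions with point singularities -/

/-! ### Averages over the Brillouin zone and over a mesh -/

/-- Periodicity with respect to the reciprocal lattice. -/
def LatPeriodic {E : Type} (A : Basis (Fin 3) ℝ E3) (F : E3 → E) : Prop :=
  ∀ x, ∀ G ∈ recipLattice A, F (x + G) = F x

theorem LatPeriodic.eq_of_sub_mem {E : Type} {F : E3 → E} (hF : LatPeriodic A F) {x y : E3}
    (h : x - y ∈ recipLattice A) : F x = F y := by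
  rw [← hF y _ h]
  congr 1
  abel

/-- The average of a function of the momentum over the points of a mesh. -/
def meshMean (A : Basis (Fin 3) ℝ E3) (m : ℕ) [NeZero m] (k₀ : E3) (F : E3 → ℂ) : ℂ :=
  meshAvg m fun x => F (meshPoint A m k₀ x)

theorem card_mesh (m : ℕ) [NeZero m] : Fintype.card (Mesh m) = m ^ 3 := by
  simp [Mesh, ZMod.card]

theorem meshMean_const (m : ℕ) [NeZero m] (k₀ : E3) (c : ℂ) :
    meshMean A m k₀ (fun _ => c) = c := by
  have : ((m ^ 3 : ℕ) : ℂ) ≠ 0 := Nat.cast_ne_zero.2 (pow_ne_zero _ (NeZero.ne m))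
  simp only [meshMean, meshAvg, Finset.sum_const, Finset.card_univ, card_mesh, nsmul_eq_mul]
  field_simp

theorem meshMean_add (m : ℕ) [NeZero m] (k₀ : E3) (F G : E3 → ℂ) :
    meshMean A m k₀ (fun x => F x + G x) = meshMean A m k₀ F + meshMean A m k₀ G := by
  simp only [meshMean, meshAvg, Finset.sum_add_distrib, mul_add]

theorem meshMean_const_mul (m : ℕ) [NeZero m] (k₀ : E3) (c : ℂ) (F : E3 → ℂ) :
    meshMean A m k₀ (fun x => c * F x) = c * meshMean A m k₀ F := by
  simp only [meshMean, meshAvg, ← Finset.mul_sum]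
  ring

theorem meshMean_neg (m : ℕ) [NeZero m] (k₀ : E3) (F : E3 → ℂ) :
    meshMean A m k₀ (fun x => -F x) = -meshMean A m k₀ F := by
  simpa using meshMean_const_mul (A := A) m k₀ (-1) F

theorem meshMean_sub (m : ℕ) [NeZero m] (k₀ : E3) (F G : E3 → ℂ) :
    meshMean A m k₀ (fun x => F x - G x) = meshMean A m k₀ F - meshMean A m k₀ G := by
  simp only [sub_eq_add_neg, meshMean_add, meshMean_neg]

theorem norm_meshMean_le_sum (m : ℕ) [NeZero m] (k₀ : E3) (F : E3 → ℂ) :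
    ‖meshMean A m k₀ F‖ ≤ ((m : ℝ) ^ 3)⁻¹ * ∑ x : Mesh m, ‖F (meshPoint A m k₀ x)‖ := by
  rw [meshMean, meshAvg, norm_mul, norm_inv, Complex.norm_natCast]
  push_cast
  gcongr
  exact norm_sum_le _ _

theorem norm_meshMean_le (m : ℕ) [NeZero m] (k₀ : E3) {F : E3 → ℂ} {K : ℝ}
    (h : ∀ x, ‖F x‖ ≤ K) : ‖meshMean A m k₀ F‖ ≤ K := by
  have hm : (m : ℝ) ≠ 0 := Nat.cast_ne_zero.2 (NeZero.ne m)
  refine (norm_meshMean_le_sum m k₀ F).trans ?_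
  have : ∑ x : Mesh m, ‖F (meshPoint A m k₀ x)‖ ≤ ∑ _x : Mesh m, K :=
    Finset.sum_le_sum fun x _ => h _
  rw [Finset.sum_const, Finset.card_univ, card_mesh, nsmul_eq_mul] at this
  rw [inv_mul_le_iff₀ (by positivity)]
  exact_mod_cast this

theorem volume_zone_ne_zero : volume (brillouinZone A) ≠ 0 :=
  ZSpan.measure_fundamentalDomain_ne_zero _

theorem volume_zone_ne_top : volume (brillouinZone A) ≠ ⊤ :=
  ((ZSpan.fundamentalDomain_isBounded (recipBasis A)).measure_lt_top).ne

instance : IsFiniteMeasure (volume.restrict (brillouinZone A)) :=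
  ⟨by rw [Measure.restrict_apply_univ]; exact lt_top_iff_ne_top.2 volume_zone_ne_top⟩

theorem volume_zone_pos : 0 < volume.real (brillouinZone A) :=
  ENNReal.toReal_pos volume_zone_ne_zero volume_zone_ne_top

theorem zoneAvg_eq (F : E3 → ℂ) :
    zoneAvg A F = (((volume.real (brillouinZone A))⁻¹ : ℝ) : ℂ) * ∫ k in brillouinZone A, F k := by
  rw [zoneAvg, setAverage_eq, Complex.real_smul]

theorem zoneAvg_const (c : ℂ) : zoneAvg A (fun _ => c) = c := by
  rw [zoneAvg]
  exact setAverage_const volume_zone_ne_zero volume_zone_ne_top c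

theorem zoneAvg_const_mul (c : ℂ) (F : E3 → ℂ) :
    zoneAvg A (fun x => c * F x) = c * zoneAvg A F := by
  rw [zoneAvg_eq, zoneAvg_eq, integral_const_mul]
  ring

theorem zoneAvg_add {F G : E3 → ℂ} (hF : IntegrableOn F (brillouinZone A))
    (hG : IntegrableOn G (brillouinZone A)) :
    zoneAvg A (fun x => F x + G x) = zoneAvg A F + zoneAvg A G := by
  rw [zoneAvg_eq, zoneAvg_eq, zoneAvg_eq, integral_add hF hG, mul_add]

theorem zoneAvg_sub {F G : E3 → ℂ} (hF : IntegrableOn F (brillouinZone A))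
    (hG : IntegrableOn G (brillouinZone A)) :
    zoneAvg A (fun x => F x - G x) = zoneAvg A F - zoneAvg A G := by
  rw [zoneAvg_eq, zoneAvg_eq, zoneAvg_eq, integral_sub hF hG, mul_sub]

theorem norm_zoneAvg_le {F : E3 → ℂ} {K : ℝ} (h : ∀ x, ‖F x‖ ≤ K) : ‖zoneAvg A F‖ ≤ K := by
  have h1 := norm_setIntegral_le_of_norm_le_const (μ := volume) (s := brillouinZone A) (f := F)
    (lt_top_iff_ne_top.2 volume_zone_ne_top) fun x _ => h x
  rw [zoneAvg_eq, norm_mul, Complex.norm_real, Real.norm_of_nonneg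
    (inv_nonneg.2 volume_zone_pos.le), inv_mul_le_iff₀ volume_zone_pos, mul_comm]
  exact h1

theorem integrableOn_zone {F : E3 → ℂ} {K : ℝ} (hF : Measurable F) (h : ∀ x, ‖F x‖ ≤ K) :
    IntegrableOn F (brillouinZone A) :=
  Integrable.of_bound hF.aestronglyMeasurable K (Filter.Eventually.of_forall h)

theorem isAddFundamentalDomain_zone :
    IsAddFundamentalDomain (recipLattice A) (brillouinZone A) (volume : Measure E3) :=
  ZSpan.isAddFundamentalDomain (recipBasis A) volume

/-- A translate of a fundamental domain is again a fundamental domain, and a periodic function has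
the same integral over both. -/
theorem zoneAvg_translate {F : E3 → ℂ} (hF : LatPeriodic A F) (y : E3) :
    zoneAvg A (fun x => F (y + x)) = zoneAvg A F := by
  have : VAddInvariantMeasure (recipLattice A) E3 volume :=
    inferInstanceAs (VAddInvariantMeasure (recipLattice A).toAddSubgroup E3 volume)
  have : VAddCommClass E3 (recipLattice A) E3 := ⟨fun a g x => by
    simp only [Submodule.vadd_def, vadd_eq_add]
    abel⟩
  have h := (isAddFundamentalDomain_zone (A := A)).vadd_of_comm y
  have h1 := h.setIntegral_eq isAddFundamentalDomain_zone (f := F) fun g x => by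
    rw [Submodule.vadd_def, vadd_eq_add, add_comm]
    exact hF x g g.2
  have h2 := (measurePreserving_vadd y (volume : Measure E3)).setIntegral_image_emb
    (measurableEmbedding_const_vadd y) F (brillouinZone A)
  rw [zoneAvg_eq, zoneAvg_eq, ← h1, ← Set.image_vadd, h2]
  rfl

theorem zoneAvg_meshMean (m : ℕ) [NeZero m] (k₀ : E3) {D : E3 → E3 → ℂ}
    (h : ∀ x, IntegrableOn (D x) (brillouinZone A)) :
    zoneAvg A (fun y => meshMean A m k₀ fun x => D x y) =
      meshMean A m k₀ fun x => zoneAvg A (D x) := by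
  simp only [meshMean, meshAvg, zoneAvg_const_mul]
  congr 1
  simp only [zoneAvg_eq]
  rw [integral_finsetSum _ fun x _ => h _, Finset.mul_sum]

/-! ### Reduction of the quadrature error to differences on the scale of the mesh -/

theorem LatPeriodic.translate {F : E3 → ℂ} (hF : LatPeriodic A F) (z : E3) :
    LatPeriodic A fun x => F (x + z) := fun x G hG => by
  simp only
  rw [← hF (x + z) G hG]
  congr 1
  abel

theorem LatPeriodic.sub {F G : E3 → ℂ} (hF : LatPeriodic A F) (hG : LatPeriodic A G) :
    LatPeriodic A fun x => F x - G x := fun x g hg => by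
  simp only [hF x g hg, hG x g hg]

/-- Reduce `m • y` modulo the reciprocal lattice to get `G`. Translation by `m⁻¹ • G` permutes the
mesh modulo the lattice, and the remainder `y - m⁻¹ • G` has the size of a mesh cell. -/
theorem exists_small_translation (m : ℕ) [NeZero m] (k₀ y : E3) :
    ∃ z : E3, ‖z‖ ≤ zoneBound A / m ∧ ∀ F : E3 → ℂ, LatPeriodic A F →
      meshMean A m k₀ (fun x => F (x + y)) = meshMean A m k₀ (fun x => F (x + z)) := by
  have hm : (m : ℝ) ≠ 0 := Nat.cast_ne_zero.2 (NeZero.ne m)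
  have hm0 : (0 : ℝ) < m := Nat.cast_pos.2 (NeZero.pos m)
  obtain ⟨G, hG, hGn⟩ := exists_reduce A ((m : ℝ) • y)
  rw [Basis.mem_span_iff_repr_mem] at hG
  choose c hc using hG
  simp only [algebraMap_int_eq, eq_intCast] at hc
  have hGs : G = ∑ s, (c s : ℝ) • recipBasis A s := by
    conv_lhs => rw [← (recipBasis A).sum_repr G]
    simp only [hc]
  let n : Mesh m := fun s => (c s : ZMod m)
  have hn : (m : ℝ)⁻¹ • G - meshPoint A m 0 n ∈ recipLattice A := by
    have h1 : (m : ℝ)⁻¹ • G - meshPoint A m 0 n =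
        ∑ s, ((c s : ℝ) / m - ((n s).val : ℝ) / m) • recipBasis A s := by
      rw [hGs]
      simp only [meshPoint, zero_add, sub_smul, Finset.sum_sub_distrib, Finset.smul_sum, smul_smul]
      congr 2
      funext s
      rw [div_eq_inv_mul]
    rw [h1, sum_smul_mem_iff]
    intro s
    have h2 : (m : ℤ) ∣ c s - (n s).val := by
      rw [← ZMod.intCast_eq_intCast_iff_dvd_sub]
      simp [n]
    obtain ⟨z, hz⟩ := h2
    refine ⟨z, ?_⟩
    have : (c s : ℝ) - (n s).val = m * z := by exact_mod_cast hz
    field_simp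
    linarith
  refine ⟨y - (m : ℝ)⁻¹ • G, ?_, fun F hF => ?_⟩
  · have : y - (m : ℝ)⁻¹ • G = (m : ℝ)⁻¹ • ((m : ℝ) • y - G) := by
      rw [smul_sub, smul_smul, inv_mul_cancel₀ hm, one_smul]
    rw [this, norm_smul, norm_inv, Real.norm_natCast, div_eq_inv_mul]
    gcongr
  · simp only [meshMean, meshAvg]
    congr 1
    rw [← _root_.Equiv.sum_comp (Equiv.addRight n)
      fun x => F (meshPoint A m k₀ x + (y - (m : ℝ)⁻¹ • G))]
    refine Finset.sum_congr rfl fun x _ => hF.eq_of_sub_mem ?_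
    simp only [Equiv.coe_addRight]
    have h3 := sub_mem hn (meshPoint_add_mem (A := A) m k₀ x n)
    convert h3 using 1
    abel

/-- The zone average over `y` of the mesh mean of `F (· + y)` is the exact average of `F`. The error
is thus an average over `y` of mesh means of differences, in which `y` may be replaced by a small
translation. -/
theorem quadrature_error_le_of_difference (m : ℕ) [NeZero m] (k₀ : E3) {F : E3 → ℂ} {B K : ℝ}
    (hF : LatPeriodic A F) (hm : Measurable F) (hB : ∀ x, ‖F x‖ ≤ B)
    (h : ∀ z : E3, ‖z‖ ≤ zoneBound A / m → ‖meshMean A m k₀ fun x => F (x + z) - F x‖ ≤ K) :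
    ‖meshMean A m k₀ F - zoneAvg A F‖ ≤ K := by
  have h1 : zoneAvg A (fun y => meshMean A m k₀ fun x => F (x + y)) = zoneAvg A F := by
    rw [zoneAvg_meshMean (D := fun x y => F (x + y)) m k₀ fun x =>
      integrableOn_zone (hm.comp (measurable_const_add x)) fun y => hB _]
    simp only [zoneAvg_translate hF, meshMean_const]
  have h2 : zoneAvg A F - meshMean A m k₀ F =
      zoneAvg A (fun y => meshMean A m k₀ fun x => F (x + y) - F x) := by
    simp only [meshMean_sub]
    rw [zoneAvg_sub, h1, zoneAvg_const]
    · refine integrableOn_zone (K := B) ?_ fun y => norm_meshMean_le m k₀ fun x => hB _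
      simp only [meshMean, meshAvg]
      fun_prop
    · exact integrableOn_const volume_zone_ne_top
  rw [norm_sub_rev, h2]
  refine norm_zoneAvg_le fun y => ?_
  obtain ⟨z, hz, hzF⟩ := exists_small_translation (A := A) m k₀ y
  simp only [meshMean_sub, hzF F hF] at h ⊢
  exact h z hz

/-- Iterated forward differences. -/
def diffs : List E3 → (E3 → ℂ) → E3 → ℂ
  | [], F => F
  | z :: l, F => diffs l fun x => F (x + z) - F x

/-- The zone average of `F (· + z) - F` is zero, so the mesh mean of this difference is itself a
quadrature error, to which the previous lemma applies again. -/
theorem quadrature_error_le_of_diffs (m : ℕ) [NeZero m] (k₀ : E3) {K : ℝ} (n : ℕ) :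
    ∀ {F : E3 → ℂ} {B : ℝ}, LatPeriodic A F → Measurable F → (∀ x, ‖F x‖ ≤ B) →
    (∀ l : List E3, l.length = n + 1 → (∀ z ∈ l, ‖z‖ ≤ zoneBound A / m) →
      ‖meshMean A m k₀ (diffs l F)‖ ≤ K) →
    ‖meshMean A m k₀ F - zoneAvg A F‖ ≤ K := by
  induction n with
  | zero =>
    intro F B hF hm hB h
    refine quadrature_error_le_of_difference m k₀ hF hm hB fun z hz => ?_
    exact h [z] rfl (by simpa using hz)
  | succ n ih =>
    intro F B hF hm hB h
    refine quadrature_error_le_of_difference m k₀ hF hm hB fun z hz => ?_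
    have h0 : zoneAvg A (fun x => F (x + z) - F x) = 0 := by
      rw [zoneAvg_sub (F := fun x => F (x + z)) (integrableOn_zone (hm.comp (measurable_add_const z)) fun y => hB _)
        (integrableOn_zone hm hB)]
      have := zoneAvg_translate hF z
      simp only [add_comm z] at this
      rw [this, sub_self]
    have h1 := ih (F := fun x => F (x + z) - F x) (B := B + B) ((hF.translate z).sub hF)
      ((hm.comp (measurable_add_const z)).sub hm)
      (fun x => (norm_sub_le _ _).trans (add_le_add (hB _) (hB _)))
      fun l hl hlz => h (z :: l) (by simp [hl]) (by
        intro w hw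
        rcases List.mem_cons.1 hw with rfl | hw
        · exact hz
        · exact hlz w hw)
    rwa [h0, sub_zero] at h1

theorem norm_diffs_le_of_bound (l : List E3) : ∀ {F : E3 → ℂ} {B : ℝ}, (∀ x, ‖F x‖ ≤ B) →
    ∀ x, ‖diffs l F x‖ ≤ 2 ^ l.length * B := by
  induction l with
  | nil => intro F B hB x; simpa [diffs] using hB x
  | cons z l ih =>
    intro F B hB x
    have := ih (F := fun x => F (x + z) - F x) (B := B + B)
      (fun x => (norm_sub_le _ _).trans (add_le_add (hB _) (hB _))) x
    rw [diffs, List.length_cons, pow_succ]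
    linarith

/-- Each forward difference uses up one derivative and gains one factor `r` by the mean value
inequality; the points involved drift by at most `r` per difference. -/
theorem norm_diffs_le (l : List E3) {r K : ℝ} (hr : 0 ≤ r) (hl : ∀ z ∈ l, ‖z‖ ≤ r) :
    ∀ {F : E3 → ℂ} {x : E3}, (∀ y, ‖y - x‖ ≤ l.length * r →
      ContDiffAt ℝ l.length F y ∧ ‖iteratedFDeriv ℝ l.length F y‖ ≤ K) →
    ‖diffs l F x‖ ≤ K * r ^ l.length := by
  induction l generalizing K with
  | nil =>
    intro F x h
    have := (h x (by simp)).2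
    simpa [diffs] using this
  | cons z l ih =>
    intro F x h
    have hz : ‖z‖ ≤ r := hl z (by simp)
    simp only [List.length_cons] at h
    rw [diffs, List.length_cons, pow_succ, mul_comm (r ^ l.length), ← mul_assoc]
    refine ih (K := K * r) (fun w hw => hl w (List.mem_cons_of_mem _ hw)) fun y hy => ?_
    have hy1 : ‖y - x‖ ≤ ((l.length + 1 : ℕ) : ℝ) * r := by
      push_cast
      nlinarith
    have hy2 : ‖y + z - x‖ ≤ ((l.length + 1 : ℕ) : ℝ) * r := by
      have : y + z - x = (y - x) + z := by abel
      rw [this]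
      push_cast
      linarith [norm_add_le (y - x) z]
    have hle : (l.length : ℕ∞ω) ≤ ((l.length + 1 : ℕ) : ℕ∞ω) := by
      exact_mod_cast Nat.le_succ _
    have c1 : ContDiffAt ℝ l.length F y := (h y hy1).1.of_le hle
    have c2 : ContDiffAt ℝ l.length (fun x => F (x + z)) y :=
      ((h _ hy2).1.of_le hle).comp y (by fun_prop)
    refine ⟨c2.sub c1, ?_⟩
    have e : iteratedFDeriv ℝ l.length (fun x => F (x + z) - F x) y =
        iteratedFDeriv ℝ l.length F (y + z) - iteratedFDeriv ℝ l.length F y := by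
      have := iteratedFDeriv_sub_apply (i := l.length) c2 c1
      rw [iteratedFDeriv_comp_add_right] at this
      exact this
    rw [e]
    have hmv := (convex_closedBall x (((l.length + 1 : ℕ) : ℝ) * r)).norm_image_sub_le_of_norm_fderiv_le
      (𝕜 := ℝ) (f := iteratedFDeriv ℝ l.length F) (C := K) (x := y) (y := y + z)
      (fun w hw => by
        rw [mem_closedBall_iff_norm] at hw
        exact (h w hw).1.differentiableAt_iteratedFDeriv (by exact_mod_cast Nat.lt_succ_self _))
      (fun w hw => by
        rw [mem_closedBall_iff_norm] at hw
        rw [norm_fderiv_iteratedFDeriv]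
        exact (h w hw).2)
      (by rwa [mem_closedBall_iff_norm]) (by rwa [mem_closedBall_iff_norm])
    rw [add_sub_cancel_left] at hmv
    have hK : 0 ≤ K := (norm_nonneg _).trans (h y hy1).2
    exact hmv.trans (by gcongr)

/-! ### Quadrature of functions with finitely many singularities -/

/-- The scale `e` is the minimum of 1 and half of all distances. Bounding the largest of the inverse
fourth powers by their sum lets the contributions of several singularities be added; the factor 16
is `2 ^ 4` from the halving. -/
theorem exists_scale (h : ℝ) (h1 : h ≤ 1) : ∀ ds : List ℝ, (∀ d ∈ ds, 2 * h ≤ d) → 0 < h →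
    ∃ e, h ≤ e ∧ e ≤ 1 ∧ (∀ d ∈ ds, 2 * e ≤ d) ∧
      (e ^ 4)⁻¹ ≤ 1 + (ds.map fun d => 16 * (d ^ 4)⁻¹).sum := by
  intro ds
  induction ds with
  | nil => intro _ _; exact ⟨1, h1, le_rfl, by simp, by simp⟩
  | cons d ds ih =>
    intro hds h0
    obtain ⟨e, he, he1, hed, hs⟩ := ih (fun d hd => hds d (List.mem_cons_of_mem _ hd)) h0
    have hd : 2 * h ≤ d := hds d (by simp)
    have hd0 : 0 < d := by linarith
    have hsum : 0 ≤ (ds.map fun d => 16 * (d ^ 4)⁻¹).sum := by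
      apply List.sum_nonneg
      simp only [List.mem_map]
      rintro _ ⟨d, hd, rfl⟩
      positivity
    rw [List.map_cons, List.sum_cons]
    rcases le_total e (d / 2) with hle | hle
    · refine ⟨e, he, he1, fun d' hd' => ?_, hs.trans ?_⟩
      · rcases List.mem_cons.1 hd' with rfl | hd'
        · linarith
        · exact hed d' hd'
      · have : 0 ≤ 16 * (d ^ 4)⁻¹ := by positivity
        linarith
    · refine ⟨d / 2, by linarith, by linarith, fun d' hd' => ?_, ?_⟩
      · rcases List.mem_cons.1 hd' with rfl | hd'
        · linarith
        · linarith [hed d' hd']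
      · have : ((d / 2) ^ 4)⁻¹ = 16 * (d ^ 4)⁻¹ := by
          rw [div_pow, inv_div, div_eq_mul_inv]
          norm_num
        linarith

theorem sum_list_sum_comm {α : Type} [Fintype α] (P : List E3) (f : E3 → α → ℝ) :
    ∑ x, (P.map fun p => f p x).sum = (P.map fun p => ∑ x, f p x).sum := by
  induction P with
  | nil => simp
  | cons p P ih => simp [Finset.sum_add_distrib, ih]

theorem list_sum_le_of_le (P : List E3) (f : E3 → ℝ) {C : ℝ} (h : ∀ p, f p ≤ C) :
    (P.map f).sum ≤ P.length * C := by
  induction P with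
  | nil => simp
  | cons p P ih =>
    simp only [List.map_cons, List.sum_cons, List.length_cons]
    push_cast
    linarith [h p]

/-- Within a few mesh cells of a singularity the sup bound suffices, since the weight there is
bounded below. Elsewhere the derivative bound at scale `e` holds along all the points that the
fourth difference uses. The constant is the sum of those of the two cases. -/
theorem norm_diffs_le_weight {m : ℕ} [NeZero m] {F : E3 → ℂ} {P : List E3} {K : ℝ} {l : List E3}
    (hl : l.length = 4) (hlz : ∀ z ∈ l, ‖z‖ ≤ zoneBound A / m) (hK : ∀ x, ‖F x‖ ≤ K)
    (hs : ∀ x e, (m : ℝ)⁻¹ ≤ e → e ≤ 1 → (∀ p ∈ P, e ≤ latDist A (x - p)) →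
      ContDiffAt ℝ 4 F x ∧ ‖iteratedFDeriv ℝ 4 F x‖ ≤ K * (e ^ 4)⁻¹) (x : E3) :
    ‖diffs l F x‖ ≤ (16 * (8 * zoneBound A + 3) ^ 4 + 256 * zoneBound A ^ 4) * K *
      (((m : ℝ) ^ 4)⁻¹ + (P.map fun p => ((1 + m * latDist A (x - p)) ^ 4)⁻¹).sum) := by
  have hm0 : (0 : ℝ) < m := Nat.cast_pos.2 (NeZero.pos m)
  have hm1 : (1 : ℝ) ≤ m := by exact_mod_cast NeZero.one_le
  have hK0 : 0 ≤ K := (norm_nonneg _).trans (hK 0)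
  have hρ := zoneBound_pos (A := A)
  set ρ := zoneBound A
  have hS : ∀ Q : List E3, 0 ≤ (Q.map fun p => ((1 + m * latDist A (x - p)) ^ 4)⁻¹).sum := by
    intro Q
    apply List.sum_nonneg
    simp only [List.mem_map]
    rintro _ ⟨p, _, rfl⟩
    positivity
  -- Four differences of step `ρ / m` drift by at most `4 * ρ / m`. The `8 * ρ` keeps that below
  -- half of the distance to the singularity, and the 2 is what `exists_scale` requires for `h =
  -- m⁻¹`.
  by_cases hnear : ∃ p ∈ P, m * latDist A (x - p) ≤ 8 * ρ + 2
  · obtain ⟨p, hp, hpx⟩ := hnear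
    have h1 := norm_diffs_le_of_bound l hK x
    rw [hl] at h1
    have h2 : ((1 + m * latDist A (x - p)) ^ 4)⁻¹ ≤
        (P.map fun p => ((1 + m * latDist A (x - p)) ^ 4)⁻¹).sum := by
      refine List.single_le_sum ?_ _ (List.mem_map.2 ⟨p, hp, rfl⟩)
      simp only [List.mem_map]
      rintro _ ⟨p, _, rfl⟩
      positivity
    have hd : 0 ≤ latDist A (x - p) := latDist_nonneg _
    have h3 : 1 ≤ (8 * ρ + 3) ^ 4 * ((1 + m * latDist A (x - p)) ^ 4)⁻¹ := by
      rw [← div_eq_mul_inv, one_le_div (by positivity)]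
      exact pow_le_pow_left₀ (by positivity) (by linarith) 4
    have h4 : (8 * ρ + 3) ^ 4 * ((1 + m * latDist A (x - p)) ^ 4)⁻¹ ≤ (8 * ρ + 3) ^ 4 *
        (((m : ℝ) ^ 4)⁻¹ + (P.map fun p => ((1 + m * latDist A (x - p)) ^ 4)⁻¹).sum) := by
      gcongr
      have : 0 ≤ ((m : ℝ) ^ 4)⁻¹ := by positivity
      linarith
    calc ‖diffs l F x‖ ≤ 16 * K * 1 := by linarith
      _ ≤ 16 * K * ((8 * ρ + 3) ^ 4 *
        (((m : ℝ) ^ 4)⁻¹ + (P.map fun p => ((1 + m * latDist A (x - p)) ^ 4)⁻¹).sum)) := by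
          gcongr
          exact h3.trans h4
      _ = (16 * (8 * ρ + 3) ^ 4) * K *
        (((m : ℝ) ^ 4)⁻¹ + (P.map fun p => ((1 + m * latDist A (x - p)) ^ 4)⁻¹).sum) := by ring
      _ ≤ _ := by
          have := hS P
          gcongr
          have : 0 ≤ 256 * ρ ^ 4 := by positivity
          linarith
  · push Not at hnear
    have hfar : ∀ p ∈ P, (8 * ρ + 2) * (m : ℝ)⁻¹ ≤ latDist A (x - p) := fun p hp => by
      rw [← div_eq_mul_inv, div_le_iff₀ hm0, mul_comm (latDist _ _)]
      exact (hnear p hp).le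
    have hi0 : 0 < (m : ℝ)⁻¹ := inv_pos.2 hm0
    obtain ⟨e, he, he1, hed, hes⟩ := exists_scale (m : ℝ)⁻¹ (inv_le_one_of_one_le₀ hm1)
      (P.map fun p => latDist A (x - p)) (by
        simp only [List.mem_map]
        rintro _ ⟨p, hp, rfl⟩
        refine le_trans ?_ (hfar p hp)
        gcongr
        linarith) hi0
    have h1 := norm_diffs_le l (r := ρ / m) (K := K * (e ^ 4)⁻¹) (by positivity) hlz (F := F)
      (x := x) (fun y hy => by
        rw [hl] at hy ⊢
        refine hs y e he he1 fun p hp => ?_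
        have h2 := latDist_le_add (A := A) (x - p) (y - p)
        rw [sub_sub_sub_cancel_right, norm_sub_rev] at h2
        have h3 := hed _ (List.mem_map.2 ⟨p, hp, rfl⟩)
        have h4 := hfar p hp
        rw [div_eq_mul_inv] at hy
        push_cast at hy
        nlinarith)
    rw [hl] at h1
    rw [List.map_map] at hes
    -- The factor 256 is 16 from `exists_scale` times 16 from `1 + t ≤ 2 * t` raised to the fourth
    -- power, valid as `t = m * latDist ≥ 1` here.
    have h5 : ∀ Q : List E3, (∀ p ∈ Q, p ∈ P) →
        ((m : ℝ) ^ 4)⁻¹ * (Q.map ((fun d => 16 * (d ^ 4)⁻¹) ∘ fun p => latDist A (x - p))).sum ≤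
        256 * (Q.map fun p => ((1 + m * latDist A (x - p)) ^ 4)⁻¹).sum := by
      intro Q hQ
      induction Q with
      | nil => simp
      | cons p Q ih =>
        have h6 := ih fun q hq => hQ q (List.mem_cons_of_mem _ hq)
        have h7 := hfar p (hQ p (by simp))
        simp only [List.map_cons, List.sum_cons, mul_add, Function.comp_apply]
        refine add_le_add ?_ h6
        have h8 : 1 ≤ m * latDist A (x - p) := by
          have := mul_le_mul_of_nonneg_left h7 hm0.le
          rw [mul_comm, mul_assoc, inv_mul_cancel₀ hm0.ne'] at this
          linarith
        have h9 : 0 < latDist A (x - p) := by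
          by_contra hcon
          push Not at hcon
          nlinarith
        have h10 : (1 + m * latDist A (x - p)) ^ 4 ≤ 16 * (m * latDist A (x - p)) ^ 4 := by
          calc _ ≤ (2 * (m * latDist A (x - p))) ^ 4 := by gcongr; linarith
            _ = _ := by ring
        calc ((m : ℝ) ^ 4)⁻¹ * (16 * (latDist A (x - p) ^ 4)⁻¹)
            = 256 * (16 * (m * latDist A (x - p)) ^ 4)⁻¹ := by
              rw [mul_pow]
              field_simp
              norm_num
          _ ≤ _ := by gcongr
    have h6 := h5 P fun _ h => h
    have h7 := hS P
    calc ‖diffs l F x‖ ≤ K * (e ^ 4)⁻¹ * (ρ / m) ^ 4 := h1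
      _ = K * ρ ^ 4 * (((m : ℝ) ^ 4)⁻¹ * (e ^ 4)⁻¹) := by rw [div_pow]; ring
      _ ≤ K * ρ ^ 4 * (((m : ℝ) ^ 4)⁻¹ * (1 + (P.map
          ((fun d => 16 * (d ^ 4)⁻¹) ∘ fun p => latDist A (x - p))).sum)) := by gcongr
      _ ≤ K * ρ ^ 4 * (((m : ℝ) ^ 4)⁻¹ +
          256 * (P.map fun p => ((1 + m * latDist A (x - p)) ^ 4)⁻¹).sum) := by
          rw [mul_add, mul_one]
          gcongr
      _ ≤ K * ρ ^ 4 * (256 * ((m : ℝ) ^ 4)⁻¹ +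
          256 * (P.map fun p => ((1 + m * latDist A (x - p)) ^ 4)⁻¹).sum) := by
          gcongr
          have : 0 ≤ ((m : ℝ) ^ 4)⁻¹ := by positivity
          linarith
      _ = (256 * ρ ^ 4) * K * (((m : ℝ) ^ 4)⁻¹ +
          (P.map fun p => ((1 + m * latDist A (x - p)) ^ 4)⁻¹).sum) := by ring
      _ ≤ _ := by
          gcongr
          have : 0 ≤ 16 * (8 * ρ + 3) ^ 4 := by positivity
          linarith

/-- The error of the averaged mesh sum is `O(h³)`, `h = 1/m`, for periodic functions that are
bounded by `K` and whose fourth derivative is bounded by `K e⁻⁴` at distance `e ≥ h` from finitely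
many singularities, uniformly in the position of the singularities. -/
theorem exists_quadrature_bound (A : Basis (Fin 3) ℝ E3) (r : ℝ) :
    ∃ C : ℝ, 0 ≤ C ∧ ∀ (m : ℕ) [NeZero m] (k₀ : E3) (F : E3 → ℂ) (P : List E3) (K : ℝ),
      (P.length : ℝ) ≤ r → LatPeriodic A F → Measurable F → (∀ x, ‖F x‖ ≤ K) →
      (∀ x e, (m : ℝ)⁻¹ ≤ e → e ≤ 1 → (∀ p ∈ P, e ≤ latDist A (x - p)) →
        ContDiffAt ℝ 4 F x ∧ ‖iteratedFDeriv ℝ 4 F x‖ ≤ K * (e ^ 4)⁻¹) →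
      ‖meshMean A m k₀ F - zoneAvg A F‖ ≤ C * K * ((m : ℝ) ^ 3)⁻¹ := by
  obtain ⟨C₀, hC₀, hsum⟩ := exists_mesh_sum_bound A
  have hρ := zoneBound_pos (A := A)
  set C₁ := 16 * (8 * zoneBound A + 3) ^ 4 + 256 * zoneBound A ^ 4 with hC₁
  have hC₁0 : 0 ≤ C₁ := by positivity
  refine ⟨C₁ * (1 + |r| * C₀), by positivity, ?_⟩
  intro m _ k₀ F P K hP hF hmeas hK hs
  have hm0 : (0 : ℝ) < m := Nat.cast_pos.2 (NeZero.pos m)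
  have hm1 : (1 : ℝ) ≤ m := by exact_mod_cast NeZero.one_le
  have hK0 : 0 ≤ K := (norm_nonneg _).trans (hK 0)
  -- The argument 3 means four differences, the least number whose decay is summable over a
  -- three-dimensional mesh uniformly in `m`. The gain `m⁻³` is then just the weight of one mesh
  -- point.
  refine quadrature_error_le_of_diffs m k₀ 3 hF hmeas hK fun l hl hlz => ?_
  refine (norm_meshMean_le_sum m k₀ _).trans ?_
  have h1 : ∑ x : Mesh m, ‖diffs l F (meshPoint A m k₀ x)‖ ≤ ∑ x : Mesh m, C₁ * K *
      (((m : ℝ) ^ 4)⁻¹ +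
        (P.map fun p => ((1 + m * latDist A (meshPoint A m k₀ x - p)) ^ 4)⁻¹).sum) :=
    Finset.sum_le_sum fun x _ => norm_diffs_le_weight hl hlz hK hs _
  rw [← Finset.mul_sum, Finset.sum_add_distrib, sum_list_sum_comm, Finset.sum_const,
    Finset.card_univ, card_mesh, nsmul_eq_mul] at h1
  have h2 := list_sum_le_of_le P
    (fun p => ∑ x : Mesh m, ((1 + m * latDist A (meshPoint A m k₀ x - p)) ^ 4)⁻¹)
    (fun p => hsum m k₀ p)
  have h3 : (((m ^ 3 : ℕ) : ℝ)) * ((m : ℝ) ^ 4)⁻¹ ≤ 1 := by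
    push_cast
    rw [← div_eq_mul_inv, div_le_one (by positivity)]
    exact pow_le_pow_right₀ hm1 (by norm_num)
  have h4 : (P.length : ℝ) * C₀ ≤ |r| * C₀ := by
    gcongr
    exact hP.trans (le_abs_self r)
  calc ((m : ℝ) ^ 3)⁻¹ * ∑ x : Mesh m, ‖diffs l F (meshPoint A m k₀ x)‖
      ≤ ((m : ℝ) ^ 3)⁻¹ * (C₁ * K * (1 + |r| * C₀)) := by
        gcongr
        refine h1.trans ?_
        gcongr
        exact h2.trans h4
    _ = _ := by ring

/-! ### Functions with finitely many singularities of order zero -/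

theorem norm_iteratedFDeriv_smul_le_of_contDiffAt {E F : Type} [NormedAddCommGroup E]
    [NormedSpace ℝ E] [NormedAddCommGroup F] [NormedSpace ℝ F] [NormedSpace ℂ F]
    [IsScalarTower ℝ ℂ F] {f : E → ℂ} {g : E → F} {n : ℕ} {x : E} (hf : ContDiffAt ℝ n f x)
    (hg : ContDiffAt ℝ n g x) :
    ‖iteratedFDeriv ℝ n (fun y => f y • g y) x‖ ≤ ∑ i ∈ Finset.range (n + 1),
      (n.choose i : ℝ) * ‖iteratedFDeriv ℝ i f x‖ * ‖iteratedFDeriv ℝ (n - i) g x‖ := by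
  obtain ⟨u, hu, hxu, hfu⟩ := hf.contDiffOn' le_rfl (by simp)
  obtain ⟨w, hw, hxw, hgw⟩ := hg.contDiffOn' le_rfl (by simp)
  simp only [Set.insert_eq_of_mem (Set.mem_univ x), Set.univ_inter] at hfu hgw
  have ho : IsOpen (u ∩ w) := hu.inter hw
  have hx : x ∈ u ∩ w := ⟨hxu, hxw⟩
  have h := norm_iteratedFDerivWithin_smul_le (hfu.mono Set.inter_subset_left)
    (hgw.mono Set.inter_subset_right) ho.uniqueDiffOn hx (le_refl (n : ℕ∞ω))
  simpa only [iteratedFDerivWithin_of_isOpen _ ho hx] using h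

/-- `F` is periodic, bounded by `B` and smooth away from at most `B` points (modulo the reciprocal
lattice), with derivatives of order `n ≤ 4` that are bounded by `B e⁻ⁿ` at distance `e` from these
points. -/
structure Reg (A : Basis (Fin 3) ℝ E3) (B : ℝ) (F : E3 → ℂ) : Prop where
  periodic : LatPeriodic A F
  bound : ∀ x, ‖F x‖ ≤ B
  deriv : ∃ P : List E3, (P.length : ℝ) ≤ B ∧ ∀ x e, 0 < e → e ≤ 1 →
    (∀ p ∈ P, e ≤ latDist A (x - p)) →
    ContDiffAt ℝ 4 F x ∧ ∀ n : ℕ, n ≤ 4 → ‖iteratedFDeriv ℝ n F x‖ ≤ B * (e ^ n)⁻¹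

theorem Reg.nonneg {B : ℝ} {F : E3 → ℂ} (h : Reg A B F) : 0 ≤ B :=
  (norm_nonneg _).trans (h.bound 0)

theorem Reg.mono {B B' : ℝ} {F : E3 → ℂ} (h : Reg A B F) (hB : B ≤ B') : Reg A B' F := by
  refine ⟨h.periodic, fun x => (h.bound x).trans hB, ?_⟩
  obtain ⟨P, hP, hd⟩ := h.deriv
  refine ⟨P, hP.trans hB, fun x e he he1 hx => ⟨(hd x e he he1 hx).1, fun n hn => ?_⟩⟩
  refine ((hd x e he he1 hx).2 n hn).trans ?_
  gcongr

theorem Reg.const (c : ℂ) : Reg A ‖c‖ (fun _ => c) := by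
  refine ⟨fun _ _ _ => rfl, fun x => le_rfl, [], by simp, fun x e he he1 _ =>
    ⟨contDiffAt_const, fun n _ => ?_⟩⟩
  rcases n with _ | n
  · simp
  · rw [iteratedFDeriv_succ_const]
    simp only [Pi.zero_apply, norm_zero]
    positivity

theorem Reg.add {B B' : ℝ} {F G : E3 → ℂ} (hF : Reg A B F) (hG : Reg A B' G) :
    Reg A (B + B') (fun x => F x + G x) := by
  obtain ⟨P, hP, hd⟩ := hF.deriv
  obtain ⟨Q, hQ, hd'⟩ := hG.deriv
  refine ⟨fun x g hg => by simp only [hF.periodic x g hg, hG.periodic x g hg],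
    fun x => (norm_add_le _ _).trans (add_le_add (hF.bound x) (hG.bound x)), P ++ Q, ?_,
    fun x e he he1 hx => ?_⟩
  · rw [List.length_append]
    push_cast
    linarith
  · obtain ⟨c1, b1⟩ := hd x e he he1 fun p hp => hx p (List.mem_append_left _ hp)
    obtain ⟨c2, b2⟩ := hd' x e he he1 fun p hp => hx p (List.mem_append_right _ hp)
    refine ⟨c1.add c2, fun n hn => ?_⟩
    have hn' : (n : ℕ∞ω) ≤ 4 := by exact_mod_cast hn
    have := fun_iteratedFDeriv_add_apply (c1.of_le hn') (c2.of_le hn')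
    rw [this, add_mul]
    exact (norm_add_le _ _).trans (add_le_add (b1 n hn) (b2 n hn))

/-- In the new constant, 16 bounds the sum of the binomial coefficients in the Leibniz rule up to
order 4, and `B + B'` leaves room for the union of the two singular sets. -/
theorem Reg.mul {B B' : ℝ} {F G : E3 → ℂ} (hF : Reg A B F) (hG : Reg A B' G) :
    Reg A (16 * B * B' + B + B') (fun x => F x * G x) := by
  obtain ⟨P, hP, hd⟩ := hF.deriv
  obtain ⟨Q, hQ, hd'⟩ := hG.deriv
  have hB := hF.nonneg
  have hB' := hG.nonneg
  have hBB : 0 ≤ B * B' := mul_nonneg hB hB'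
  refine ⟨fun x g hg => by simp only [hF.periodic x g hg, hG.periodic x g hg],
    fun x => ?_, P ++ Q, ?_, fun x e he he1 hx => ?_⟩
  · rw [norm_mul]
    have := mul_le_mul (hF.bound x) (hG.bound x) (norm_nonneg _) hB
    linarith
  · rw [List.length_append]
    push_cast
    linarith
  · obtain ⟨c1, b1⟩ := hd x e he he1 fun p hp => hx p (List.mem_append_left _ hp)
    obtain ⟨c2, b2⟩ := hd' x e he he1 fun p hp => hx p (List.mem_append_right _ hp)
    refine ⟨c1.mul c2, fun n hn => ?_⟩
    have hn' : (n : ℕ∞ω) ≤ 4 := by exact_mod_cast hn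
    have h := norm_iteratedFDeriv_smul_le_of_contDiffAt (c1.of_le hn') (c2.of_le hn')
    simp only [smul_eq_mul] at h
    refine h.trans ?_
    have h1 : ∀ i ∈ Finset.range (n + 1), (n.choose i : ℝ) * ‖iteratedFDeriv ℝ i F x‖ *
        ‖iteratedFDeriv ℝ (n - i) G x‖ ≤ n.choose i * (B * B' * (e ^ n)⁻¹) := by
      intro i hi
      have hin : i ≤ n := Nat.lt_succ_iff.1 (Finset.mem_range.1 hi)
      have e1 := b1 i (hin.trans hn)
      have e2 := b2 (n - i) ((Nat.sub_le _ _).trans hn)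
      have e3 : (e ^ n)⁻¹ = (e ^ i)⁻¹ * (e ^ (n - i))⁻¹ := by
        rw [← mul_inv, ← pow_add, Nat.add_sub_cancel' hin]
      rw [mul_assoc, e3]
      refine mul_le_mul_of_nonneg_left ?_ (Nat.cast_nonneg _)
      calc _ ≤ B * (e ^ i)⁻¹ * (B' * (e ^ (n - i))⁻¹) := by gcongr
        _ = _ := by ring
    refine (Finset.sum_le_sum h1).trans ?_
    rw [← Finset.sum_mul]
    have h2 : (∑ i ∈ Finset.range (n + 1), (n.choose i : ℝ)) ≤ 16 := by
      have := Nat.sum_range_choose n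
      have h3 : (∑ i ∈ Finset.range (n + 1), (n.choose i : ℝ)) = (2 : ℝ) ^ n := by
        exact_mod_cast this
      rw [h3]
      calc (2 : ℝ) ^ n ≤ 2 ^ 4 := pow_le_pow_right₀ (by norm_num) hn
        _ = 16 := by norm_num
    calc _ ≤ 16 * (B * B' * (e ^ n)⁻¹) := by gcongr
      _ = (16 * B * B') * (e ^ n)⁻¹ := by ring
      _ ≤ _ := by
        gcongr
        linarith

/-- A family of functions that is uniformly of the kind described by `Reg`. -/
def UReg {ι : Type} (A : Basis (Fin 3) ℝ E3) (F : ι → E3 → ℂ) : Prop :=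
  ∃ B : ℝ, ∀ i, Reg A B (F i)

section UReg

variable {ι : Type} {F G : ι → E3 → ℂ}

theorem UReg.add (hF : UReg A F) (hG : UReg A G) : UReg A fun i x => F i x + G i x := by
  obtain ⟨B, hB⟩ := hF
  obtain ⟨B', hB'⟩ := hG
  exact ⟨_, fun i => (hB i).add (hB' i)⟩

theorem UReg.mul (hF : UReg A F) (hG : UReg A G) : UReg A fun i x => F i x * G i x := by
  obtain ⟨B, hB⟩ := hF
  obtain ⟨B', hB'⟩ := hG
  exact ⟨_, fun i => (hB i).mul (hB' i)⟩

theorem UReg.const (c : ℂ) : UReg A fun (_ : ι) _ => c := ⟨_, fun _ => Reg.const c⟩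

theorem UReg.sum {κ : Type} (s : Finset κ) {F : κ → ι → E3 → ℂ} (h : ∀ k ∈ s, UReg A (F k)) :
    UReg A fun i x => ∑ k ∈ s, F k i x := by
  classical
  induction s using Finset.induction with
  | empty => simpa using UReg.const 0
  | insert k s hk ih =>
    simp only [Finset.sum_insert hk]
    exact (h k (by simp)).add (ih fun k' hk' => h k' (Finset.mem_insert_of_mem hk'))

theorem UReg.comp {κ : Type} (hF : UReg A F) (f : κ → ι) : UReg A fun k => F (f k) := by
  obtain ⟨B, hB⟩ := hF
  exact ⟨B, fun k => hB _⟩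

end UReg

theorem UReg.exists_quadrature_bound {ι : Type} {F : ι → E3 → ℂ} (hF : UReg A F)
    (hm : ∀ i, Measurable (F i)) :
    ∃ C : ℝ, 0 ≤ C ∧ ∀ (m : ℕ) [NeZero m] (k₀ : E3) (i : ι),
      ‖meshMean A m k₀ (F i) - zoneAvg A (F i)‖ ≤ C * ((m : ℝ) ^ 3)⁻¹ := by
  obtain ⟨B, hB⟩ := hF
  obtain ⟨C, hC, h⟩ := PeriodicCCD.exists_quadrature_bound A B
  refine ⟨C * |B|, by positivity, fun m _ k₀ i => ?_⟩
  obtain ⟨P, hP, hd⟩ := (hB i).deriv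
  rw [abs_of_nonneg (hB i).nonneg]
  refine h m k₀ (F i) P B hP (hB i).periodic (hm i) (hB i).bound fun x e he he1 hx => ?_
  have hm0 : (0 : ℝ) < m := Nat.cast_pos.2 (NeZero.pos m)
  have := hd x e ((inv_pos.2 hm0).trans_le he) he1 hx
  exact ⟨this.1, this.2 4 le_rfl⟩

/-! ### Double averages -/

/-- Families of functions of two momenta that are uniformly regular in each of them. -/
structure Reg₂ {ι : Type} (A : Basis (Fin 3) ℝ E3) (D : ι → E3 → E3 → ℂ) : Prop where
  measurable : ∀ i, Measurable fun p : E3 × E3 => D i p.1 p.2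
  fst : UReg A fun (p : ι × E3) x => D p.1 x p.2
  snd : UReg A fun (p : ι × E3) y => D p.1 p.2 y

section Reg₂

variable {ι : Type} {D D' : ι → E3 → E3 → ℂ}

theorem Reg₂.add (h : Reg₂ A D) (h' : Reg₂ A D') : Reg₂ A fun i x y => D i x y + D' i x y :=
  ⟨fun i => (h.measurable i).add (h'.measurable i), h.fst.add h'.fst, h.snd.add h'.snd⟩

theorem Reg₂.mul (h : Reg₂ A D) (h' : Reg₂ A D') : Reg₂ A fun i x y => D i x y * D' i x y :=
  ⟨fun i => (h.measurable i).mul (h'.measurable i), h.fst.mul h'.fst, h.snd.mul h'.snd⟩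

theorem Reg₂.const (c : ℂ) : Reg₂ A fun (_ : ι) _ _ => c :=
  ⟨fun _ => measurable_const, UReg.const c, UReg.const c⟩

theorem Reg₂.const_mul (c : ℂ) (h : Reg₂ A D) : Reg₂ A fun i x y => c * D i x y :=
  (Reg₂.const c).mul h

theorem Reg₂.neg (h : Reg₂ A D) : Reg₂ A fun i x y => -D i x y := by
  simpa using h.const_mul (-1)

theorem Reg₂.sub (h : Reg₂ A D) (h' : Reg₂ A D') : Reg₂ A fun i x y => D i x y - D' i x y := by
  simpa only [sub_eq_add_neg] using h.add h'.neg

theorem Reg₂.sum {κ : Type} [Fintype κ] {D : κ → ι → E3 → E3 → ℂ} (h : ∀ k, Reg₂ A (D k)) :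
    Reg₂ A fun i x y => ∑ k, D k i x y :=
  ⟨fun i => Finset.measurable_sum _ fun k _ => (h k).measurable i,
    UReg.sum _ fun k _ => (h k).fst, UReg.sum _ fun k _ => (h k).snd⟩

theorem Reg₂.measurable_left (h : Reg₂ A D) (i : ι) (y : E3) : Measurable fun x => D i x y :=
  (h.measurable i).comp (measurable_id.prodMk measurable_const)

theorem Reg₂.measurable_right (h : Reg₂ A D) (i : ι) (x : E3) : Measurable fun y => D i x y :=
  (h.measurable i).comp (measurable_const.prodMk measurable_id)

theorem Reg₂.exists_bound (h : Reg₂ A D) : ∃ B : ℝ, ∀ i x y, ‖D i x y‖ ≤ B := by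
  obtain ⟨B, hB⟩ := h.fst
  exact ⟨B, fun i x y => (hB (i, y)).bound x⟩

theorem Reg₂.integrable_right (h : Reg₂ A D) (i : ι) (x : E3) :
    IntegrableOn (fun y => D i x y) (brillouinZone A) := by
  obtain ⟨B, hB⟩ := h.exists_bound
  exact integrableOn_zone (h.measurable_right i x) fun y => hB i x y

theorem Reg₂.measurable_zoneAvg (h : Reg₂ A D) (i : ι) :
    Measurable fun x => zoneAvg A fun y => D i x y := by
  simp only [zoneAvg_eq]
  exact ((h.measurable i).stronglyMeasurable.integral_prod_right).measurable.const_mul _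

theorem Reg₂.integrable_zoneAvg (h : Reg₂ A D) (i : ι) :
    IntegrableOn (fun x => zoneAvg A fun y => D i x y) (brillouinZone A) := by
  obtain ⟨B, hB⟩ := h.exists_bound
  exact integrableOn_zone (h.measurable_zoneAvg i) fun x => norm_zoneAvg_le fun y => hB i x y

theorem Reg₂.zoneAvg_comm (h : Reg₂ A D) (i : ι) :
    (zoneAvg A fun x => zoneAvg A fun y => D i x y) =
      zoneAvg A fun y => zoneAvg A fun x => D i x y := by
  obtain ⟨B, hB⟩ := h.exists_bound
  simp only [zoneAvg_eq, integral_const_mul]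
  rw [integral_integral_swap]
  exact Integrable.of_bound (h.measurable i).aestronglyMeasurable B
    (Filter.Eventually.of_forall fun p => hB i p.1 p.2)

/-- The averages are exchanged one at a time: the error in `y` is averaged over the mesh in `x`, the
error in `x` over the zone in `y`, with Fubini in between. Only regularity in each variable
separately is needed, uniformly in the other one. -/
theorem Reg₂.exists_quadrature_bound (h : Reg₂ A D) :
    ∃ C : ℝ, 0 ≤ C ∧ ∀ (m : ℕ) [NeZero m] (k₀ : E3) (i : ι),
      ‖(meshMean A m k₀ fun x => meshMean A m k₀ fun y => D i x y) -
        zoneAvg A fun x => zoneAvg A fun y => D i x y‖ ≤ C * ((m : ℝ) ^ 3)⁻¹ := by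
  obtain ⟨C₁, hC₁, h₁⟩ := h.fst.exists_quadrature_bound fun p => h.measurable_left p.1 p.2
  obtain ⟨C₂, hC₂, h₂⟩ := h.snd.exists_quadrature_bound fun p => h.measurable_right p.1 p.2
  obtain ⟨B, hB⟩ := h.exists_bound
  refine ⟨C₂ + C₁, by positivity, fun m _ k₀ i => ?_⟩
  have hint : IntegrableOn (fun y => zoneAvg A fun x => D i x y) (brillouinZone A) := by
    refine integrableOn_zone (K := B) ?_ fun y => norm_zoneAvg_le fun x => hB i x y
    simp only [zoneAvg_eq]
    exact ((h.measurable i).stronglyMeasurable.integral_prod_left').measurable.const_mul _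
  have hint' : IntegrableOn (fun y => meshMean A m k₀ fun x => D i x y) (brillouinZone A) := by
    refine integrableOn_zone (K := B) ?_ fun y => norm_meshMean_le m k₀ fun x => hB i x y
    simp only [meshMean, meshAvg]
    exact (Finset.measurable_sum _ fun x _ => h.measurable_right i _).const_mul _
  have e1 : ((meshMean A m k₀ fun x => meshMean A m k₀ fun y => D i x y) -
        zoneAvg A fun x => zoneAvg A fun y => D i x y) =
      (meshMean A m k₀ fun x => (meshMean A m k₀ fun y => D i x y) - zoneAvg A fun y => D i x y) +
      zoneAvg A fun y => (meshMean A m k₀ fun x => D i x y) - zoneAvg A fun x => D i x y := by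
    rw [meshMean_sub, zoneAvg_sub hint' hint, zoneAvg_meshMean m k₀ fun x => h.integrable_right i x,
      h.zoneAvg_comm]
    ring
  rw [e1, add_mul]
  exact (norm_add_le _ _).trans (add_le_add
    (norm_meshMean_le m k₀ fun x => h₂ m k₀ (i, x)) (norm_zoneAvg_le fun y => h₁ m k₀ (i, y)))

end Reg₂

/-! ### Functions with a singularity of order `-2` -/

/-- In dimension three the radial density `y ^ 2` cancels the singularity, so the radial integrand
is at most 2 on `(0, ρ]`. The constant is 2 times dimension 3 times the volume `c` of the unit ball.
-/
theorem exists_lintegral_singular_bound :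
    ∃ C : ℝ, 0 ≤ C ∧ ∀ ρ : ℝ, 0 < ρ → ρ ≤ 1 →
      ∫⁻ z : E3, ENNReal.ofReal (if ‖z‖ ≤ ρ then 1 + (‖z‖ ^ 2)⁻¹ else 0) ≤
        ENNReal.ofReal (C * ρ) := by
  set c := volume.real (Metric.ball (0 : E3) 1)
  refine ⟨6 * c, by positivity, fun ρ h0 h1 => ?_⟩
  set f : ℝ → ℝ := fun y => if y ≤ ρ then 1 + (y ^ 2)⁻¹ else 0 with hf
  have hfm : Measurable f := by
    refine Measurable.ite measurableSet_Iic ?_ measurable_const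
    fun_prop
  have hdim : Module.finrank ℝ E3 = 3 := by simp
  have hle : ∀ y ∈ Set.Ioi (0 : ℝ), y ^ 2 * f y ≤ (Set.Ioc 0 ρ).indicator (fun _ => 2) y := by
    intro y hy
    have hy0 : 0 < y := hy
    by_cases hyρ : y ≤ ρ
    · rw [Set.indicator_of_mem (show y ∈ Set.Ioc 0 ρ from ⟨hy0, hyρ⟩)]
      simp only [hf, hyρ, if_true]
      rw [mul_add, mul_one, mul_inv_cancel₀ (by positivity)]
      nlinarith
    · rw [Set.indicator_of_notMem fun h => hyρ h.2]
      simp [hf, hyρ]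
  have hf0 : ∀ y, 0 ≤ f y := fun y => by
    simp only [hf]
    split_ifs
    · positivity
    · exact le_rfl
  have hindi : IntegrableOn ((Set.Ioc 0 ρ).indicator fun _ => (2 : ℝ)) (Set.Ioi 0) :=
    ((integrable_indicator_iff measurableSet_Ioc).2
      (integrableOn_const (by simp))).integrableOn
  have hint : IntegrableOn (fun y => y ^ 2 * f y) (Set.Ioi 0) := by
    refine Integrable.mono' hindi (by fun_prop) ?_
    refine (ae_restrict_iff' measurableSet_Ioi).2 (Filter.Eventually.of_forall fun y hy => ?_)
    rw [Real.norm_of_nonneg (mul_nonneg (sq_nonneg _) (hf0 y))]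
    exact hle y hy
  have hI : Integrable (fun z : E3 => f ‖z‖) := by
    rw [integrable_fun_norm_addHaar volume (f := f), hdim]
    simpa using hint
  rw [← ofReal_integral_eq_lintegral_ofReal hI (Filter.Eventually.of_forall fun z => hf0 _)]
  apply ENNReal.ofReal_le_ofReal
  rw [integral_fun_norm_addHaar volume f, hdim]
  simp only [Nat.add_one_sub_one, smul_eq_mul, nsmul_eq_mul, Nat.cast_ofNat]
  have h2 : ∫ y in Set.Ioi (0 : ℝ), y ^ 2 * f y ≤ 2 * ρ := by
    refine (setIntegral_mono_on hint hindi measurableSet_Ioi hle).trans ?_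
    rw [setIntegral_indicator measurableSet_Ioc]
    have : Set.Ioi (0 : ℝ) ∩ Set.Ioc 0 ρ = Set.Ioc 0 ρ := by
      ext y; simp +contextual
    rw [this]
    simp [h0.le, mul_comm]
  have hc : 0 ≤ c := by positivity
  calc _ ≤ 3 * (c * (2 * ρ)) := by gcongr
    _ = _ := by ring

/-- The function is dominated by the sum of all lattice translates of the radial profile `ψ`, the
nearest one alone being enough. Integrating this sum over a fundamental domain gives the integral of
`ψ` over the whole space. -/
theorem exists_zoneAvg_singular_bound (A : Basis (Fin 3) ℝ E3) :
    ∃ C : ℝ, 0 ≤ C ∧ ∀ (N : E3 → ℂ) (p : E3) (K ρ : ℝ), Measurable N → 0 ≤ K → 0 < ρ → ρ ≤ 1 →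
      (∀ x, ‖N x‖ ≤ K * if latDist A (x - p) ≤ ρ then 1 + (latDist A (x - p) ^ 2)⁻¹ else 0) →
      IntegrableOn N (brillouinZone A) ∧ ‖zoneAvg A N‖ ≤ C * K * ρ := by
  obtain ⟨C, hC, hψ⟩ := exists_lintegral_singular_bound
  refine ⟨(volume.real (brillouinZone A))⁻¹ * C, by positivity, ?_⟩
  intro N p K ρ hN hK hρ hρ1 hle
  have : VAddInvariantMeasure (recipLattice A) E3 volume :=
    inferInstanceAs (VAddInvariantMeasure (recipLattice A).toAddSubgroup E3 volume)
  set ψ : E3 → ENNReal := fun z => ENNReal.ofReal (if ‖z‖ ≤ ρ then 1 + (‖z‖ ^ 2)⁻¹ else 0) with hψd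
  have hψm : Measurable ψ := by
    refine ENNReal.measurable_ofReal.comp
      (Measurable.ite (measurableSet_le measurable_norm measurable_const) ?_ measurable_const)
    fun_prop
  have hpt : ∀ x, ‖N x‖ₑ ≤ ∑' g : recipLattice A, ENNReal.ofReal K * ψ ((g +ᵥ x) - p) := by
    intro x
    obtain ⟨G, hG, hd⟩ := exists_nearest A (x - p)
    refine le_trans ?_ (ENNReal.le_tsum (⟨-G, neg_mem hG⟩ : recipLattice A))
    rw [← ofReal_norm, hψd, ← ENNReal.ofReal_mul hK]
    apply ENNReal.ofReal_le_ofReal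
    have e : ((⟨-G, neg_mem hG⟩ : recipLattice A) +ᵥ x) - p = x - p - G := by
      rw [Submodule.vadd_def, vadd_eq_add]
      simp only
      abel
    rw [e, ← hd]
    exact hle x
  have htot : ∫⁻ x in brillouinZone A, ‖N x‖ₑ ≤ ENNReal.ofReal (K * (C * ρ)) := by
    calc ∫⁻ x in brillouinZone A, ‖N x‖ₑ
        ≤ ∫⁻ x in brillouinZone A, ∑' g : recipLattice A,
            ENNReal.ofReal K * ψ ((g +ᵥ x) - p) := lintegral_mono hpt
      _ = ∑' g : recipLattice A, ∫⁻ x in brillouinZone A,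
            ENNReal.ofReal K * ψ ((g +ᵥ x) - p) := by
          refine lintegral_tsum fun g => ?_
          refine ((hψm.comp ((measurable_const_vadd g).sub_const p)).const_mul _).aemeasurable
      _ = ∫⁻ x, ENNReal.ofReal K * ψ (x - p) :=
          (isAddFundamentalDomain_zone.lintegral_eq_tsum''
            (fun x => ENNReal.ofReal K * ψ (x - p))).symm
      _ = ENNReal.ofReal K * ∫⁻ x, ψ x := by
          rw [lintegral_const_mul (f := fun x => ψ (x - p)) _ (hψm.comp (measurable_sub_const p)),
            lintegral_sub_right_eq_self]
      _ ≤ ENNReal.ofReal K * ENNReal.ofReal (C * ρ) := by gcongr; exact hψ ρ hρ hρ1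
      _ = _ := (ENNReal.ofReal_mul hK).symm
  refine ⟨⟨hN.aestronglyMeasurable, htot.trans_lt ENNReal.ofReal_lt_top⟩, ?_⟩
  rw [zoneAvg_eq, norm_mul, Complex.norm_real, Real.norm_of_nonneg (by positivity)]
  have h1 : ‖∫ k in brillouinZone A, N k‖ ≤ K * (C * ρ) := by
    have := (enorm_integral_le_lintegral_enorm (μ := volume.restrict (brillouinZone A)) N).trans htot
    rw [← ofReal_norm] at this
    exact (ENNReal.ofReal_le_ofReal_iff (by positivity)).1 this
  calc _ ≤ (volume.real (brillouinZone A))⁻¹ * (K * (C * ρ)) := by gcongr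
    _ = _ := by ring

/-- `V` is periodic, bounded by `B` at the translates of `p` and smooth elsewhere, with derivatives
of order `n ≤ 4` that are bounded by `B e⁻²⁻ⁿ` at distance `e` from the translates of `p`. -/
structure DoublePole (A : Basis (Fin 3) ℝ E3) (B : ℝ) (p : E3) (V : E3 → ℂ) : Prop where
  periodic : LatPeriodic A V
  value : ∀ x, x - p ∈ recipLattice A → ‖V x‖ ≤ B
  deriv : ∀ x e, 0 < e → e ≤ 1 → e ≤ latDist A (x - p) →
    ContDiffAt ℝ 4 V x ∧ ∀ n : ℕ, n ≤ 4 → ‖iteratedFDeriv ℝ n V x‖ ≤ B * (e ^ (n + 2))⁻¹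

theorem DoublePole.mono {B B' : ℝ} {p : E3} {V : E3 → ℂ} (h : DoublePole A B p V) (hB : B ≤ B') :
    DoublePole A B' p V := by
  refine ⟨h.periodic, fun x hx => (h.value x hx).trans hB, fun x e he he1 hx =>
    ⟨(h.deriv x e he he1 hx).1, fun n hn => ((h.deriv x e he he1 hx).2 n hn).trans ?_⟩⟩
  gcongr

theorem DoublePole.norm_le {B : ℝ} {p : E3} {V : E3 → ℂ} (h : DoublePole A B p V) (x : E3) {e : ℝ}
    (he : 0 < e) (he1 : e ≤ 1) (hx : e ≤ latDist A (x - p)) : ‖V x‖ ≤ B * (e ^ 2)⁻¹ := by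
  simpa using (h.deriv x e he he1 hx).2 0 (by norm_num)

/-- The part of a function at distance larger than `ρ` from the translates of `p`. -/
def farPart (A : Basis (Fin 3) ℝ E3) (p : E3) (ρ : ℝ) (F : E3 → ℂ) (x : E3) : ℂ :=
  if latDist A (x - p) ≤ ρ then 0 else F x

/-- The part of a function at distance at most `ρ` from the translates of `p`. -/
def nearPart (A : Basis (Fin 3) ℝ E3) (p : E3) (ρ : ℝ) (F : E3 → ℂ) (x : E3) : ℂ :=
  if latDist A (x - p) ≤ ρ then F x else 0

theorem nearPart_add_farPart (p : E3) (ρ : ℝ) (F : E3 → ℂ) (x : E3) :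
    nearPart A p ρ F x + farPart A p ρ F x = F x := by
  unfold nearPart farPart
  split_ifs <;> simp

theorem measurableSet_near (p : E3) (ρ : ℝ) : MeasurableSet {x : E3 | latDist A (x - p) ≤ ρ} :=
  measurableSet_le (continuous_latDist.measurable.comp (measurable_sub_const p)) measurable_const

theorem measurable_farPart {p : E3} {ρ : ℝ} {F : E3 → ℂ} (hF : Measurable F) :
    Measurable (farPart A p ρ F) := Measurable.ite (measurableSet_near p ρ) measurable_const hF

theorem measurable_nearPart {p : E3} {ρ : ℝ} {F : E3 → ℂ} (hF : Measurable F) :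
    Measurable (nearPart A p ρ F) := Measurable.ite (measurableSet_near p ρ) hF measurable_const

section Product

variable {B : ℝ} {p : E3} {V τ : E3 → ℂ}

/-- The summand 1 in the majorant covers the translates of `p` themselves, where `latDist` is 0 and
its inverse square is 0 by convention. -/
theorem DoublePole.norm_nearPart_mul_le (hV : DoublePole A B p V) (hτ : Reg A B τ) {ρ : ℝ}
    (hρ1 : ρ ≤ 1) (x : E3) :
    ‖nearPart A p ρ (fun x => V x * τ x) x‖ ≤
      B ^ 2 * if latDist A (x - p) ≤ ρ then 1 + (latDist A (x - p) ^ 2)⁻¹ else 0 := by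
  have hB := hτ.nonneg
  unfold nearPart
  split_ifs with h
  · have h1 : ‖V x‖ ≤ B * (1 + (latDist A (x - p) ^ 2)⁻¹) := by
      by_cases hx : x - p ∈ recipLattice A
      · rw [latDist_eq_zero hx]
        simpa using hV.value x hx
      · have h0 := latDist_pos_iff.2 hx
        refine (hV.norm_le x h0 (h.trans hρ1) le_rfl).trans ?_
        gcongr
        linarith
    rw [norm_mul]
    have h2 : 0 ≤ (latDist A (x - p) ^ 2)⁻¹ := by positivity
    calc ‖V x‖ * ‖τ x‖ ≤ B * (1 + (latDist A (x - p) ^ 2)⁻¹) * B := by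
          gcongr
          exact hτ.bound x
      _ = _ := by ring
  · simp

theorem DoublePole.norm_farPart_mul_le (hV : DoublePole A B p V) (hτ : Reg A B τ) {ρ : ℝ}
    (hρ : 0 < ρ) (hρ1 : ρ ≤ 1) (x : E3) :
    ‖farPart A p ρ (fun x => V x * τ x) x‖ ≤ B ^ 2 * (ρ ^ 2)⁻¹ := by
  have hB := hτ.nonneg
  unfold farPart
  split_ifs with h
  · rw [norm_zero]
    positivity
  · push Not at h
    rw [norm_mul]
    calc ‖V x‖ * ‖τ x‖ ≤ B * (ρ ^ 2)⁻¹ * B := by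
          gcongr
          · exact hV.norm_le x hρ hρ1 h.le
          · exact hτ.bound x
      _ = _ := by ring

theorem DoublePole.integrable_mul (hV : DoublePole A B p V) (hτ : Reg A B τ) (hVm : Measurable V)
    (hτm : Measurable τ) : IntegrableOn (fun x => V x * τ x) (brillouinZone A) := by
  obtain ⟨C, hC, h⟩ := exists_zoneAvg_singular_bound A
  have h1 := (h _ p (B ^ 2) 1 (measurable_nearPart (A := A) (p := p) (ρ := 1) (hVm.mul hτm))
    (sq_nonneg _) one_pos le_rfl (hV.norm_nearPart_mul_le hτ le_rfl)).1
  have h2 := integrableOn_zone (A := A) (measurable_farPart (A := A) (p := p) (ρ := 1) (hVm.mul hτm))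
    (hV.norm_farPart_mul_le hτ one_pos le_rfl)
  refine (h1.add h2).congr (Filter.Eventually.of_forall fun x => ?_)
  exact nearPart_add_farPart p 1 (fun x => V x * τ x) x

/-- Leibniz gives `e⁻⁶`; the excess `e⁻²` is at most `m ^ 2` because only scales `e ≥ m⁻¹` are
considered. This leaves the `e⁻⁴` profile of `exists_quadrature_bound`. At such points the cutoff at
half a mesh width is locally invisible. -/
theorem DoublePole.deriv_farPart_mul (hV : DoublePole A B p V) (hτ : Reg A B τ) :
    ∃ P : List E3, (P.length : ℝ) ≤ B + 1 ∧ ∀ (m : ℕ) [NeZero m] (x : E3) (e : ℝ),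
      (m : ℝ)⁻¹ ≤ e → e ≤ 1 → (∀ q ∈ P, e ≤ latDist A (x - q)) →
      ContDiffAt ℝ 4 (farPart A p ((m : ℝ)⁻¹ / 2) fun x => V x * τ x) x ∧
      ‖iteratedFDeriv ℝ 4 (farPart A p ((m : ℝ)⁻¹ / 2) fun x => V x * τ x) x‖ ≤
        16 * B ^ 2 * (m : ℝ) ^ 2 * (e ^ 4)⁻¹ := by
  have hB := hτ.nonneg
  obtain ⟨P, hP, hd⟩ := hτ.deriv
  refine ⟨p :: P, by simpa using hP, fun m _ x e he he1 hx => ?_⟩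
  have hm0 : (0 : ℝ) < m := Nat.cast_pos.2 (NeZero.pos m)
  have he0 : 0 < e := (inv_pos.2 hm0).trans_le he
  obtain ⟨c1, b1⟩ := hV.deriv x e he0 he1 (hx p (by simp))
  obtain ⟨c2, b2⟩ := hd x e he0 he1 fun q hq => hx q (List.mem_cons_of_mem _ hq)
  have heq : farPart A p ((m : ℝ)⁻¹ / 2) (fun x => V x * τ x) =ᶠ[nhds x] fun x => V x * τ x := by
    have ho : IsOpen {y : E3 | (m : ℝ)⁻¹ / 2 < latDist A (y - p)} :=
      isOpen_lt continuous_const (continuous_latDist.comp (continuous_sub_right p))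
    have hx' : x ∈ {y : E3 | (m : ℝ)⁻¹ / 2 < latDist A (y - p)} := by
      have := hx p (by simp)
      have h3 := inv_pos.2 hm0
      simp only [Set.mem_ofPred_eq]
      linarith
    filter_upwards [ho.mem_nhds hx'] with y hy
    unfold farPart
    rw [if_neg (not_le.2 hy)]
  refine ⟨(c1.mul c2).congr_of_eventuallyEq heq, ?_⟩
  rw [(heq.iteratedFDeriv ℝ 4).eq_of_nhds]
  have h := norm_iteratedFDeriv_smul_le_of_contDiffAt (n := 4) c1 c2
  simp only [smul_eq_mul] at h
  refine h.trans ?_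
  have h1 : ∀ i ∈ Finset.range (4 + 1), (Nat.choose 4 i : ℝ) * ‖iteratedFDeriv ℝ i V x‖ *
      ‖iteratedFDeriv ℝ (4 - i) τ x‖ ≤ Nat.choose 4 i * (B ^ 2 * m ^ 2 * (e ^ 4)⁻¹) := by
    intro i hi
    have hin : i ≤ 4 := Nat.lt_succ_iff.1 (Finset.mem_range.1 hi)
    have e1 := b1 i hin
    have e2 := b2 (4 - i) (Nat.sub_le _ _)
    have e3 : (e ^ 4)⁻¹ = (e ^ i)⁻¹ * (e ^ (4 - i))⁻¹ := by
      rw [← mul_inv, ← pow_add, Nat.add_sub_cancel' hin]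
    have e4 : (e ^ 2)⁻¹ ≤ (m : ℝ) ^ 2 := by
      rw [← inv_pow]
      have := inv_anti₀ (inv_pos.2 hm0) he
      rw [inv_inv] at this
      exact pow_le_pow_left₀ (by positivity) this 2
    rw [mul_assoc]
    refine mul_le_mul_of_nonneg_left ?_ (Nat.cast_nonneg _)
    calc ‖iteratedFDeriv ℝ i V x‖ * ‖iteratedFDeriv ℝ (4 - i) τ x‖
        ≤ B * (e ^ (i + 2))⁻¹ * (B * (e ^ (4 - i))⁻¹) := by gcongr
      _ = B ^ 2 * (e ^ 2)⁻¹ * (e ^ 4)⁻¹ := by rw [e3, pow_add, mul_inv]; ring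
      _ ≤ B ^ 2 * m ^ 2 * (e ^ 4)⁻¹ := by gcongr
  refine (Finset.sum_le_sum h1).trans_eq ?_
  rw [← Finset.sum_mul]
  have h2 : (∑ i ∈ Finset.range (4 + 1), (Nat.choose 4 i : ℝ)) = 16 := by
    have := Nat.sum_range_choose 4
    exact_mod_cast this
  rw [h2]
  ring

theorem LatPeriodic.farPart {F : E3 → ℂ} (hF : LatPeriodic A F) (p : E3) (ρ : ℝ) :
    LatPeriodic A (farPart A p ρ F) := fun x G hG => by
  have : x + G - p = x - p + G := by abel
  simp only [PeriodicCCD.farPart, this, latDist_add _ hG, hF x G hG]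

end Product

/-- If `G` is the lattice point nearest to `q`, then `m • (q - G)` is a nonzero lattice vector,
hence no shorter than the shortest one. This keeps mesh points away from a pole that sits on the
mesh. -/
theorem exists_latDist_lower_bound (A : Basis (Fin 3) ℝ E3) :
    ∃ c : ℝ, 0 < c ∧ c ≤ 1 ∧ ∀ (m : ℕ) [NeZero m] (q : E3), (m : ℝ) • q ∈ recipLattice A →
      q ∉ recipLattice A → c / m ≤ latDist A q := by
  obtain ⟨l, hl, hlb⟩ := exists_norm_lower_bound A
  refine ⟨min l 1, lt_min hl one_pos, min_le_right _ _, fun m _ q hq hq' => ?_⟩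
  have hm0 : (0 : ℝ) < m := Nat.cast_pos.2 (NeZero.pos m)
  obtain ⟨G, hG, hd⟩ := exists_nearest A q
  have h1 : (m : ℝ) • (q - G) ∈ recipLattice A := by
    rw [smul_sub, Nat.cast_smul_eq_nsmul ℝ m G]
    exact sub_mem hq (Submodule.smul_of_tower_mem _ m hG)
  have h2 : (m : ℝ) • (q - G) ≠ 0 := by
    rw [Ne, smul_eq_zero, not_or]
    refine ⟨hm0.ne', fun h => hq' ?_⟩
    rw [sub_eq_zero.1 h]
    exact hG
  have h3 := hlb _ h1 h2
  rw [norm_smul, Real.norm_natCast] at h3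
  rw [hd, div_le_iff₀ hm0, mul_comm]
  exact (min_le_left _ _).trans h3

/-- The error of the averaged mesh sum is `O(h)` for a singularity of order `-2` at a point of the
mesh, times a function with singularities of order zero. -/
theorem exists_doublePole_quadrature_bound (A : Basis (Fin 3) ℝ E3) (B : ℝ) :
    ∃ C : ℝ, 0 ≤ C ∧ ∀ (m : ℕ) [NeZero m] (k₀ p : E3) (V τ : E3 → ℂ), DoublePole A B p V →
      Reg A B τ → Measurable V → Measurable τ →
      (∀ x, (m : ℝ) • (meshPoint A m k₀ x - p) ∈ recipLattice A) →
      ‖meshMean A m k₀ (fun x => V x * τ x) - zoneAvg A fun x => V x * τ x‖ ≤ C * (m : ℝ)⁻¹ := by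
  obtain ⟨c, hc, hc1, hlow⟩ := exists_latDist_lower_bound A
  obtain ⟨C₁, hC₁, hquad⟩ := exists_quadrature_bound A (B + 1)
  obtain ⟨C₂, hC₂, hnear⟩ := exists_zoneAvg_singular_bound A
  obtain ⟨C₃, hC₃, hsum⟩ := exists_mesh_sum_bound A
  refine ⟨C₁ * (16 * B ^ 2) + 16 * (B ^ 2 * (c ^ 2)⁻¹) * C₃ + C₂ * B ^ 2, by positivity, ?_⟩
  intro m _ k₀ p V τ hV hτ hVm hτm hmesh
  have hB := hτ.nonneg
  have hm0 : (0 : ℝ) < m := Nat.cast_pos.2 (NeZero.pos m)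
  have hm1 : (1 : ℝ) ≤ m := by exact_mod_cast NeZero.one_le
  have hi0 : 0 < (m : ℝ)⁻¹ := inv_pos.2 hm0
  have hi1 : (m : ℝ)⁻¹ ≤ 1 := inv_le_one_of_one_le₀ hm1
  -- Half of the smallest scale `m⁻¹` occurring in the quadrature bound, so that the jump of
  -- `farPart` is never seen by its derivative hypothesis.
  set ρ := (m : ℝ)⁻¹ / 2 with hρ
  have hρ0 : 0 < ρ := by positivity
  have hρ1 : ρ ≤ 1 := by linarith
  set F : E3 → ℂ := fun x => V x * τ x with hF
  have hFm : Measurable F := hVm.mul hτm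
  have hFp : LatPeriodic A F := fun x G hG => by
    simp only [hF, hV.periodic x G hG, hτ.periodic x G hG]
  obtain ⟨P, hP, hPd⟩ := hV.deriv_farPart_mul hτ
  -- The quadrature bound is linear in the sup bound, so size `m ^ 2` turns `m⁻³` into `m⁻¹`.
  have hfar := hquad m k₀ (farPart A p ρ F) P (16 * B ^ 2 * (m : ℝ) ^ 2) hP (hFp.farPart p ρ)
    (measurable_farPart hFm) (fun x => by
      refine (hV.norm_farPart_mul_le hτ hρ0 hρ1 x).trans ?_
      have : (ρ ^ 2)⁻¹ = 4 * (m : ℝ) ^ 2 := by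
        rw [hρ]
        field_simp
        norm_num
      rw [this]
      nlinarith [mul_nonneg (sq_nonneg B) (sq_nonneg (m : ℝ))])
    (fun x e he he1 hx => hPd m x e he he1 hx)
  obtain ⟨hnI, hn⟩ := hnear _ p (B ^ 2) ρ (measurable_nearPart (A := A) (p := p) (ρ := ρ) hFm)
    (sq_nonneg _) hρ0 hρ1 (hV.norm_nearPart_mul_le hτ hρ1)
  have hfI := integrableOn_zone (A := A) (measurable_farPart (A := A) (p := p) (ρ := ρ) hFm)
    (hV.norm_farPart_mul_le hτ hρ0 hρ1)
  -- Here the pole must lie on the mesh: a mesh point is either a translate of `p`, where `V` is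
  -- bounded, or at distance at least `c / m` from all of them.
  have hval : ∀ x : Mesh m, ‖F (meshPoint A m k₀ x)‖ ≤ B ^ 2 * (c ^ 2)⁻¹ * (m : ℝ) ^ 2 := by
    intro x
    have h1 : ‖V (meshPoint A m k₀ x)‖ ≤ B * ((c ^ 2)⁻¹ * (m : ℝ) ^ 2) := by
      by_cases hx : meshPoint A m k₀ x - p ∈ recipLattice A
      · refine (hV.value _ hx).trans (le_mul_of_one_le_right hB ?_)
        have h2 : 1 ≤ (c ^ 2)⁻¹ := (one_le_inv₀ (by positivity)).2 (pow_le_one₀ hc.le hc1)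
        have h3 : (1 : ℝ) ≤ (m : ℝ) ^ 2 := one_le_pow₀ hm1
        nlinarith
      · have h2 := hV.norm_le _ (e := c / m) (by positivity)
          ((div_le_one hm0).2 (hc1.trans hm1)) (hlow m _ (hmesh x) hx)
        refine h2.trans_eq ?_
        rw [div_pow, inv_div]
        ring
    rw [hF, norm_mul]
    calc _ ≤ B * ((c ^ 2)⁻¹ * (m : ℝ) ^ 2) * B := by
          gcongr
          exact hτ.bound _
      _ = _ := by ring
  have hnm : ‖meshMean A m k₀ (nearPart A p ρ F)‖ ≤ 16 * (B ^ 2 * (c ^ 2)⁻¹) * C₃ * (m : ℝ)⁻¹ := by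
    refine (norm_meshMean_le_sum m k₀ _).trans ?_
    -- On the support of `nearPart` the base `1 + m * latDist` is at most 2, so 16 times the weight
    -- is at least 1. The uniform mesh sum thereby replaces a count of the near points.
    have h1 : ∀ x ∈ (Finset.univ : Finset (Mesh m)), ‖nearPart A p ρ F (meshPoint A m k₀ x)‖ ≤
        16 * (B ^ 2 * (c ^ 2)⁻¹ * (m : ℝ) ^ 2) *
          ((1 + m * latDist A (meshPoint A m k₀ x - p)) ^ 4)⁻¹ := by
      intro x _
      have hd := latDist_nonneg (A := A) (meshPoint A m k₀ x - p)
      unfold nearPart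
      split_ifs with h
      · have h2 : 1 + m * latDist A (meshPoint A m k₀ x - p) ≤ 2 := by
          have : m * latDist A (meshPoint A m k₀ x - p) ≤ m * ρ := by gcongr
          have h3 : m * ρ = 1 / 2 := by rw [hρ]; field_simp
          linarith
        have h3 : 1 ≤ 16 * ((1 + m * latDist A (meshPoint A m k₀ x - p)) ^ 4)⁻¹ := by
          rw [← div_eq_mul_inv, one_le_div (by positivity)]
          calc _ ≤ (2 : ℝ) ^ 4 := pow_le_pow_left₀ (by positivity) h2 4
            _ = 16 := by norm_num
        refine (hval x).trans ?_
        have h4 : 0 ≤ B ^ 2 * (c ^ 2)⁻¹ * (m : ℝ) ^ 2 := by positivity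
        nlinarith
      · rw [norm_zero]
        positivity
    calc ((m : ℝ) ^ 3)⁻¹ * ∑ x : Mesh m, ‖nearPart A p ρ F (meshPoint A m k₀ x)‖
        ≤ ((m : ℝ) ^ 3)⁻¹ * (16 * (B ^ 2 * (c ^ 2)⁻¹ * (m : ℝ) ^ 2) * C₃) := by
          gcongr
          refine (Finset.sum_le_sum h1).trans ?_
          rw [← Finset.mul_sum]
          gcongr
          exact hsum m k₀ p
      _ = _ := by field_simp
  have hsplit : ∀ x, F x = nearPart A p ρ F x + farPart A p ρ F x := fun x =>
    (nearPart_add_farPart p ρ F x).symm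
  have e1 : meshMean A m k₀ F = meshMean A m k₀ (nearPart A p ρ F) +
      meshMean A m k₀ (farPart A p ρ F) := by
    rw [← meshMean_add]
    exact congrArg _ (funext hsplit)
  have e2 : zoneAvg A F = zoneAvg A (nearPart A p ρ F) + zoneAvg A (farPart A p ρ F) := by
    rw [← zoneAvg_add hnI hfI]
    exact congrArg _ (funext hsplit)
  have e3 : meshMean A m k₀ F - zoneAvg A F = (meshMean A m k₀ (farPart A p ρ F) -
      zoneAvg A (farPart A p ρ F)) + meshMean A m k₀ (nearPart A p ρ F) -
      zoneAvg A (nearPart A p ρ F) := by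
    rw [e1, e2]
    ring
  rw [e3]
  have e4 : C₁ * (16 * B ^ 2 * (m : ℝ) ^ 2) * ((m : ℝ) ^ 3)⁻¹ =
      C₁ * (16 * B ^ 2) * (m : ℝ)⁻¹ := by field_simp
  rw [e4] at hfar
  have e5 : C₂ * B ^ 2 * ρ ≤ C₂ * B ^ 2 * (m : ℝ)⁻¹ := by
    gcongr
    linarith
  calc _ ≤ ‖meshMean A m k₀ (farPart A p ρ F) - zoneAvg A (farPart A p ρ F)‖ +
        ‖meshMean A m k₀ (nearPart A p ρ F)‖ + ‖zoneAvg A (nearPart A p ρ F)‖ :=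
        (norm_sub_le _ _).trans (add_le_add_left (norm_add_le _ _) _)
    _ ≤ _ := by linarith

/-! ### From bounds in the momentum transfer to regularity along affine families of momenta -/

/-! ### Iterated directional derivatives and mixed partial derivatives -/

section Directional

variable {E G V W : Type} [NormedAddCommGroup E] [NormedSpace ℝ E] [NormedAddCommGroup G]
  [NormedSpace ℝ G] [NormedAddCommGroup V] [NormedSpace ℝ V] [NormedAddCommGroup W]
  [NormedSpace ℝ W]

theorem iteratedFDeriv_comp_affine {f : E → V} (L : G →L[ℝ] E) (c : E) {n : ℕ} {x : G}
    (hf : ContDiffAt ℝ n f (c + L x)) :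
    iteratedFDeriv ℝ n (fun y => f (c + L y)) x =
      (iteratedFDeriv ℝ n f (c + L x)).compContinuousLinearMap fun _ => L := by
  have hf' : ContDiffAt ℝ n (fun z => f (c + z)) (L x) :=
    hf.comp (L x) (contDiffAt_const.add contDiffAt_id)
  obtain ⟨u, hu, hxu, hfu⟩ := hf'.contDiffOn' le_rfl (by simp)
  simp only [Set.insert_eq_of_mem (Set.mem_univ (L x)), Set.univ_inter] at hfu
  have hpre : IsOpen (L ⁻¹' u) := hu.preimage L.continuous
  have h := L.iteratedFDerivWithin_comp_right hfu hu.uniqueDiffOn hpre.uniqueDiffOn hxu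
    (le_refl (n : ℕ∞ω))
  rw [iteratedFDerivWithin_of_isOpen _ hpre (by exact hxu),
    iteratedFDerivWithin_of_isOpen _ hu hxu] at h
  have h2 := congrFun (iteratedFDeriv_comp_add_left' (𝕜 := ℝ) (f := f) n c) (L x)
  rw [h2] at h
  exact h

/-- Iterated directional derivatives. -/
def dirDeriv : List E → (E → V) → E → V
  | [], f => f
  | v :: l, f => fun p => fderiv ℝ (dirDeriv l f) p v

theorem dirDeriv_append (l l' : List E) (f : E → V) :
    dirDeriv (l ++ l') f = dirDeriv l (dirDeriv l' f) := by
  induction l with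
  | nil => rfl
  | cons v l ih => simp only [List.cons_append, dirDeriv, ih]

theorem contDiffOn_fderiv_apply {f : E → V} {U : Set E} (hU : IsOpen U) (hf : ContDiffOn ℝ ∞ f U)
    (v : E) : ContDiffOn ℝ ∞ (fun p => fderiv ℝ f p v) U :=
  (hf.fderiv_of_isOpen hU (by simp)).clm_apply contDiffOn_const

theorem contDiffOn_dirDeriv {f : E → V} {U : Set E} (hU : IsOpen U) (hf : ContDiffOn ℝ ∞ f U)
    (l : List E) : ContDiffOn ℝ ∞ (dirDeriv l f) U := by
  induction l with
  | nil => exact hf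
  | cons v l ih => exact contDiffOn_fderiv_apply hU ih v

theorem dirDeriv_congr {f g : E → V} {U : Set E} (hU : IsOpen U) (h : Set.EqOn f g U)
    (l : List E) : Set.EqOn (dirDeriv l f) (dirDeriv l g) U := by
  induction l with
  | nil => exact h
  | cons v l ih =>
    intro p hp
    have : dirDeriv l f =ᶠ[nhds p] dirDeriv l g := by
      filter_upwards [hU.mem_nhds hp] with q hq using ih hq
    simp only [dirDeriv, this.fderiv_eq]

/-- Adjacent directions commute by symmetry of the second derivative. It serves to move all
directions in the second factor of a product innermost. -/
theorem dirDeriv_perm {f : E → V} {U : Set E} (hU : IsOpen U) (hf : ContDiffOn ℝ ∞ f U)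
    {l l' : List E} (h : l.Perm l') : Set.EqOn (dirDeriv l f) (dirDeriv l' f) U := by
  induction h with
  | nil => exact fun _ _ => rfl
  | @cons v l₁ l₂ _ ih =>
    intro p hp
    have : dirDeriv l₁ f =ᶠ[nhds p] dirDeriv l₂ f := by
      filter_upwards [hU.mem_nhds hp] with q hq using ih hq
    simp only [dirDeriv, this.fderiv_eq]
  | swap v w l =>
    intro p hp
    have hc : ContDiffAt ℝ ∞ (dirDeriv l f) p :=
      (contDiffOn_dirDeriv hU hf l).contDiffAt (hU.mem_nhds hp)
    have hd : DifferentiableAt ℝ (fderiv ℝ (dirDeriv l f)) p :=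
      (hc.fderiv_right (m := 1) (by norm_cast)).differentiableAt (by simp)
    have hs : IsSymmSndFDerivAt ℝ (dirDeriv l f) p := hc.isSymmSndFDerivAt (by
      simp only [minSmoothness_of_isRCLikeNormedField]
      exact WithTop.coe_le_coe.2 le_top)
    simp only [dirDeriv]
    rw [fderiv_clm_apply hd (differentiableAt_const _), fderiv_clm_apply hd (differentiableAt_const _)]
    simpa using hs w v
  | trans _ _ ih1 ih2 => exact fun p hp => (ih1 hp).trans (ih2 hp)

theorem dirDeriv_comp_clm {f : E → V} {U : Set E} (hU : IsOpen U) (hf : ContDiffOn ℝ ∞ f U)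
    (Λ : V →L[ℝ] W) (l : List E) :
    Set.EqOn (dirDeriv l fun x => Λ (f x)) (fun x => Λ (dirDeriv l f x)) U := by
  induction l with
  | nil => exact fun _ _ => rfl
  | cons v l ih =>
    intro p hp
    have h1 : dirDeriv l (fun x => Λ (f x)) =ᶠ[nhds p] fun x => Λ (dirDeriv l f x) := by
      filter_upwards [hU.mem_nhds hp] with q hq using ih hq
    have hd : DifferentiableAt ℝ (dirDeriv l f) p :=
      ((contDiffOn_dirDeriv hU hf l).contDiffAt (hU.mem_nhds hp)).differentiableAt (by simp)
    simp only [dirDeriv, h1.fderiv_eq]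
    have := (Λ.hasFDerivAt.comp p hd.hasFDerivAt).fderiv
    rw [show (fun x => Λ (dirDeriv l f x)) = Λ ∘ dirDeriv l f from rfl, this]
    rfl

theorem dirDeriv_comp_affine {f : E → V} {U : Set E} (hU : IsOpen U) (hf : ContDiffOn ℝ ∞ f U)
    (L : G →L[ℝ] E) (c : E) (l : List G) {y : G} (hy : c + L y ∈ U) :
    dirDeriv l (fun y => f (c + L y)) y = dirDeriv (l.map L) f (c + L y) := by
  induction l generalizing y with
  | nil => rfl
  | cons v l ih =>
    have hU' : IsOpen {y | c + L y ∈ U} :=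
      hU.preimage (continuous_const.add L.continuous)
    have h1 : dirDeriv l (fun y => f (c + L y)) =ᶠ[nhds y]
        fun y => dirDeriv (l.map L) f (c + L y) := by
      filter_upwards [hU'.mem_nhds hy] with q hq using ih hq
    have hd : DifferentiableAt ℝ (dirDeriv (l.map L) f) (c + L y) :=
      ((contDiffOn_dirDeriv hU hf _).contDiffAt (hU.mem_nhds hy)).differentiableAt (by simp)
    simp only [dirDeriv, h1.fderiv_eq, List.map_cons]
    have := (hd.hasFDerivAt.comp y ((L.hasFDerivAt (x := y)).const_add c)).fderiv
    rw [show (fun y => dirDeriv (l.map L) f (c + L y)) =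
      dirDeriv (l.map L) f ∘ fun y => c + L y from rfl, this]
    rfl

theorem iteratedFDeriv_apply_eq_dirDeriv {f : E → V} {U : Set E} (hU : IsOpen U)
    (hf : ContDiffOn ℝ ∞ f U) (n : ℕ) (m : Fin n → E) {p : E} (hp : p ∈ U) :
    iteratedFDeriv ℝ n f p m = dirDeriv (List.ofFn m) f p := by
  induction n generalizing p with
  | zero => simp [dirDeriv]
  | succ n ih =>
    rw [iteratedFDeriv_succ_apply_left, List.ofFn_succ]
    simp only [dirDeriv]
    have hd : DifferentiableAt ℝ (iteratedFDeriv ℝ n f) p :=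
      (hf.contDiffAt (hU.mem_nhds hp)).differentiableAt_iteratedFDeriv
        (WithTop.coe_lt_coe.2 (WithTop.coe_lt_top n))
    have h1 : dirDeriv (List.ofFn fun i : Fin n => m i.succ) f =ᶠ[nhds p]
        fun q => iteratedFDeriv ℝ n f q (Fin.tail m) := by
      filter_upwards [hU.mem_nhds hp] with q hq using (ih (Fin.tail m) hq).symm
    rw [h1.fderiv_eq]
    have := ((ContinuousMultilinearMap.apply ℝ (fun _ : Fin n => E) V
      (Fin.tail m)).hasFDerivAt.comp p hd.hasFDerivAt).fderiv
    rw [show (fun q => iteratedFDeriv ℝ n f q (Fin.tail m)) =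
      ContinuousMultilinearMap.apply ℝ (fun _ : Fin n => E) V (Fin.tail m) ∘
        iteratedFDeriv ℝ n f from rfl, this]
    rfl

theorem contDiffAt_iteratedFDeriv {f : E → V} {p : E} (hf : ContDiffAt ℝ ∞ f p) (n : ℕ) :
    ContDiffAt ℝ ∞ (iteratedFDeriv ℝ n f) p :=
  hf.iteratedFDeriv_right (by norm_cast)

end Directional

section Mixed

variable {X Y V : Type} [NormedAddCommGroup X] [NormedSpace ℝ X] [NormedAddCommGroup Y]
  [NormedSpace ℝ Y] [NormedAddCommGroup V] [NormedSpace ℝ V]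

theorem iteratedFDeriv_snd_eq {f : X × Y → V} {b : ℕ} {x : X} {y : Y}
    (hf : ContDiffAt ℝ b f (x, y)) :
    iteratedFDeriv ℝ b (fun y' => f (x, y')) y =
      ContinuousMultilinearMap.compContinuousLinearMapL (F := V)
        (fun _ : Fin b => ContinuousLinearMap.inr ℝ X Y) (iteratedFDeriv ℝ b f (x, y)) := by
  have e : ∀ y' : Y, (x, y') = (x, (0 : Y)) + ContinuousLinearMap.inr ℝ X Y y' := by simp
  have := iteratedFDeriv_comp_affine (ContinuousLinearMap.inr ℝ X Y) (x, (0 : Y)) (x := y)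
    (f := f) (n := b) (by rwa [← e])
  simp only [← e] at this
  exact this

theorem contDiffAt_iteratedFDeriv_snd {f : X × Y → V} {x : X} {y : Y} (b : ℕ)
    (hf : ContDiffAt ℝ ∞ f (x, y)) :
    ContDiffAt ℝ ∞ (fun p : X × Y => iteratedFDeriv ℝ b (fun y' => f (p.1, y')) p.2) (x, y) := by
  have h1 : (fun p : X × Y => iteratedFDeriv ℝ b (fun y' => f (p.1, y')) p.2) =ᶠ[nhds (x, y)]
      fun p => ContinuousMultilinearMap.compContinuousLinearMapL (F := V)
        (fun _ : Fin b => ContinuousLinearMap.inr ℝ X Y) (iteratedFDeriv ℝ b f p) := by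
    have : ∀ᶠ p in nhds (x, y), ContDiffAt ℝ b f p :=
      (hf.of_le (by exact_mod_cast le_top)).eventually (by simp)
    filter_upwards [this] with p hp
    exact iteratedFDeriv_snd_eq (x := p.1) (y := p.2) hp
  refine ContDiffAt.congr_of_eventuallyEq ?_ h1
  exact (ContinuousLinearMap.contDiff _).contDiffAt.comp _ (contDiffAt_iteratedFDeriv hf b)

/-- Derivatives along `Y` are taken first and those along `X` outside, the nesting used in
`HasAlgebraicSingularity`. The inner ones are an evaluation of a multilinear derivative, and
evaluation is a continuous linear map that commutes with the outer ones. -/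
theorem norm_dirDeriv_mixed_le {f : X × Y → V} {U : Set (X × Y)} (hU : IsOpen U)
    (hf : ContDiffOn ℝ ∞ f U) {x : X} {y : Y} (hp : (x, y) ∈ U) (us : List X) (ws : List Y) :
    ‖dirDeriv (us.map (ContinuousLinearMap.inl ℝ X Y) ++ ws.map (ContinuousLinearMap.inr ℝ X Y))
      f (x, y)‖ ≤
    ‖iteratedFDeriv ℝ us.length (fun x' => iteratedFDeriv ℝ ws.length (fun y' => f (x', y')) y) x‖ *
      ((us.map norm).prod * (ws.map norm).prod) := by
  have ex : ∀ x' : X, ((x', y) : X × Y) = ((0 : X), y) + ContinuousLinearMap.inl ℝ X Y x' := by simp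
  have ey : ∀ (x' : X) (y' : Y), (x', y') = (x', (0 : Y)) + ContinuousLinearMap.inr ℝ X Y y' := by
    simp
  have hUx : IsOpen {x' : X | (x', y) ∈ U} := hU.preimage (by fun_prop)
  have h1 : dirDeriv (us.map (ContinuousLinearMap.inl ℝ X Y) ++
      ws.map (ContinuousLinearMap.inr ℝ X Y)) f (x, y) =
      dirDeriv us (fun x' => dirDeriv (ws.map (ContinuousLinearMap.inr ℝ X Y)) f (x', y)) x := by
    have := dirDeriv_comp_affine hU (contDiffOn_dirDeriv hU hf
      (ws.map (ContinuousLinearMap.inr ℝ X Y))) (ContinuousLinearMap.inl ℝ X Y) ((0 : X), y) us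
      (y := x) (by rwa [← ex])
    simp only [← ex] at this
    rw [this, dirDeriv_append]
  have hsm : ContDiffOn ℝ ∞ (fun x' => iteratedFDeriv ℝ ws.length (fun y' => f (x', y')) y)
      {x' : X | (x', y) ∈ U} := fun x' hx' =>
    ((contDiffAt_iteratedFDeriv_snd ws.length (hf.contDiffAt (hU.mem_nhds hx'))).comp x'
      (contDiffAt_id.prodMk contDiffAt_const)).contDiffWithinAt
  have h2 : Set.EqOn (fun x' => dirDeriv (ws.map (ContinuousLinearMap.inr ℝ X Y)) f (x', y))
      (fun x' => ContinuousMultilinearMap.apply ℝ (fun _ : Fin ws.length => Y) V ws.get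
        (iteratedFDeriv ℝ ws.length (fun y' => f (x', y')) y)) {x' : X | (x', y) ∈ U} := by
    intro x' hx'
    have hUy : IsOpen {y' : Y | (x', y') ∈ U} := hU.preimage (by fun_prop)
    have hfy : ContDiffOn ℝ ∞ (fun y' => f (x', y')) {y' : Y | (x', y') ∈ U} :=
      hf.comp (contDiffOn_const.prodMk contDiffOn_id) fun _ h => h
    have h3 := dirDeriv_comp_affine hU hf (ContinuousLinearMap.inr ℝ X Y) (x', (0 : Y)) ws
      (y := y) (by rw [← ey]; exact hx')
    simp only [← ey] at h3
    simp only [ContinuousMultilinearMap.apply_apply]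
    rw [← h3, iteratedFDeriv_apply_eq_dirDeriv hUy hfy _ _ hx', List.ofFn_get]
  rw [h1, dirDeriv_congr hUx h2 us hp, dirDeriv_comp_clm hUx hsm _ us hp]
  simp only [ContinuousMultilinearMap.apply_apply]
  have h4 := iteratedFDeriv_apply_eq_dirDeriv hUx hsm us.length us.get hp
  rw [List.ofFn_get] at h4
  rw [← h4]
  have h5 : ∀ l : List X, ∏ i, ‖l.get i‖ = (l.map norm).prod := fun l => by
    rw [← List.prod_ofFn]
    congr 1
    conv_rhs => rw [← List.ofFn_get l, List.map_ofFn]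
    rfl
  have h6 : ∀ l : List Y, ∏ i, ‖l.get i‖ = (l.map norm).prod := fun l => by
    rw [← List.prod_ofFn]
    congr 1
    conv_rhs => rw [← List.ofFn_get l, List.map_ofFn]
    rfl
  refine (ContinuousMultilinearMap.le_opNorm _ _).trans ?_
  rw [h6, ← mul_assoc]
  have hn : 0 ≤ (ws.map norm).prod := by rw [← h6]; positivity
  gcongr
  rw [← h5]
  exact ContinuousMultilinearMap.le_opNorm _ _

/-- When every direction lies in one of the two factors, the list can be sorted into the order of
`norm_dirDeriv_mixed_le`. A zero direction is counted with `X`. -/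
theorem norm_dirDeriv_pure_le {f : X × Y → V} {U : Set (X × Y)} (hU : IsOpen U)
    (hf : ContDiffOn ℝ ∞ f U) {x : X} {y : Y} (hp : (x, y) ∈ U) {B : ℝ} (l : List (X × Y))
    (hl : ∀ z ∈ l, z.2 = 0 ∨ z.1 = 0)
    (hB : ∀ a b : ℕ, a + b = l.length →
      ‖iteratedFDeriv ℝ a (fun x' => iteratedFDeriv ℝ b (fun y' => f (x', y')) y) x‖ ≤ B) :
    ‖dirDeriv l f (x, y)‖ ≤ B * (l.map norm).prod := by
  classical
  set lx := l.filter fun z => decide (z.2 = 0)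
  set ly := l.filter fun z => !decide (z.2 = 0)
  have hperm : (lx ++ ly).Perm l := List.filter_append_perm _ l
  have hx : lx = (lx.map Prod.fst).map (ContinuousLinearMap.inl ℝ X Y) := by
    rw [List.map_map]
    conv_lhs => rw [← List.map_id lx]
    refine List.map_congr_left fun z hz => ?_
    have : z.2 = 0 := by simpa [lx] using (List.mem_filter.1 hz).2
    ext <;> simp [this]
  have hy : ly = (ly.map Prod.snd).map (ContinuousLinearMap.inr ℝ X Y) := by
    rw [List.map_map]
    conv_lhs => rw [← List.map_id ly]
    refine List.map_congr_left fun z hz => ?_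
    have h1 : z.2 ≠ 0 := by simpa [ly] using (List.mem_filter.1 hz).2
    have : z.1 = 0 := (hl z (List.mem_filter.1 hz).1).resolve_left h1
    ext <;> simp [this]
  have hlen : (lx.map Prod.fst).length + (ly.map Prod.snd).length = l.length := by
    rw [List.length_map, List.length_map, ← List.length_append, hperm.length_eq]
  have h1 := norm_dirDeriv_mixed_le hU hf hp (lx.map Prod.fst) (ly.map Prod.snd)
  rw [← hx, ← hy, dirDeriv_perm hU hf hperm hp] at h1
  have hprod : ((lx.map Prod.fst).map norm).prod * ((ly.map Prod.snd).map norm).prod =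
      (l.map norm).prod := by
    rw [← (hperm.map norm).prod_eq, List.map_append, List.prod_append]
    congr 2
    · conv_rhs => rw [hx]
      simp only [List.map_map]
      refine List.map_congr_left fun z _ => ?_
      simp
    · conv_rhs => rw [hy]
      simp only [List.map_map]
      refine List.map_congr_left fun z _ => ?_
      simp
  rw [hprod] at h1
  refine h1.trans ?_
  have h0 : 0 ≤ (l.map norm).prod := by
    apply List.prod_nonneg
    simp only [List.mem_map]
    rintro _ ⟨z, _, rfl⟩
    exact norm_nonneg _
  gcongr
  exact hB _ _ hlen

/-- Bounds for the mixed partial derivatives of order `n` give a bound for the total derivative. -/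
theorem norm_iteratedFDeriv_le_of_mixed {f : X × Y → V} {U : Set (X × Y)} (hU : IsOpen U)
    (hf : ContDiffOn ℝ ∞ f U) {x : X} {y : Y} (hp : (x, y) ∈ U) {B : ℝ} (n : ℕ)
    (hB : ∀ a b : ℕ, a + b = n →
      ‖iteratedFDeriv ℝ a (fun x' => iteratedFDeriv ℝ b (fun y' => f (x', y')) y) x‖ ≤ B) :
    ‖iteratedFDeriv ℝ n f (x, y)‖ ≤ 2 ^ n * B := by
  have hB0 : 0 ≤ B := (norm_nonneg _).trans (hB n 0 rfl)
  refine ContinuousMultilinearMap.opNorm_le_bound (by positivity) fun m => ?_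
  -- Splitting every argument into its two components and expanding multilinearly produces one term
  -- for each subset of the arguments; this is the factor `2 ^ n`.
  have hm : m = (fun i => ((m i).1, (0 : Y))) + fun i => ((0 : X), (m i).2) := by
    ext i <;> simp
  conv_lhs => rw [hm]
  rw [ContinuousMultilinearMap.map_add_univ]
  refine (norm_sum_le _ _).trans ?_
  have hterm : ∀ s ∈ (Finset.univ : Finset (Finset (Fin n))),
      ‖iteratedFDeriv ℝ n f (x, y) (s.piecewise (fun i => ((m i).1, (0 : Y)))
        fun i => ((0 : X), (m i).2))‖ ≤ B * ∏ i, ‖m i‖ := by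
    intro s _
    rw [iteratedFDeriv_apply_eq_dirDeriv hU hf _ _ hp]
    refine (norm_dirDeriv_pure_le hU hf hp _ ?_ (by simpa using hB)).trans ?_
    · intro z hz
      obtain ⟨i, rfl⟩ := (List.mem_ofFn' _ _).1 hz
      by_cases hi : i ∈ s <;> simp [hi]
    · rw [List.map_ofFn, List.prod_ofFn]
      refine mul_le_mul_of_nonneg_left (Finset.prod_le_prod (fun i _ => norm_nonneg _)
        fun i _ => ?_) hB0
      simp only [Function.comp_apply]
      by_cases hi : i ∈ s
      · simp only [hi, Finset.piecewise_eq_of_mem]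
        exact (by simp : ‖((m i).1, (0 : Y))‖ = ‖(m i).1‖).trans_le (norm_fst_le _)
      · simp only [hi, not_false_eq_true, Finset.piecewise_eq_of_notMem]
        exact (by simp : ‖((0 : X), (m i).2)‖ = ‖(m i).2‖).trans_le (norm_snd_le _)
  refine (Finset.sum_le_sum hterm).trans_eq ?_
  rw [Finset.sum_const, Finset.card_univ, Fintype.card_finset, Fintype.card_fin, nsmul_eq_mul]
  push_cast
  ring

end Mixed

/-! ### Functions of three momenta with a singularity in the momentum transfer -/

/-- The analogue of `InAmplitudeSpace` for singularities of order `-s`. -/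
structure SingSpace (A : Basis (Fin 3) ℝ E3) (s : ℕ) (f : E3 → E3 → E3 → ℂ) : Prop where
  periodic_i : ∀ ki kj ka, ∀ G ∈ recipLattice A, f (ki + G) kj ka = f ki kj ka
  periodic_j : ∀ ki kj ka, ∀ G ∈ recipLattice A, f ki (kj + G) ka = f ki kj ka
  periodic_a : ∀ ki kj ka, ∀ G ∈ recipLattice A, f ki kj (ka + G) = f ki kj ka
  smooth_off : ContDiffOn ℝ ∞ (fun p : E3 × E3 × E3 => f p.1 p.2.1 p.2.2)
    {p | p.2.2 - p.1 ∉ recipLattice A}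
  singular : HasAlgebraicSingularity (-(s : ℝ))
    (fun (q : E3) (k : E3 × E3) => f k.1 k.2 (k.1 + q)) 0
  smooth_on : ContDiff ℝ ∞ (fun k : E3 × E3 => f k.1 k.2 k.1)

theorem InAmplitudeSpace.singSpace {f : E3 → E3 → E3 → ℂ} (h : InAmplitudeSpace A f) :
    SingSpace A 0 f :=
  ⟨h.periodic_i, h.periodic_j, h.periodic_a, h.smooth_off, by simpa using h.singular, h.smooth_on⟩

/-- A function of three momenta in terms of the momentum transfer and the first two momenta. -/
def transfer (f : E3 → E3 → E3 → ℂ) (p : E3 × (E3 × E3)) : ℂ := f p.2.1 p.2.2 (p.2.1 + p.1)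

theorem eq_transfer (f : E3 → E3 → E3 → ℂ) (k₁ k₂ k₃ : E3) :
    f k₁ k₂ k₃ = transfer f (k₃ - k₁, (k₁, k₂)) := by
  simp [transfer]

/-- The momenta with nonzero transfer modulo the reciprocal lattice. -/
def offLattice (A : Basis (Fin 3) ℝ E3) : Set (E3 × (E3 × E3)) := {p | p.1 ∉ recipLattice A}

theorem isOpen_offLattice : IsOpen (offLattice A) :=
  (isClosed_recipLattice A).isOpen_compl.preimage continuous_fst

/-- All three momenta can be translated into a ball of radius `zoneBound A` without changing `Φ` or
the distance to the lattice, and there the region is compact. -/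
theorem exists_bound_of_periodic {W : Type} [NormedAddCommGroup W] {Φ : E3 × (E3 × E3) → W} {δ : ℝ}
    (hΦ : ContinuousOn Φ {p | δ ≤ latDist A p.1})
    (hper : ∀ p (g₁ g₂ g₃ : E3), g₁ ∈ recipLattice A → g₂ ∈ recipLattice A → g₃ ∈ recipLattice A →
      Φ (p + (g₁, (g₂, g₃))) = Φ p) :
    ∃ M : ℝ, 0 ≤ M ∧ ∀ p : E3 × (E3 × E3), δ ≤ latDist A p.1 → ‖Φ p‖ ≤ M := by
  set D := zoneBound A
  set K : Set (E3 × (E3 × E3)) := Metric.closedBall 0 D ∩ {p | δ ≤ latDist A p.1}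
  have hK : IsCompact K := (isCompact_closedBall _ _).inter_right
    (isClosed_le continuous_const (continuous_latDist.comp continuous_fst))
  obtain ⟨M, hM⟩ := hK.exists_bound_of_continuousOn (hΦ.mono Set.inter_subset_right)
  refine ⟨|M|, abs_nonneg _, fun p hp => ?_⟩
  obtain ⟨g₁, h₁, b₁⟩ := exists_reduce A p.1
  obtain ⟨g₂, h₂, b₂⟩ := exists_reduce A p.2.1
  obtain ⟨g₃, h₃, b₃⟩ := exists_reduce A p.2.2
  rw [← hper p (-g₁) (-g₂) (-g₃) (neg_mem h₁) (neg_mem h₂) (neg_mem h₃)]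
  refine (hM _ ⟨?_, ?_⟩).trans (le_abs_self M)
  · rw [mem_closedBall_zero_iff]
    simp only [Prod.norm_def, Prod.fst_add, Prod.snd_add, ← sub_eq_add_neg]
    exact max_le b₁ (max_le b₂ b₃)
  · simp only [Set.mem_ofPred_eq, Prod.fst_add]
    rwa [latDist_add _ (neg_mem h₁)]

theorem periodic_iteratedFDeriv {f : E3 × (E3 × E3) → ℂ} {v : E3 × (E3 × E3)}
    (h : ∀ p, f (p + v) = f p) (n : ℕ) (p : E3 × (E3 × E3)) :
    iteratedFDeriv ℝ n f (p + v) = iteratedFDeriv ℝ n f p := by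
  rw [← iteratedFDeriv_comp_add_right]
  simp only [h]

theorem exists_common_bound {p : ℕ → ℝ → Prop} (hp : ∀ n b b', b ≤ b' → p n b → p n b')
    (h : ∀ n, ∃ b, 0 ≤ b ∧ p n b) (N : ℕ) : ∃ b, 0 ≤ b ∧ ∀ n ≤ N, p n b := by
  choose b hb0 hb using h
  refine ⟨∑ n ∈ Finset.range (N + 1), b n, Finset.sum_nonneg fun n _ => hb0 n, fun n hn => ?_⟩
  exact hp n _ _ (Finset.single_le_sum (fun n _ => hb0 n)
    (Finset.mem_range.2 (Nat.lt_succ_of_le hn))) (hb n)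

section SingSpace

variable {s : ℕ} {f : E3 → E3 → E3 → ℂ}

theorem SingSpace.transfer_periodic (h : SingSpace A s f) (p : E3 × (E3 × E3)) (g₁ g₂ g₃ : E3)
    (h₁ : g₁ ∈ recipLattice A) (h₂ : g₂ ∈ recipLattice A) (h₃ : g₃ ∈ recipLattice A) :
    transfer f (p + (g₁, (g₂, g₃))) = transfer f p := by
  simp only [transfer, Prod.fst_add, Prod.snd_add]
  rw [h.periodic_i _ _ _ g₂ h₂, h.periodic_j _ _ _ g₃ h₃,
    show p.2.1 + g₂ + (p.1 + g₁) = p.2.1 + p.1 + g₁ + g₂ by abel, h.periodic_a _ _ _ g₂ h₂,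
    h.periodic_a _ _ _ g₁ h₁]

theorem SingSpace.transfer_periodic_fst (h : SingSpace A s f) (q : E3) (y : E3 × E3) {g : E3}
    (hg : g ∈ recipLattice A) : transfer f (q + g, y) = transfer f (q, y) := by
  have := h.transfer_periodic (q, y) g 0 0 hg (zero_mem _) (zero_mem _)
  rwa [show (q, y) + (g, ((0 : E3), (0 : E3))) = (q + g, y) by ext <;> simp] at this

theorem SingSpace.contDiffOn_transfer (h : SingSpace A s f) :
    ContDiffOn ℝ ∞ (transfer f) (offLattice A) := by
  have : transfer f = (fun p : E3 × E3 × E3 => f p.1 p.2.1 p.2.2) ∘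
      fun p : E3 × (E3 × E3) => (p.2.1, p.2.2, p.2.1 + p.1) := rfl
  rw [this]
  refine h.smooth_off.comp (by fun_prop) fun p hp => ?_
  simpa [offLattice] using hp

theorem SingSpace.continuousOn_iteratedFDeriv (h : SingSpace A s f) (n : ℕ) :
    ContinuousOn (iteratedFDeriv ℝ n (transfer f)) (offLattice A) := fun p hp =>
  (contDiffAt_iteratedFDeriv (h.contDiffOn_transfer.contDiffAt
    (isOpen_offLattice.mem_nhds hp)) n).continuousAt.continuousWithinAt

theorem SingSpace.exists_bound_far (h : SingSpace A s f) {δ : ℝ} (hδ : 0 < δ) (n : ℕ) :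
    ∃ M : ℝ, 0 ≤ M ∧ ∀ p : E3 × (E3 × E3), δ ≤ latDist A p.1 →
      ‖iteratedFDeriv ℝ n (transfer f) p‖ ≤ M := by
  refine exists_bound_of_periodic (δ := δ) ((h.continuousOn_iteratedFDeriv n).mono fun _ hp =>
    latDist_pos_iff.1 (hδ.trans_le hp)) fun p g₁ g₂ g₃ h₁ h₂ h₃ => ?_
  exact periodic_iteratedFDeriv (fun p => h.transfer_periodic p _ _ _ h₁ h₂ h₃) n p

theorem exists_mixed_bound {g : E3 → E3 × E3 → ℂ} {δ : ℝ}
    (h : ∀ a b : ℕ, ∃ C : ℝ, ∀ x y, 0 < ‖x - 0‖ → ‖x - 0‖ < δ →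
      ‖iteratedFDeriv ℝ a (fun x' => iteratedFDeriv ℝ b (fun y' => g x' y') y) x‖
        ≤ C * ‖x - 0‖ ^ (-(s : ℝ) - (a : ℝ))) (n : ℕ) :
    ∃ C : ℝ, 0 ≤ C ∧ ∀ a b : ℕ, a + b = n → ∀ x y e, 0 < e → e ≤ 1 → e ≤ ‖x‖ → ‖x‖ < δ →
      ‖iteratedFDeriv ℝ a (fun x' => iteratedFDeriv ℝ b (fun y' => g x' y') y) x‖
        ≤ C * (e ^ (a + s))⁻¹ := by
  choose C hC using h
  refine ⟨∑ a ∈ Finset.range (n + 1), |C a (n - a)|, Finset.sum_nonneg fun _ _ => abs_nonneg _, ?_⟩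
  rintro a b rfl x y e he he1 hex hxδ
  have hx0 : 0 < ‖x‖ := he.trans_le hex
  have h1 := hC a b x y (by simpa using hx0) (by simpa using hxδ)
  rw [sub_zero] at h1
  have h2 : ‖x‖ ^ (-(s : ℝ) - (a : ℝ)) = (‖x‖ ^ (a + s))⁻¹ := by
    rw [show -(s : ℝ) - (a : ℝ) = -((a + s : ℕ) : ℝ) by push_cast; ring, Real.rpow_neg hx0.le,
      Real.rpow_natCast]
  rw [h2] at h1
  have h3 : |C a b| ≤ ∑ a' ∈ Finset.range (a + b + 1), |C a' (a + b - a')| := by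
    have := Finset.single_le_sum (f := fun a' => |C a' (a + b - a')|)
      (fun _ _ => abs_nonneg _) (Finset.mem_range.2 (show a < a + b + 1 by omega))
    simpa using this
  calc _ ≤ C a b * (‖x‖ ^ (a + s))⁻¹ := h1
    _ ≤ |C a b| * (‖x‖ ^ (a + s))⁻¹ := by gcongr; exact le_abs_self _
    _ ≤ _ := by gcongr

/-- Near the lattice, periodicity moves the transfer close to 0, where the singularity hypothesis
bounds the mixed derivatives and hence the total one. Away from it compactness gives a bound, which
`e ≤ 1` allows to be weakened by the inverse power of `e`. -/
theorem SingSpace.exists_bound (h : SingSpace A s f) (n : ℕ) :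
    ∃ M : ℝ, 0 ≤ M ∧ ∀ (p : E3 × (E3 × E3)) (e : ℝ), 0 < e → e ≤ 1 → e ≤ latDist A p.1 →
      ‖iteratedFDeriv ℝ n (transfer f) p‖ ≤ M * (e ^ (n + s))⁻¹ := by
  obtain ⟨δ, hδ, -, hb⟩ := h.singular
  obtain ⟨C, hC, hCb⟩ := exists_mixed_bound hb n
  obtain ⟨M, hM, hMb⟩ := h.exists_bound_far hδ n
  refine ⟨2 ^ n * C + M, by positivity, fun p e he he1 hep => ?_⟩
  have hone : 1 ≤ (e ^ (n + s))⁻¹ :=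
    (one_le_inv₀ (by positivity)).2 (pow_le_one₀ he.le he1)
  rcases lt_or_ge (latDist A p.1) δ with hlt | hge
  · obtain ⟨G, hG, hd⟩ := exists_nearest A p.1
    have e1 : iteratedFDeriv ℝ n (transfer f) p = iteratedFDeriv ℝ n (transfer f) (p.1 - G, p.2) := by
      rw [← periodic_iteratedFDeriv (v := (-G, (0, 0)))
        (fun p => h.transfer_periodic p _ _ _ (neg_mem hG) (zero_mem _) (zero_mem _)) n p]
      congr 1
      ext <;> simp [sub_eq_add_neg]
    have hmem : (p.1 - G, p.2) ∈ offLattice A := by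
      refine latDist_pos_iff.1 ?_
      simp only
      rw [sub_eq_add_neg, latDist_add _ (neg_mem hG)]
      exact he.trans_le hep
    have h2 := norm_iteratedFDeriv_le_of_mixed isOpen_offLattice h.contDiffOn_transfer hmem
      (B := C * (e ^ (n + s))⁻¹) n (fun a b hab => by
        refine (hCb a b hab (p.1 - G) p.2 e he he1 (hd ▸ hep) (hd ▸ hlt)).trans ?_
        have : e ^ (n + s) ≤ e ^ (a + s) := pow_le_pow_of_le_one he.le he1 (by omega)
        gcongr)
    rw [e1]
    refine h2.trans ?_
    rw [← mul_assoc]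
    gcongr
    linarith
  · calc _ ≤ M * 1 := by rw [mul_one]; exact hMb p hge
      _ ≤ (2 ^ n * C + M) * (e ^ (n + s))⁻¹ := by
        gcongr
        have : 0 ≤ 2 ^ n * C := by positivity
        linarith

theorem SingSpace.transfer_lattice (h : SingSpace A s f) {q : E3} (hq : q ∈ recipLattice A)
    (y : E3 × E3) : transfer f (q, y) = f y.1 y.2 y.1 := by
  have := h.transfer_periodic_fst 0 y hq
  rw [zero_add] at this
  rw [this]
  simp [transfer]

theorem SingSpace.exists_bound_on (h : SingSpace A s f) (n : ℕ) :
    ∃ M : ℝ, 0 ≤ M ∧ ∀ y : E3 × E3,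
      ‖iteratedFDeriv ℝ n (fun k : E3 × E3 => f k.1 k.2 k.1) y‖ ≤ M := by
  obtain ⟨M, hM, hb⟩ := exists_bound_of_periodic (A := A) (δ := 0)
    (Φ := fun p : E3 × (E3 × E3) => iteratedFDeriv ℝ n (fun k : E3 × E3 => f k.1 k.2 k.1) p.2)
    (((h.smooth_on.continuous_iteratedFDeriv (m := n) (by exact_mod_cast le_top)).comp
      continuous_snd).continuousOn) (fun _ g₁ g₂ g₃ h₁ h₂ h₃ => by
        simp only [Prod.snd_add]
        rw [← iteratedFDeriv_comp_add_right]
        congr 1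
        funext k
        simp only [Prod.fst_add, Prod.snd_add]
        rw [h.periodic_i _ _ _ _ h₂, h.periodic_j _ _ _ _ h₃, h.periodic_a _ _ _ _ h₂])
  exact ⟨M, hM, fun y => hb (0, y) (latDist_nonneg _)⟩

theorem SingSpace.contDiff_section (h : SingSpace A s f) (q : E3) :
    ContDiff ℝ ∞ fun y : E3 × E3 => transfer f (q, y) := by
  by_cases hq : q ∈ recipLattice A
  · simp only [h.transfer_lattice hq]
    exact h.smooth_on
  · rw [contDiff_iff_contDiffAt]
    intro y
    exact (h.contDiffOn_transfer.contDiffAt (isOpen_offLattice.mem_nhds (show (q, y) ∈ _ from hq))).comp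
      y (contDiffAt_const.prodMk contDiffAt_id)

/-- For order 0, derivatives in the smooth variables alone do not blow up as the transfer approaches
the lattice. This handles sections whose transfer is fixed but may be arbitrarily small or zero. -/
theorem SingSpace.exists_section_bound (h : SingSpace A 0 f) (n : ℕ) :
    ∃ M : ℝ, 0 ≤ M ∧ ∀ (q : E3) (y : E3 × E3),
      ‖iteratedFDeriv ℝ n (fun y' : E3 × E3 => transfer f (q, y')) y‖ ≤ M := by
  obtain ⟨δ, hδ, -, hb⟩ := h.singular
  obtain ⟨C, hC⟩ := hb 0 n
  obtain ⟨M, hM, hMb⟩ := h.exists_bound_far hδ n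
  obtain ⟨M', hM', hMb'⟩ := h.exists_bound_on n
  refine ⟨|C| + M + M', by positivity, fun q y => ?_⟩
  have hC0 := abs_nonneg C
  by_cases hq : q ∈ recipLattice A
  · simp only [h.transfer_lattice hq]
    linarith [hMb' y]
  rcases lt_or_ge (latDist A q) δ with hlt | hge
  · obtain ⟨G, hG, hd⟩ := exists_nearest A q
    have e1 : ∀ y', transfer f (q, y') = transfer f (q - G, y') := fun y' => by
      rw [← h.transfer_periodic_fst (q - G) y' hG, sub_add_cancel]
    simp only [e1]
    have h1 := hC (q - G) y (by
      rw [sub_zero, ← hd]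
      exact latDist_pos_iff.2 hq) (by rwa [sub_zero, ← hd])
    rw [norm_iteratedFDeriv_zero] at h1
    simp only [CharP.cast_eq_zero, neg_zero, sub_zero, Real.rpow_zero, mul_one] at h1
    refine h1.trans ?_
    linarith [le_abs_self C]
  · have hc : ContDiffAt ℝ n (transfer f) (q, y) :=
      (h.contDiffOn_transfer.contDiffAt (isOpen_offLattice.mem_nhds
        (show (q, y) ∈ _ from hq))).of_le (by exact_mod_cast le_top)
    rw [iteratedFDeriv_snd_eq hc]
    refine (ContinuousMultilinearMap.norm_compContinuousLinearMap_le _ _).trans ?_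
    have h1 : ∏ _i : Fin n, ‖ContinuousLinearMap.inr ℝ E3 (E3 × E3)‖ ≤ 1 :=
      Finset.prod_le_one (fun _ _ => norm_nonneg _)
        fun _ _ => ContinuousLinearMap.norm_inr_le_one ℝ E3 (E3 × E3)
    calc _ ≤ ‖iteratedFDeriv ℝ n (transfer f) (q, y)‖ * 1 := by gcongr
      _ ≤ M := by rw [mul_one]; exact hMb _ hge
      _ ≤ _ := by linarith

/-- The function is continuous on the open set off the lattice, and on the closed complement it
equals another continuous function. -/
theorem SingSpace.measurable_transfer (h : SingSpace A s f) : Measurable (transfer f) := by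
  classical
  set S : Set (E3 × (E3 × E3)) := {p | p.1 ∈ recipLattice A} with hS
  have hSc : IsClosed S := (isClosed_recipLattice A).preimage continuous_fst
  have e : transfer f = S.piecewise (fun p => f p.2.1 p.2.2 p.2.1) (transfer f) := by
    funext p
    by_cases hp : p ∈ S
    · rw [Set.piecewise_eq_of_mem _ _ _ hp]
      exact h.transfer_lattice hp p.2
    · rw [Set.piecewise_eq_of_notMem _ _ _ hp]
  rw [e]
  refine ContinuousOn.measurable_piecewise ?_ ?_ hSc.measurableSet
  · exact (h.smooth_on.continuous.comp continuous_snd).continuousOn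
  · exact h.contDiffOn_transfer.continuousOn

theorem SingSpace.measurable (h : SingSpace A s f) {α : Type} [MeasurableSpace α] {k₁ k₂ k₃ : α → E3}
    (h₁ : Measurable k₁) (h₂ : Measurable k₂) (h₃ : Measurable k₃) :
    Measurable fun x => f (k₁ x) (k₂ x) (k₃ x) := by
  simp only [eq_transfer f]
  exact h.measurable_transfer.comp ((h₃.sub h₁).prodMk (h₁.prodMk h₂))

end SingSpace

/-! ### Sections along affine families of momenta -/

/-- A family of momenta that depends on `x` through `e • x`. -/
def Aff {ι : Type} (e : ℤ) (k : ι → E3 → E3) : Prop := ∀ i x, k i x = k i 0 + (e : ℝ) • x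

theorem zsmul_mem_recipLattice (e : ℤ) {g : E3} (hg : g ∈ recipLattice A) :
    (e : ℝ) • g ∈ recipLattice A := by
  rw [Int.cast_smul_eq_zsmul]
  exact Submodule.smul_mem _ _ hg

section Sections

variable {ι : Type} {s : ℕ} {f : E3 → E3 → E3 → ℂ} {k₁ k₂ k₃ : ι → E3 → E3} {e₁ e₂ e₃ : ℤ}

theorem SingSpace.latPeriodic_section (h : SingSpace A s f) (h₁ : Aff e₁ k₁) (h₂ : Aff e₂ k₂)
    (h₃ : Aff e₃ k₃) (i : ι) : LatPeriodic A fun x => f (k₁ i x) (k₂ i x) (k₃ i x) := by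
  intro x g hg
  have key : ∀ {e : ℤ} {k : ι → E3 → E3}, Aff e k → k i (x + g) = k i x + (e : ℝ) • g := by
    intro e k hk
    rw [hk i (x + g), hk i x, smul_add]
    abel
  simp only [key h₁, key h₂, key h₃]
  rw [h.periodic_i _ _ _ _ (zsmul_mem_recipLattice e₁ hg),
    h.periodic_j _ _ _ _ (zsmul_mem_recipLattice e₂ hg),
    h.periodic_a _ _ _ _ (zsmul_mem_recipLattice e₃ hg)]

theorem norm_intCast_smul_le {e : ℤ} (he : |e| ≤ 1) (x : E3) : ‖(e : ℝ) • x‖ ≤ ‖x‖ := by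
  rw [norm_smul, Real.norm_eq_abs]
  have : |(e : ℝ)| ≤ 1 := by exact_mod_cast he
  exact mul_le_of_le_one_left (norm_nonneg _) this

theorem norm_comp_le_of_norm_le_one {E V : Type} [NormedAddCommGroup E] [NormedSpace ℝ E]
    [NormedAddCommGroup V] [NormedSpace ℝ V] {n : ℕ}
    (T : ContinuousMultilinearMap ℝ (fun _ : Fin n => E) V) {L : E3 →L[ℝ] E} (hL : ‖L‖ ≤ 1) :
    ‖T.compContinuousLinearMap fun _ => L‖ ≤ ‖T‖ := by
  refine (ContinuousMultilinearMap.norm_compContinuousLinearMap_le _ _).trans ?_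
  have h1 : ∏ _i : Fin n, ‖L‖ ≤ 1 := Finset.prod_le_one (fun _ _ => norm_nonneg _) fun _ _ => hL
  exact mul_le_of_le_one_right (norm_nonneg _) h1

/-- The direction of an affine family of momenta. -/
def dir₂ (e₁ e₂ : ℤ) : E3 →L[ℝ] E3 × E3 :=
  ((e₁ : ℝ) • ContinuousLinearMap.id ℝ E3).prod ((e₂ : ℝ) • ContinuousLinearMap.id ℝ E3)

/-- The direction of an affine family of momenta and momentum transfers. -/
def dir₃ (e e₁ e₂ : ℤ) : E3 →L[ℝ] E3 × (E3 × E3) :=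
  ((e : ℝ) • ContinuousLinearMap.id ℝ E3).prod (dir₂ e₁ e₂)

theorem norm_dir₂_le (h₁ : |e₁| ≤ 1) (h₂ : |e₂| ≤ 1) : ‖dir₂ e₁ e₂‖ ≤ 1 := by
  refine ContinuousLinearMap.opNorm_le_bound _ zero_le_one fun x => ?_
  rw [one_mul]
  exact max_le (norm_intCast_smul_le h₁ x) (norm_intCast_smul_le h₂ x)

theorem norm_dir₃_le {e : ℤ} (h : |e| ≤ 1) (h₁ : |e₁| ≤ 1) (h₂ : |e₂| ≤ 1) :
    ‖dir₃ e e₁ e₂‖ ≤ 1 := by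
  refine ContinuousLinearMap.opNorm_le_bound _ zero_le_one fun x => ?_
  rw [one_mul]
  exact max_le (norm_intCast_smul_le h x)
    (max_le (norm_intCast_smul_le h₁ x) (norm_intCast_smul_le h₂ x))

theorem section_eq_transfer₃ (h₁ : Aff e₁ k₁) (h₂ : Aff e₂ k₂) (h₃ : Aff e₃ k₃) (i : ι) (x : E3) :
    f (k₁ i x) (k₂ i x) (k₃ i x) =
      transfer f ((k₃ i 0 - k₁ i 0, (k₁ i 0, k₂ i 0)) + dir₃ (e₃ - e₁) e₁ e₂ x) := by
  rw [eq_transfer f]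
  congr 1
  rw [h₁ i x, h₂ i x, h₃ i x]
  ext1
  · simp only [dir₃, Prod.fst_add, ContinuousLinearMap.prod_apply, _root_.smul_apply,
      ContinuousLinearMap.id_apply]
    push_cast
    module
  · simp [dir₃, dir₂]

theorem section_eq_transfer₂ (h₁ : Aff e₁ k₁) (h₂ : Aff e₂ k₂) (h₃ : Aff e₁ k₃) (i : ι) (x : E3) :
    f (k₁ i x) (k₂ i x) (k₃ i x) =
      transfer f (k₃ i 0 - k₁ i 0, (k₁ i 0, k₂ i 0) + dir₂ e₁ e₂ x) := by
  rw [section_eq_transfer₃ (f := f) h₁ h₂ h₃]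
  simp [dir₃]

/-- The point at which the momentum transfer of an affine family vanishes. -/
def pole (e : ℤ) (k₁ k₃ : ι → E3 → E3) (i : ι) : E3 := -((e : ℝ) • (k₃ i 0 - k₁ i 0))

theorem sub_pole {e : ℤ} (he : |e| = 1) (i : ι) (x : E3) :
    x - pole e k₁ k₃ i = (e : ℝ) • (k₃ i 0 - k₁ i 0 + (e : ℝ) • x) := by
  have : (e : ℝ) * e = 1 := by
    have h2 : e * e = 1 := by rw [← abs_mul_abs_self, he, one_mul]
    exact_mod_cast h2
  rw [smul_add, smul_smul, this, one_smul, pole]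
  abel

theorem latDist_sub_pole {e : ℤ} (he : |e| = 1) (i : ι) (x : E3) :
    latDist A (x - pole e k₁ k₃ i) = latDist A (k₃ i 0 - k₁ i 0 + (e : ℝ) • x) := by
  rw [sub_pole he]
  rcases (abs_eq zero_le_one).1 he with rfl | rfl
  · simp
  · rw [Int.cast_neg, Int.cast_one, neg_one_smul, latDist_neg]

theorem SingSpace.section_deriv (h : SingSpace A s f) (h₁ : Aff e₁ k₁) (h₂ : Aff e₂ k₂)
    (h₃ : Aff e₃ k₃) (he₁ : |e₁| ≤ 1) (he₂ : |e₂| ≤ 1) (he : |e₃ - e₁| = 1) :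
    ∃ B : ℝ, 0 ≤ B ∧ ∀ i x e, 0 < e → e ≤ 1 → e ≤ latDist A (x - pole (e₃ - e₁) k₁ k₃ i) →
      ContDiffAt ℝ 4 (fun x => f (k₁ i x) (k₂ i x) (k₃ i x)) x ∧ ∀ n : ℕ, n ≤ 4 →
        ‖iteratedFDeriv ℝ n (fun x => f (k₁ i x) (k₂ i x) (k₃ i x)) x‖ ≤ B * (e ^ (n + s))⁻¹ := by
  obtain ⟨B, hB, hb⟩ := exists_common_bound (p := fun n M => ∀ (p : E3 × (E3 × E3)) (e : ℝ), 0 < e →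
      e ≤ 1 → e ≤ latDist A p.1 → ‖iteratedFDeriv ℝ n (transfer f) p‖ ≤ M * (e ^ (n + s))⁻¹)
    (fun n b b' hbb hp p e he he1 hpe => (hp p e he he1 hpe).trans (by gcongr)) h.exists_bound 4
  refine ⟨B, hB, fun i x e he0 he1 hx => ?_⟩
  simp only [section_eq_transfer₃ h₁ h₂ h₃]
  rw [latDist_sub_pole he] at hx
  set p := (k₃ i 0 - k₁ i 0, (k₁ i 0, k₂ i 0)) + dir₃ (e₃ - e₁) e₁ e₂ x with hp
  have hp1 : p.1 = k₃ i 0 - k₁ i 0 + ((e₃ - e₁ : ℤ) : ℝ) • x := rfl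
  have hmem : p ∈ offLattice A := by
    refine latDist_pos_iff.1 ?_
    rw [hp1]
    exact he0.trans_le hx
  have hc : ContDiffAt ℝ ∞ (transfer f) p :=
    h.contDiffOn_transfer.contDiffAt (isOpen_offLattice.mem_nhds hmem)
  have h4 : (4 : ℕ∞ω) ≤ ∞ := WithTop.coe_le_coe.2 le_top
  refine ⟨(hc.of_le h4).comp x (contDiff_const.add (ContinuousLinearMap.contDiff _)).contDiffAt,
    fun n hn => ?_⟩
  rw [iteratedFDeriv_comp_affine (dir₃ (e₃ - e₁) e₁ e₂) _ (hc.of_le (by exact_mod_cast le_top))]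
  refine (norm_comp_le_of_norm_le_one _ (norm_dir₃_le he.le he₁ he₂)).trans ?_
  exact hb n hn p e he0 he1 (by rwa [hp1])

/-- Either the transfer does not move with `x`, and the section has no singularities at all, or it
moves with slope `±1`, and there is a single singular point modulo the lattice. Larger slopes are
excluded by hypothesis. -/
theorem SingSpace.uReg (h : SingSpace A 0 f) (h₁ : Aff e₁ k₁) (h₂ : Aff e₂ k₂)
    (h₃ : Aff e₃ k₃) (he₁ : |e₁| ≤ 1) (he₂ : |e₂| ≤ 1) (he : |e₃ - e₁| ≤ 1) :
    UReg A fun i x => f (k₁ i x) (k₂ i x) (k₃ i x) := by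
  obtain ⟨M, hM, hMb⟩ := exists_common_bound (p := fun n M => ∀ (q : E3) (y : E3 × E3),
      ‖iteratedFDeriv ℝ n (fun y' : E3 × E3 => transfer f (q, y')) y‖ ≤ M)
    (fun n b b' hbb hp q y => (hp q y).trans hbb) h.exists_section_bound 4
  have hbd : ∀ k₁ k₂ k₃, ‖f k₁ k₂ k₃‖ ≤ M := fun k₁ k₂ k₃ => by
    rw [eq_transfer f]
    simpa using hMb 0 (by norm_num) (k₃ - k₁) (k₁, k₂)
  rcases eq_or_ne e₃ e₁ with rfl | hne
  · refine ⟨M, fun i => ⟨h.latPeriodic_section h₁ h₂ h₃ i, fun x => hbd _ _ _, [], by simpa using hM,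
      fun x e he he1 _ => ?_⟩⟩
    simp only [section_eq_transfer₂ h₁ h₂ h₃]
    have hc := h.contDiff_section (k₃ i 0 - k₁ i 0)
    have hle : (4 : ℕ∞ω) ≤ ∞ := WithTop.coe_le_coe.2 le_top
    refine ⟨((hc.of_le hle).comp
      (contDiff_const.add (ContinuousLinearMap.contDiff _))).contDiffAt, fun n hn => ?_⟩
    have h4 := iteratedFDeriv_comp_affine (f := fun y => transfer f (k₃ i 0 - k₁ i 0, y))
      (dir₂ e₃ e₂) (k₁ i 0, k₂ i 0) (n := n) (x := x)
      (hc.of_le (by exact_mod_cast le_top)).contDiffAt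
    rw [h4]
    refine (norm_comp_le_of_norm_le_one _ (norm_dir₂_le he₁ he₂)).trans ((hMb n hn _ _).trans ?_)
    exact le_mul_of_one_le_right hM ((one_le_inv₀ (by positivity)).2 (pow_le_one₀ he.le he1))
  · have he' : |e₃ - e₁| = 1 := by
      have : 0 < |e₃ - e₁| := abs_pos.2 (sub_ne_zero.2 hne)
      omega
    obtain ⟨B, hB, hb⟩ := h.section_deriv h₁ h₂ h₃ he₁ he₂ he'
    refine ⟨M + B + 1, fun i => ⟨h.latPeriodic_section h₁ h₂ h₃ i, fun x => ?_,
      [pole (e₃ - e₁) k₁ k₃ i], ?_, fun x e he0 he1 hx => ?_⟩⟩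
    · linarith [hbd (k₁ i x) (k₂ i x) (k₃ i x)]
    · simp only [List.length_cons, List.length_nil]
      push_cast
      linarith
    · obtain ⟨c, d⟩ := hb i x e he0 he1 (hx _ (by simp))
      refine ⟨c, fun n hn => (d n hn).trans ?_⟩
      rw [add_zero]
      gcongr
      linarith

/-- At the pole itself the value is bounded because `smooth_on` prescribes a smooth periodic
function at zero transfer; elsewhere `section_deriv` applies. -/
theorem SingSpace.doublePole (h : SingSpace A 2 f) (h₁ : Aff e₁ k₁) (h₂ : Aff e₂ k₂)
    (h₃ : Aff e₃ k₃) (he₁ : |e₁| ≤ 1) (he₂ : |e₂| ≤ 1) (he : |e₃ - e₁| = 1) :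
    ∃ B : ℝ, ∀ i, DoublePole A B (pole (e₃ - e₁) k₁ k₃ i)
      fun x => f (k₁ i x) (k₂ i x) (k₃ i x) := by
  obtain ⟨B, hB, hb⟩ := h.section_deriv h₁ h₂ h₃ he₁ he₂ he
  obtain ⟨M, hM, hMb⟩ := h.exists_bound_on 0
  refine ⟨B + M, fun i => ⟨h.latPeriodic_section h₁ h₂ h₃ i, fun x hx => ?_,
    fun x e he0 he1 hx => ⟨(hb i x e he0 he1 hx).1, fun n hn =>
      ((hb i x e he0 he1 hx).2 n hn).trans ?_⟩⟩⟩
  · have h4 : k₃ i x - k₁ i x ∈ recipLattice A := by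
      have h5 : (((e₃ - e₁ : ℤ)) : ℝ) • (x - pole (e₃ - e₁) k₁ k₃ i) = k₃ i x - k₁ i x := by
        have : (((e₃ - e₁ : ℤ)) : ℝ) * ((e₃ - e₁ : ℤ)) = 1 := by
          have h2 : (e₃ - e₁) * (e₃ - e₁) = 1 := by rw [← abs_mul_abs_self, he, one_mul]
          exact_mod_cast h2
        rw [sub_pole he, smul_smul, this, one_smul, h₁ i x, h₃ i x]
        push_cast
        module
      rw [← h5]
      exact zsmul_mem_recipLattice _ hx
    rw [eq_transfer f, h.transfer_lattice h4]
    have := hMb (k₁ i x, k₂ i x)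
    rw [norm_iteratedFDeriv_zero] at this
    linarith
  · gcongr
    linarith

end Sections

/-! ### Smoothness of the lattice sums in the momenta, by means of Banach spaces -/

/-! ### Smooth families of continuous functions on a compact space -/

section CompactFamily

variable {K : Type} [TopologicalSpace K] {E F : Type} [NormedAddCommGroup E]
  [NormedSpace ℝ E] [NormedAddCommGroup F] [NormedSpace ℝ F]

/-- Pointwise evaluation of a continuous family of continuous linear maps. -/
def familyApply (K E F : Type) [TopologicalSpace K] [CompactSpace K] [NormedAddCommGroup E]
    [NormedSpace ℝ E] [NormedAddCommGroup F] [NormedSpace ℝ F] :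
    C(K, E →L[ℝ] F) →L[ℝ] E →L[ℝ] C(K, F) :=
  LinearMap.mkContinuous₂
    (LinearMap.mk₂ ℝ (fun (T : C(K, E →L[ℝ] F)) (v : E) =>
        (⟨fun x => T x v, T.continuous.clm_apply continuous_const⟩ : C(K, F)))
      (fun _ _ _ => by ext; simp) (fun _ _ _ => by ext; simp)
      (fun _ _ _ => by ext; simp) (fun _ _ _ => by ext; simp)) 1 fun T v => by
    rw [one_mul]
    refine (ContinuousMap.norm_le _ (by positivity)).2 fun x => ?_
    exact ((T x).le_opNorm v).trans (mul_le_mul_of_nonneg_right (T.norm_coe_le_norm x)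
      (norm_nonneg v))

/-- `f k x` is smooth in `k`, with derivatives continuous in both variables. -/
structure SmoothFamily (f : E → K → F) : Prop where
  contDiff : ∀ x, ContDiff ℝ ∞ fun k => f k x
  continuous : ∀ p : ℕ, Continuous fun z : E × K => iteratedFDeriv ℝ p (fun k => f k z.2) z.1

theorem SmoothFamily.continuous_uncurry {f : E → K → F} (h : SmoothFamily f) :
    Continuous fun z : E × K => f z.1 z.2 := by
  have h0 := h.continuous 0
  have : (fun z : E × K => f z.1 z.2) = fun z : E × K =>
      continuousMultilinearCurryFin0 ℝ E F (iteratedFDeriv ℝ 0 (fun k => f k z.2) z.1) := by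
    ext z
    simp
  rw [this]
  exact (LinearIsometryEquiv.continuous _).comp h0

/-- A smooth family as a curve of continuous functions. -/
def SmoothFamily.toMap {f : E → K → F} (h : SmoothFamily f) (k : E) : C(K, F) :=
  ⟨fun x => f k x, h.continuous_uncurry.comp (continuous_const.prodMk continuous_id)⟩

theorem SmoothFamily.continuous_toMap {f : E → K → F} (h : SmoothFamily f) :
    Continuous h.toMap :=
  ContinuousMap.continuous_of_continuous_uncurry _ h.continuous_uncurry

theorem SmoothFamily.deriv {f : E → K → F} (h : SmoothFamily f) :
    SmoothFamily fun k x => fderiv ℝ (fun k' => f k' x) k where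
  contDiff x := (h.contDiff x).fderiv_right (m := ∞) (by norm_cast)
  continuous p := by
    have h1 := h.continuous (p + 1)
    have : (fun z : E × K => iteratedFDeriv ℝ p (fun k => fderiv ℝ (fun k' => f k' z.2) k) z.1) =
        fun z : E × K => continuousMultilinearCurryRightEquiv' ℝ p E F
          (iteratedFDeriv ℝ (p + 1) (fun k => f k z.2) z.1) := by
      ext1 z
      rw [iteratedFDeriv_succ_eq_comp_right, Function.comp_apply,
        LinearIsometryEquiv.apply_symm_apply]
    rw [this]
    exact (LinearIsometryEquiv.continuous _).comp h1

variable [CompactSpace K]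

/-- The derivative family is itself a continuous curve in sup norm, so the mean value estimate for
the remainder is uniform over the compact space. -/
theorem SmoothFamily.hasFDerivAt {f : E → K → F} (h : SmoothFamily f) (k : E) :
    HasFDerivAt h.toMap (familyApply K E F (h.deriv.toMap k)) k := by
  rw [hasFDerivAt_iff_isLittleO_nhds_zero, Asymptotics.isLittleO_iff]
  intro c hc
  obtain ⟨δ, hδ, hball⟩ := Metric.continuousAt_iff.1
    (h.deriv.continuous_toMap.continuousAt (x := k)) c hc
  filter_upwards [Metric.ball_mem_nhds (0 : E) hδ] with v hv
  rw [mem_ball_zero_iff] at hv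
  refine (ContinuousMap.norm_le _ (by positivity)).2 fun x => ?_
  change ‖f (k + v) x - f k x - fderiv ℝ (fun k' => f k' x) k v‖ ≤ c * ‖v‖
  have hd : ∀ k', DifferentiableAt ℝ (fun k' => f k' x) k' := fun k' =>
    ((h.contDiff x).differentiable (by simp)).differentiableAt
  have := Convex.norm_image_sub_le_of_norm_hasFDerivWithin_le (𝕜 := ℝ) (s := Metric.ball k δ)
    (f := fun k' => f k' x - fderiv ℝ (fun k' => f k' x) k k')
    (f' := fun k' => fderiv ℝ (fun k' => f k' x) k' - fderiv ℝ (fun k' => f k' x) k)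
    (C := c) (x := k) (y := k + v)
    (fun k' _ => ((hd k').hasFDerivAt.sub
      (ContinuousLinearMap.hasFDerivAt _)).hasFDerivWithinAt)
    (fun k' hk' => by
      have h1 := (h.deriv.toMap k' - h.deriv.toMap k).norm_coe_le_norm x
      rw [← dist_eq_norm] at h1
      exact h1.trans (hball (by simpa using hk')).le)
    (convex_ball k δ) (Metric.mem_ball_self hδ) (by simpa using hv)
  rw [add_sub_cancel_left k v] at this
  rw [sub_sub_sub_comm, ← map_sub, add_sub_cancel_left] at this
  exact this

/-- The derivative is again the curve of a smooth family, followed by a continuous linear map. The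
target space changes to linear maps, hence the induction over all `F`. -/
theorem SmoothFamily.contDiff_toMap {f : E → K → F} (h : SmoothFamily f) :
    ContDiff ℝ ∞ h.toMap := by
  refine contDiff_infty.2 fun n => ?_
  induction n generalizing F with
  | zero => exact contDiff_zero.2 h.continuous_toMap
  | succ n ih =>
    push_cast
    exact contDiff_succ_iff_hasFDerivAt.2
      ⟨fun k => familyApply K E F (h.deriv.toMap k),
        ContDiff.comp (g := fun T => familyApply K E F T) (ContinuousLinearMap.contDiff _)
          (ih h.deriv), h.hasFDerivAt⟩

end CompactFamily

/-! ### Fourier coefficients on the unit cell -/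

/-- Lets results on the Brillouin zone be reused for the unit cell, which is the zone of the
reciprocal basis. -/
theorem recipBasis_recipBasis (A : Basis (Fin 3) ℝ E3) : recipBasis (recipBasis A) = A :=
  LinearMap.BilinForm.dualBasis_dualBasis dotForm_nondegenerate
    ⟨fun x y => by simp [dotForm_apply, real_inner_comm]⟩ A

theorem exists_inner_eq {G R : E3} (hG : G ∈ recipLattice A) (hR : R ∈ lattice A) :
    ∃ n : ℤ, (inner ℝ G R : ℝ) = n * (2 * Real.pi) := by
  refine Submodule.span_induction ?_ ⟨0, by simp⟩ ?_ ?_ hG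
  · rintro _ ⟨i, rfl⟩
    refine Submodule.span_induction ?_ ⟨0, by simp⟩ ?_ ?_ hR
    · rintro _ ⟨j, rfl⟩
      rw [inner_recipBasis]
      exact ⟨if j = i then 1 else 0, by split_ifs <;> simp⟩
    · rintro x y - - ⟨a, ha⟩ ⟨b, hb⟩
      exact ⟨a + b, by rw [inner_add_right, ha, hb]; push_cast; ring⟩
    · rintro n x - ⟨a, ha⟩
      refine ⟨n * a, ?_⟩
      rw [← Int.cast_smul_eq_zsmul ℝ, inner_smul_right, ha]
      push_cast
      ring
  · rintro x y - - ⟨a, ha⟩ ⟨b, hb⟩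
    exact ⟨a + b, by rw [inner_add_left, ha, hb]; push_cast; ring⟩
  · rintro n x - ⟨a, ha⟩
    refine ⟨n * a, ?_⟩
    rw [← Int.cast_smul_eq_zsmul ℝ, inner_smul_left, ha]
    simp only [conj_trivial]
    push_cast
    ring

/-- The plane wave `exp(i G·r)`. -/
def wave (G r : E3) : ℂ := Complex.exp (Complex.I * ((inner ℝ G r : ℝ) : ℂ))

theorem continuous_wave (G : E3) : Continuous (wave G) := by
  unfold wave
  fun_prop

theorem wave_add_left (G G' r : E3) : wave (G + G') r = wave G r * wave G' r := by
  simp only [wave, ← Complex.exp_add, inner_add_left]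
  push_cast
  ring_nf

theorem wave_add_right (G r r' : E3) : wave G (r + r') = wave G r * wave G r' := by
  simp only [wave, ← Complex.exp_add, inner_add_right]
  push_cast
  ring_nf

theorem wave_zero (r : E3) : wave 0 r = 1 := by simp [wave]

theorem conj_wave (G r : E3) : conj (wave G r) = wave (-G) r := by
  simp [wave, ← Complex.exp_conj]

theorem wave_lattice {G R : E3} (hG : G ∈ recipLattice A) (hR : R ∈ lattice A) :
    wave G R = 1 := by
  obtain ⟨n, hn⟩ := exists_inner_eq hG hR
  rw [wave, hn, Complex.exp_eq_one_iff]
  exact ⟨n, by push_cast; ring⟩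

theorem zoneAvg_recipBasis (F : E3 → ℂ) :
    zoneAvg (recipBasis A) F =
      ((volume.real (unitCell A))⁻¹ : ℝ) * ∫ r in unitCell A, F r := by
  rw [zoneAvg, brillouinZone, recipBasis_recipBasis, setAverage_eq, Complex.real_smul]

theorem volume_unitCell_pos : 0 < volume.real (unitCell A) := by
  have := volume_zone_pos (A := recipBasis A)
  rwa [brillouinZone, recipBasis_recipBasis] at this

/-- For `G ≠ 0`, translation by `(π / ‖G‖ ^ 2) • G` multiplies the wave by -1 and preserves the
average, which is therefore zero. -/
theorem integral_wave {G : E3} (hG : G ∈ recipLattice A) :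
    ∫ r in unitCell A, wave G r = if G = 0 then (volume.real (unitCell A) : ℂ) else 0 := by
  split_ifs with h0
  · subst h0
    simp [wave_zero, Measure.real]
  · have hper : LatPeriodic (recipBasis A) (wave G) := fun r R hR => by
      rw [recipLattice, recipBasis_recipBasis] at hR
      rw [wave_add_right, wave_lattice hG hR, mul_one]
    have h1 := zoneAvg_translate hper ((Real.pi / ‖G‖ ^ 2) • G)
    have hw : wave G ((Real.pi / ‖G‖ ^ 2) • G) = -1 := by
      have : ‖G‖ ≠ 0 := norm_ne_zero_iff.2 h0
      rw [wave, inner_smul_right, real_inner_self_eq_norm_sq, div_mul_cancel₀ _ (by positivity),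
        mul_comm, Complex.exp_pi_mul_I]
    simp only [wave_add_right, hw] at h1
    rw [zoneAvg_const_mul, zoneAvg_recipBasis] at h1
    have h2 : ((volume.real (unitCell A))⁻¹ : ℝ) * ∫ r in unitCell A, wave G r = (0 : ℂ) := by
      linear_combination (-1 / 2 : ℂ) * h1
    refine (mul_eq_zero.1 h2).resolve_left ?_
    exact_mod_cast (inv_pos.2 volume_unitCell_pos).ne'

/-- The closed unit cell. -/
abbrev Cell (A : Basis (Fin 3) ℝ E3) : Type := closure (unitCell A)

instance : CompactSpace (Cell A) :=
  isCompact_iff_compactSpace.1 (ZSpan.fundamentalDomain_isBounded A).isCompact_closure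

/-- The volume of the unit cell, as a measure on the closed unit cell. -/
def cellMeasure (A : Basis (Fin 3) ℝ E3) : Measure (Cell A) :=
  Measure.comap Subtype.val (volume.restrict (unitCell A))

theorem volume_unitCell_ne_top : volume (unitCell A) ≠ ⊤ :=
  (ZSpan.fundamentalDomain_isBounded A).measure_lt_top.ne

instance : IsFiniteMeasure (cellMeasure A) := by
  refine ⟨?_⟩
  rw [cellMeasure, comap_subtype_coe_apply isClosed_closure.measurableSet]
  exact (measure_mono (Set.subset_univ _)).trans_lt (by
    rw [Measure.restrict_apply_univ]
    exact volume_unitCell_ne_top.lt_top)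

theorem integral_cell (f : E3 → ℂ) : ∫ x : Cell A, f x ∂cellMeasure A = ∫ r in unitCell A, f r := by
  rw [cellMeasure, integral_subtype_comap isClosed_closure.measurableSet,
    Measure.restrict_restrict isClosed_closure.measurableSet,
    Set.inter_eq_right.2 subset_closure]

/-- The plane wave on the unit cell. -/
def cellWave (A : Basis (Fin 3) ℝ E3) (G : E3) : C(Cell A, ℂ) :=
  ⟨fun r => wave G r, (continuous_wave G).comp continuous_subtype_val⟩

/-- Normalized plane waves in `L²`. -/
def waveLp (A : Basis (Fin 3) ℝ E3) (G : recipLattice A) : Lp ℂ 2 (cellMeasure A) :=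
  ((√(volume.real (unitCell A)))⁻¹ : ℂ) • ContinuousMap.toLp 2 (cellMeasure A) ℂ (cellWave A G)

theorem orthonormal_waveLp : Orthonormal ℂ (waveLp A) := by
  rw [orthonormal_iff_ite]
  intro G G'
  have h0 := volume_unitCell_pos (A := A)
  have h1 : ∫ x : Cell A, cellWave A G' x * conj (cellWave A G x) ∂cellMeasure A =
      if G = G' then (volume.real (unitCell A) : ℂ) else 0 := by
    have e : ∀ x : Cell A, cellWave A G' x * conj (cellWave A G x) = wave (G' - G : E3) x := fun x => by
      change wave G' x * conj (wave G x) = _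
      rw [conj_wave, ← wave_add_left, sub_eq_add_neg]
    simp only [e]
    rw [integral_cell, integral_wave (sub_mem G'.2 G.2)]
    simp only [sub_eq_zero, ← Subtype.ext_iff, eq_comm]
  rw [waveLp, waveLp, inner_smul_left, inner_smul_right, ContinuousMap.inner_toLp, h1]
  split_ifs
  · rw [← Complex.ofReal_inv, Complex.conj_ofReal]
    norm_cast
    rw [← mul_assoc, ← mul_inv, Real.mul_self_sqrt h0.le, inv_mul_cancel₀ h0.ne']
  · simp

/-- Square summable families over the reciprocal lattice. -/
abbrev L2 (A : Basis (Fin 3) ℝ E3) : Type := lp (fun _ : recipLattice A => ℂ) 2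

/-- The Fourier coefficients of a continuous function on the unit cell. -/
def fourierCoeffs (A : Basis (Fin 3) ℝ E3) : C(Cell A, ℂ) →L[ℂ] L2 A :=
  (√(volume.real (unitCell A)) : ℂ) •
    (ContinuousLinearMap.adjoint
      (orthonormal_waveLp (A := A)).orthogonalFamily.linearIsometry.toContinuousLinearMap ∘L
        ContinuousMap.toLp 2 (cellMeasure A) ℂ)

/-- The adjoint of the isometry spanned by the normalized waves delivers square summable
coefficients as a bounded linear map, so only orthonormality of the waves is used and not
completeness. The factor `√|Ω|` undoes their normalization. -/
theorem fourierCoeffs_apply (f : C(Cell A, ℂ)) (G : recipLattice A) :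
    fourierCoeffs A f G = ∫ x : Cell A, f x * wave (-(G : E3)) x ∂cellMeasure A := by
  classical
  have h0 : (√(volume.real (unitCell A)) : ℂ) ≠ 0 := by
    exact_mod_cast (Real.sqrt_pos.2 volume_unitCell_pos).ne'
  have e : ∀ x : L2 A, x G = inner ℂ (lp.single 2 G (1 : ℂ)) x := fun x => by
    rw [lp.inner_single_left]
    simp
  rw [fourierCoeffs, smul_apply, lp.coeFn_smul, Pi.smul_apply, e,
    ContinuousLinearMap.comp_apply, ContinuousLinearMap.adjoint_inner_right,
    LinearIsometry.coe_toContinuousLinearMap, OrthogonalFamily.linearIsometry_apply_single,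
    LinearIsometry.toSpanSingleton_apply, one_smul, waveLp, inner_smul_left,
    ContinuousMap.inner_toLp, smul_eq_mul, ← mul_assoc, ← Complex.ofReal_inv, Complex.conj_ofReal,
    Complex.ofReal_inv, mul_inv_cancel₀ h0, one_mul]
  refine integral_congr_ae (Filter.Eventually.of_forall fun x => ?_)
  change f x * conj (wave G x) = _
  rw [conj_wave]

/-! ### The Coulomb multiplier -/

/-- Bounded families over the reciprocal lattice. -/
abbrev Linf (A : Basis (Fin 3) ℝ E3) : Type := lp (fun _ : recipLattice A => ℂ) ⊤

/-- `q + G ≠ 0` for all nonzero reciprocal lattice vectors `G`. -/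
def Regular (A : Basis (Fin 3) ℝ E3) (q : E3) : Prop :=
  ∀ G ∈ recipLattice A, G ≠ 0 → q + G ≠ 0

theorem regular_of_notMem {q : E3} (hq : q ∉ recipLattice A) : Regular A q := by
  intro G hG _ h
  exact hq (by rw [eq_neg_of_add_eq_zero_left h]; exact neg_mem hG)

theorem Regular.exists_lower_bound {q : E3} (h : Regular A q) :
    ∃ c : ℝ, 0 < c ∧ ∀ G ∈ recipLattice A, G ≠ 0 → c ≤ ‖q + G‖ := by
  by_cases hq : q ∈ recipLattice A
  · have h0 : q = 0 := by
      by_contra h0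
      exact h (-q) (neg_mem hq) (neg_ne_zero.2 h0) (add_neg_cancel q)
    obtain ⟨l, hl, hl'⟩ := exists_norm_lower_bound A
    refine ⟨l, hl, fun G hG hG0 => ?_⟩
    rw [h0, zero_add]
    exact hl' G hG hG0
  · refine ⟨latDist A q, latDist_pos_iff.2 hq, fun G hG _ => ?_⟩
    rw [← latDist_add q hG]
    exact latDist_le_norm _

theorem memℓp_top_of_bound {f : recipLattice A → ℂ} {B : ℝ} (h : ∀ G, ‖f G‖ ≤ B) :
    Memℓp f ⊤ := memℓp_infty ⟨B, by rintro _ ⟨G, rfl⟩; exact h G⟩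

/-- The Fourier multiplier of the Coulomb kernel, without the term `G = 0`. -/
def coulomb (q G : E3) : ℂ := if G = 0 then 0 else ((1 / ‖q + G‖ ^ 2 : ℝ) : ℂ)

/-- With `D G = coulomb q₀ G`, expanding the square for `G ≠ 0` gives `‖q + G‖² = ‖q₀ + G‖² (1 + D G
(2⟪q - q₀, q₀ + G⟫ + ‖q - q₀‖²))`. The bracket is a polynomial in `q` with values in the Banach
algebra of bounded families, equal to 1 at `q₀`, and inversion there is smooth near 1. -/
theorem Regular.exists_multiplier {q₀ : E3} (h : Regular A q₀) :
    ∃ N : E3 → Linf A, ContDiffAt ℝ ∞ N q₀ ∧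
      ∀ᶠ q in nhds q₀, ∀ G : recipLattice A, N q G = coulomb q G := by
  obtain ⟨c, hc, hlow⟩ := h.exists_lower_bound
  have hb : ∀ G : recipLattice A, ‖coulomb q₀ G‖ ≤ 1 / c ^ 2 := fun G => by
    unfold coulomb
    split_ifs with h0
    · rw [norm_zero]
      positivity
    · rw [Complex.norm_real, Real.norm_of_nonneg (by positivity)]
      have := hlow G G.2 h0
      gcongr
  set D : Linf A := ⟨fun G => coulomb q₀ G, memℓp_top_of_bound hb⟩ with hD
  -- The inner product grows like `‖q₀ + G‖`, but `coulomb` decays like its inverse square; the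
  -- product is bounded uniformly in `G`, so the linear term lands in `Linf A`.
  have hb' : ∀ (v : E3) (G : recipLattice A),
      ‖coulomb q₀ G * ((2 * inner ℝ v (q₀ + G) : ℝ) : ℂ)‖ ≤ 2 / c * ‖v‖ := fun v G => by
    unfold coulomb
    split_ifs with h0
    · rw [zero_mul, norm_zero]
      positivity
    · have h1 := hlow G G.2 h0
      have h2 : 0 < ‖q₀ + (G : E3)‖ := hc.trans_le h1
      rw [norm_mul, Complex.norm_real, Complex.norm_real, Real.norm_of_nonneg (by positivity),
        Real.norm_eq_abs, abs_mul, abs_two]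
      calc _ ≤ 1 / ‖q₀ + (G : E3)‖ ^ 2 * (2 * (‖v‖ * ‖q₀ + (G : E3)‖)) := by
            gcongr
            exact abs_real_inner_le_norm _ _
        _ = 2 / ‖q₀ + (G : E3)‖ * ‖v‖ := by field_simp
        _ ≤ _ := by gcongr
  let Λ : E3 →L[ℝ] Linf A := LinearMap.mkContinuous
    { toFun := fun v => ⟨fun G => coulomb q₀ G * ((2 * inner ℝ v (q₀ + G) : ℝ) : ℂ),
        memℓp_top_of_bound (hb' v)⟩
      map_add' := fun v w => by
        ext G
        change coulomb q₀ G * _ = coulomb q₀ G * _ + coulomb q₀ G * _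
        rw [inner_add_left]
        push_cast
        ring
      map_smul' := fun r v => by
        ext G
        change coulomb q₀ G * _ = (r : ℝ) • (coulomb q₀ G * _)
        rw [inner_smul_left, Complex.real_smul]
        simp only [conj_trivial]
        push_cast
        ring } (2 / c) fun v => lp.norm_le_of_forall_le (by positivity) (hb' v)
  have hΛ : ∀ v (G : recipLattice A),
      Λ v G = coulomb q₀ G * ((2 * inner ℝ v (q₀ + G) : ℝ) : ℂ) := fun v G => rfl
  set P : E3 → Linf A := fun q => 1 + (Λ (q - q₀) + ‖q - q₀‖ ^ 2 • D) with hP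
  have hPs : ContDiff ℝ ∞ P := by
    refine contDiff_const.add ((Λ.contDiff.comp (contDiff_id.sub contDiff_const)).add
      (ContDiff.smul (f := fun q => ‖q - q₀‖ ^ 2) (g := fun _ => D) ?_ contDiff_const))
    exact (contDiff_id.sub contDiff_const).norm_sq ℝ
  have hP0 : P q₀ = 1 := by simp [hP]
  refine ⟨fun q => Ring.inverse (P q) * D, ?_, ?_⟩
  · have hinv : ContDiffAt ℝ ∞ Ring.inverse (P q₀) := by
      rw [hP0]
      exact contDiffAt_ringInverse ℝ (1 : (Linf A)ˣ)
    exact (hinv.comp q₀ hPs.contDiffAt).mul contDiffAt_const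
  · have hu : ∀ᶠ q in nhds q₀, IsUnit (P q) := by
      refine hPs.continuous.continuousAt.eventually (Units.isOpen.mem_nhds ?_)
      rw [hP0]
      exact isUnit_one
    filter_upwards [hu] with q hq G
    have h1 : P q * (Ring.inverse (P q) * D) = D := by
      rw [← mul_assoc, Ring.mul_inverse_cancel _ hq, one_mul]
    set N := Ring.inverse (P q) * D
    have h2 : (1 + (coulomb q₀ G * ((2 * inner ℝ (q - q₀) (q₀ + G) : ℝ) : ℂ) +
        ((‖q - q₀‖ ^ 2 : ℝ) : ℂ) * coulomb q₀ G)) * N G = coulomb q₀ G := by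
      have := congrFun (congrArg (fun x : Linf A => (x : recipLattice A → ℂ)) h1) G
      exact this
    unfold coulomb at h2 ⊢
    split_ifs at h2 ⊢ with h0
    · simpa using h2
    · have hpos : (0 : ℝ) < ‖q₀ + (G : E3)‖ ^ 2 := pow_pos (hc.trans_le (hlow G G.2 h0)) 2
      have hq2 : ‖q + (G : E3)‖ ^ 2 = ‖q₀ + (G : E3)‖ ^ 2 +
          (2 * inner ℝ (q - q₀) (q₀ + G) + ‖q - q₀‖ ^ 2) := by
        have : q + (G : E3) = (q₀ + G) + (q - q₀) := by abel
        rw [this, norm_add_sq_real, real_inner_comm]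
        ring
      have hpos' : ((‖q₀ + (G : E3)‖ ^ 2 : ℝ) : ℂ) ≠ 0 := by exact_mod_cast hpos.ne'
      have h3 : ((‖q + (G : E3)‖ ^ 2 : ℝ) : ℂ) * N G = 1 := by
        rw [one_div, Complex.ofReal_inv] at h2
        rw [hq2, Complex.ofReal_add, Complex.ofReal_add]
        linear_combination ((‖q₀ + (G : E3)‖ ^ 2 : ℝ) : ℂ) * h2 +
          (1 - (((2 * inner ℝ (q - q₀) (q₀ + G) : ℝ) : ℂ) + ((‖q - q₀‖ ^ 2 : ℝ) : ℂ)) * N G) *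
            mul_inv_cancel₀ hpos'
      have h4 : ((‖q + (G : E3)‖ ^ 2 : ℝ) : ℂ) ≠ 0 := fun h => by simp [h] at h3
      rw [one_div, Complex.ofReal_inv]
      exact eq_inv_of_mul_eq_one_right h3

/-- Multiplication of square summable by bounded families. -/
def mulL2 (A : Basis (Fin 3) ℝ E3) : Linf A →L[ℂ] L2 A →L[ℂ] L2 A :=
  lp.holderL 2 (fun _ => ContinuousLinearMap.mul ℂ ℂ) (K := 1) fun _ => by simp

theorem mulL2_apply (M : Linf A) (x : L2 A) (G : recipLattice A) :
    mulL2 A M x G = M G * x G := rfl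

/-! ### Pair products and the electron repulsion integrals -/

namespace Insulator

variable (S : Insulator A nocc nvir)

theorem smoothFamily (n : Band nocc nvir) :
    SmoothFamily fun (k : E3) (x : Cell A) => S.u n k x where
  contDiff x := S.orbital_smooth n x
  continuous p := (S.orbital_smooth_cont n p).comp
    (continuous_fst.prodMk (continuous_subtype_val.comp continuous_snd))

/-- `conj u_{n'k'} u_{nk}` as a function on the unit cell. -/
def pairMap (n' n : Band nocc nvir) (k : E3 × E3) : C(Cell A, ℂ) :=
  star ((S.smoothFamily n').toMap k.1) * (S.smoothFamily n).toMap k.2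

theorem contDiff_pairMap (n' n : Band nocc nvir) : ContDiff ℝ ∞ (S.pairMap n' n) := by
  refine ContDiff.mul ?_ ((S.smoothFamily n).contDiff_toMap.comp contDiff_snd)
  exact (starL' ℝ : C(Cell A, ℂ) ≃L[ℝ] C(Cell A, ℂ)).contDiff.comp
    ((S.smoothFamily n').contDiff_toMap.comp contDiff_fst)

/-- The Fourier coefficients of `conj u_{n'k'} u_{nk}`. -/
def pairCoeffs (n' n : Band nocc nvir) (k : E3 × E3) : L2 A :=
  fourierCoeffs A (S.pairMap n' n k)

theorem contDiff_pairCoeffs (n' n : Band nocc nvir) : ContDiff ℝ ∞ (S.pairCoeffs n' n) :=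
  ((fourierCoeffs A).restrictScalars ℝ).contDiff.comp (S.contDiff_pairMap n' n)

theorem pairProduct_eq_integral (n' n : Band nocc nvir) (k' k G : E3) :
    S.pairProduct n' k' n k G =
      ∫ r in unitCell A, conj (S.u n' k' r) * S.u n k r * wave (-G) r := by
  unfold pairProduct
  congr 1
  ext r
  change conj (wave k' r * S.u n' k' r) * wave (k' - k - G) r * (wave k r * S.u n k r) = _
  have h : wave (-k') r * (wave (k' - k - G) r * wave k r) = wave (-G) r := by
    rw [← wave_add_left, ← wave_add_left]
    congr 1
    abel
  rw [map_mul, conj_wave, ← h]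
  ring

theorem pairProduct_eq (n' n : Band nocc nvir) (k' k : E3) (G : recipLattice A) :
    S.pairProduct n' k' n k G = S.pairCoeffs n' n (k', k) G := by
  rw [pairCoeffs, fourierCoeffs_apply, pairProduct_eq_integral]
  exact (integral_cell _).symm

/-- Makes the second factor of the lattice sum a complex conjugate, so that the sum becomes an inner
product in `L2 A`. -/
theorem pairProduct_neg (n' n : Band nocc nvir) (k' k G : E3) :
    S.pairProduct n' k' n k (-G) = conj (S.pairProduct n k n' k' G) := by
  rw [pairProduct_eq_integral, pairProduct_eq_integral, ← integral_conj]
  congr 1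
  ext r
  rw [map_mul, map_mul, Complex.conj_conj, conj_wave]
  ring

/-- The charge `∫ conj u_{n'k'} u_{nk}`. -/
def charge (n' n : Band nocc nvir) (k' k : E3) : ℂ := S.pairProduct n' k' n k 0

/-- The lattice sum of the electron repulsion integral without the term `G = 0`. -/
def regularPart (n₁ n₂ n₃ n₄ : Band nocc nvir) (p : E3 × (E3 × E3)) : ℂ :=
  ∑' G : recipLattice A, coulomb p.1 G * S.pairProduct n₁ p.2.1 n₃ (p.2.1 + p.1) G *
    S.pairProduct n₂ p.2.2 n₄ (p.2.2 - p.1) (-(G : E3))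

/-- The prefactor `4π / |Ω|`. -/
def prefactor (A : Basis (Fin 3) ℝ E3) : ℂ := ((4 * Real.pi / volume.real (unitCell A) : ℝ) : ℂ)

theorem prefactor_ne_zero : prefactor A ≠ 0 := by
  have := volume_unitCell_pos (A := A)
  have : (0 : ℝ) < 4 * Real.pi / volume.real (unitCell A) := by positivity
  rw [prefactor]
  exact_mod_cast this.ne'

theorem regularPart_term {M : Linf A} {q : E3} (hM : ∀ G : recipLattice A, M G = coulomb q G)
    (n₁ n₂ n₃ n₄ : Band nocc nvir) (k₁ k₂ : E3) (G : recipLattice A) :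
    coulomb q G * S.pairProduct n₁ k₁ n₃ (k₁ + q) G *
      S.pairProduct n₂ k₂ n₄ (k₂ - q) (-(G : E3)) =
    inner ℂ (S.pairCoeffs n₄ n₂ (k₂ - q, k₂) G)
      (mulL2 A M (S.pairCoeffs n₁ n₃ (k₁, k₁ + q)) G) := by
  rw [pairProduct_neg, pairProduct_eq, pairProduct_eq, mulL2_apply, hM, RCLike.inner_apply]

/-- Locally the sum is an inner product of smooth `L2 A`-valued maps, one of them acted on by the
smooth multiplier. No series has to be differentiated term by term. -/
theorem contDiffAt_regularPart (n₁ n₂ n₃ n₄ : Band nocc nvir) {p : E3 × (E3 × E3)}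
    (hp : Regular A p.1) : ContDiffAt ℝ ∞ (S.regularPart n₁ n₂ n₃ n₄) p := by
  obtain ⟨N, hN, hN'⟩ := hp.exists_multiplier
  have e : S.regularPart n₁ n₂ n₃ n₄ =ᶠ[nhds p] fun p =>
      inner ℂ (S.pairCoeffs n₄ n₂ (p.2.2 - p.1, p.2.2))
        (mulL2 A (N p.1) (S.pairCoeffs n₁ n₃ (p.2.1, p.2.1 + p.1))) := by
    filter_upwards [continuousAt_fst.eventually hN'] with p hp
    rw [lp.inner_eq_tsum]
    exact tsum_congr fun G => S.regularPart_term hp n₁ n₂ n₃ n₄ p.2.1 p.2.2 G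
  refine ContDiffAt.congr_of_eventuallyEq ?_ e
  refine ContDiffAt.inner ℂ ?_ ?_
  · exact ((S.contDiff_pairCoeffs n₄ n₂).comp
      (contDiff_snd.snd.sub contDiff_fst |>.prodMk contDiff_snd.snd)).contDiffAt
  · have h1 : ContDiffAt ℝ ∞ (fun p : E3 × (E3 × E3) => mulL2 A (N p.1)) p :=
      ((mulL2 A).restrictScalars ℝ).contDiff.contDiffAt.comp p (hN.comp p contDiffAt_fst)
    have h2 : ContDiffAt ℝ ∞ (fun p : E3 × (E3 × E3) =>
        (mulL2 A (N p.1)).restrictScalars ℝ) p :=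
      (ContinuousLinearMap.restrictScalarsL ℂ (L2 A) (L2 A) ℝ ℝ).contDiff.contDiffAt.comp p h1
    exact h2.clm_apply ((S.contDiff_pairCoeffs n₁ n₃).comp
      (contDiff_snd.fst.prodMk (contDiff_snd.fst.add contDiff_fst))).contDiffAt

/-- Separates the term `G = 0`. At `q = 0` the convention `1 / 0 = 0` agrees with the omission of
that term from the ERI, so the formula also describes zero transfer. -/
theorem eri_eq (n₁ n₂ n₃ n₄ : Band nocc nvir) {q : E3} (hq : Regular A q) (k₁ k₂ : E3) :
    S.eri n₁ n₂ n₃ n₄ k₁ k₂ (k₁ + q) = prefactor A * (((1 / ‖q‖ ^ 2 : ℝ) : ℂ) *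
      (S.charge n₁ n₃ k₁ (k₁ + q) * S.charge n₂ n₄ k₂ (k₂ - q)) +
        S.regularPart n₁ n₂ n₃ n₄ (q, (k₁, k₂))) := by
  classical
  obtain ⟨N, -, hN'⟩ := hq.exists_multiplier
  have hN := hN'.self_of_nhds
  have hs : Summable fun G : recipLattice A => coulomb q G *
      S.pairProduct n₁ k₁ n₃ (k₁ + q) G * S.pairProduct n₂ k₂ n₄ (k₂ - q) (-(G : E3)) := by
    simp only [S.regularPart_term hN n₁ n₂ n₃ n₄ k₁ k₂]
    exact lp.summable_inner _ _
  rw [eri, prefactor, regularPart]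
  congr 1
  set z : ℂ := ((1 / ‖q‖ ^ 2 : ℝ) : ℂ) *
      (S.charge n₁ n₃ k₁ (k₁ + q) * S.charge n₂ n₄ k₂ (k₂ - q)) with hz
  have h1 : Summable fun G : recipLattice A => Pi.single (M := fun _ => ℂ) 0 z G :=
    (hasSum_pi_single (0 : recipLattice A) z).summable
  conv_rhs => rw [← tsum_pi_single (0 : recipLattice A) z]
  rw [← h1.tsum_add hs]
  refine tsum_congr fun G => ?_
  simp only [add_sub_cancel_left]
  by_cases hG : G = 0
  · subst hG
    simp only [Submodule.coe_zero, add_zero, Pi.single_eq_same, coulomb, neg_zero, if_true,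
      zero_mul, hz, charge]
    split_ifs with h0
    · simp [h0]
    · ring
  · have hG' : (G : E3) ≠ 0 := fun h => hG (Subtype.ext h)
    rw [if_neg (hq G G.2 hG'), Pi.single_eq_of_ne hG, zero_add, coulomb, if_neg hG']

end Insulator

/-! ### Order of the singularity of the electron repulsion integrals -/

/-! ### The Coulomb kernel near zero momentum transfer -/

/-- The Coulomb kernel `1 / |q|²`. -/
def kernel (q : E3) : ℂ := ((1 / ‖q‖ ^ 2 : ℝ) : ℂ)

theorem contDiffAt_kernel {q : E3} (hq : q ≠ 0) : ContDiffAt ℝ ∞ kernel q := by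
  refine Complex.ofRealCLM.contDiff.contDiffAt.comp q ?_
  refine contDiffAt_const.div (contDiff_norm_sq ℝ).contDiffAt ?_
  exact pow_ne_zero 2 (norm_ne_zero_iff.2 hq)

/-- The kernel is homogeneous of degree -2; scaling reduces the bound to the unit sphere, which is
compact. -/
theorem exists_kernel_bound (n : ℕ) :
    ∃ M : ℝ, 0 ≤ M ∧ ∀ x : E3, x ≠ 0 → ‖iteratedFDeriv ℝ n kernel x‖ ≤ M * (‖x‖⁻¹) ^ (n + 2) := by
  have hc : ContinuousOn (iteratedFDeriv ℝ n kernel) (Metric.sphere (0 : E3) 1) := fun u hu => by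
    have h0 : u ≠ 0 := by
      rintro rfl
      simp at hu
    exact (contDiffAt_iteratedFDeriv (contDiffAt_kernel h0) n).continuousAt.continuousWithinAt
  obtain ⟨M, hM⟩ := (isCompact_sphere (0 : E3) 1).exists_bound_of_continuousOn hc
  refine ⟨|M|, abs_nonneg _, fun x hx => ?_⟩
  set t := ‖x‖ with ht
  have ht0 : 0 < t := norm_pos_iff.2 hx
  set L : E3 →L[ℝ] E3 := t⁻¹ • ContinuousLinearMap.id ℝ E3 with hL
  have hu : ‖L x‖ = 1 := by
    simp [hL, norm_smul, ← ht, abs_of_pos ht0, ht0.ne']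
  have hu0 : L x ≠ 0 := fun h => by simp [h] at hu
  have hhom : kernel = fun y => (t⁻¹ ^ 2) • kernel (0 + L y) := by
    funext y
    simp only [kernel, hL, smul_apply, ContinuousLinearMap.id_apply, zero_add,
      norm_smul, norm_inv, Real.norm_of_nonneg ht0.le, Complex.real_smul]
    norm_cast
    field_simp
  have hk : ContDiffAt ℝ n kernel (0 + L x) := by
    rw [zero_add]
    exact (contDiffAt_kernel hu0).of_le (by exact_mod_cast le_top)
  have hk2 : ContDiffAt ℝ n (fun y => kernel (0 + L y)) x :=
    hk.comp (f := fun y => 0 + L y) x (contDiffAt_const.add L.contDiff.contDiffAt)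
  rw [hhom, iteratedFDeriv_const_smul_apply' hk2, norm_smul, iteratedFDeriv_comp_affine L 0 hk]
  have h1 := (iteratedFDeriv ℝ n kernel (0 + L x)).norm_compContinuousLinearMap_le fun _ => L
  have h2 : ‖iteratedFDeriv ℝ n kernel (0 + L x)‖ ≤ |M| :=
    (hM _ (by simpa using hu)).trans (le_abs_self M)
  have h3 : ‖L‖ ≤ t⁻¹ := by
    rw [hL, norm_smul, norm_inv, Real.norm_of_nonneg ht0.le]
    exact mul_le_of_le_one_right (by positivity) ContinuousLinearMap.norm_id_le
  rw [Finset.prod_const, Finset.card_univ, Fintype.card_fin] at h1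
  have h4 : ‖(t⁻¹ ^ 2 : ℝ)‖ = t⁻¹ ^ 2 := Real.norm_of_nonneg (by positivity)
  rw [h4]
  calc _ ≤ t⁻¹ ^ 2 * (|M| * (t⁻¹) ^ n) := by
        gcongr
        exact h1.trans (by gcongr)
    _ = _ := by ring

/-! ### Smooth functions that are periodic in the parameters -/

/-- `H (q, k)` is smooth for `‖q‖ < δ` and periodic in `k`. -/
structure ParamSmooth (A : Basis (Fin 3) ℝ E3) (δ : ℝ) (H : E3 × (E3 × E3) → ℂ) : Prop where
  contDiffAt : ∀ p, ‖p.1‖ < δ → ContDiffAt ℝ ∞ H p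
  periodic : ∀ q y g₁ g₂, ‖q‖ < δ → g₁ ∈ recipLattice A → g₂ ∈ recipLattice A →
    H (q, y + (g₁, g₂)) = H (q, y)

/-- The `b`-th derivative with respect to the parameters. -/
def paramDeriv (b : ℕ) (H : E3 × (E3 × E3) → ℂ) (x : E3) (y : E3 × E3) :
    ContinuousMultilinearMap ℝ (fun _ : Fin b => E3 × E3) ℂ :=
  iteratedFDeriv ℝ b (fun y' => H (x, y')) y

section ParamSmooth

variable {δ : ℝ} {H H' : E3 × (E3 × E3) → ℂ}

theorem ParamSmooth.add (h : ParamSmooth A δ H) (h' : ParamSmooth A δ H') :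
    ParamSmooth A δ fun p => H p + H' p :=
  ⟨fun p hp => (h.contDiffAt p hp).add (h'.contDiffAt p hp), fun q y g₁ g₂ hq h₁ h₂ => by
    rw [h.periodic q y g₁ g₂ hq h₁ h₂, h'.periodic q y g₁ g₂ hq h₁ h₂]⟩

theorem ParamSmooth.mul (h : ParamSmooth A δ H) (h' : ParamSmooth A δ H') :
    ParamSmooth A δ fun p => H p * H' p :=
  ⟨fun p hp => (h.contDiffAt p hp).mul (h'.contDiffAt p hp), fun q y g₁ g₂ hq h₁ h₂ => by
    rw [h.periodic q y g₁ g₂ hq h₁ h₂, h'.periodic q y g₁ g₂ hq h₁ h₂]⟩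

theorem ParamSmooth.contDiff_param (h : ParamSmooth A δ H) {x : E3} (hx : ‖x‖ < δ) :
    ContDiff ℝ ∞ fun y => H (x, y) :=
  contDiff_iff_contDiffAt.2 fun y =>
    (h.contDiffAt (x, y) hx).comp y (contDiffAt_const.prodMk contDiffAt_id)

theorem ParamSmooth.contDiffAt_paramDeriv (h : ParamSmooth A δ H) (b : ℕ) {x : E3}
    (hx : ‖x‖ < δ) (y : E3 × E3) :
    ContDiffAt ℝ ∞ (fun p : E3 × (E3 × E3) => paramDeriv b H p.1 p.2) (x, y) :=
  contDiffAt_iteratedFDeriv_snd b (h.contDiffAt (x, y) hx)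

theorem ParamSmooth.contDiffAt_paramDeriv_left (h : ParamSmooth A δ H) (b : ℕ) {x : E3}
    (hx : ‖x‖ < δ) (y : E3 × E3) : ContDiffAt ℝ ∞ (fun x' => paramDeriv b H x' y) x :=
  (h.contDiffAt_paramDeriv b hx y).comp x (contDiffAt_id.prodMk contDiffAt_const)

theorem ParamSmooth.continuousAt_mixed (h : ParamSmooth A δ H) (a b : ℕ) {p : E3 × (E3 × E3)}
    (hp : ‖p.1‖ < δ) : ContinuousAt (fun p : E3 × (E3 × E3) =>
      iteratedFDeriv ℝ a (fun x' => paramDeriv b H x' p.2) p.1) p := by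
  have h1 : ContDiffAt ℝ ∞ (fun p : (E3 × E3) × E3 => paramDeriv b H p.2 p.1) (p.2, p.1) :=
    (h.contDiffAt_paramDeriv b hp p.2).comp (p.2, p.1)
      (contDiffAt_snd.prodMk contDiffAt_fst)
  have h2 := (contDiffAt_iteratedFDeriv_snd a h1).continuousAt
  exact h2.comp (f := fun p : E3 × (E3 × E3) => (p.2, p.1)) (x := p)
    (continuousAt_snd.prodMk continuousAt_fst)

theorem ParamSmooth.paramDeriv_periodic (h : ParamSmooth A δ H) (b : ℕ) {x g₁ g₂ : E3}
    (hx : ‖x‖ < δ) (y : E3 × E3) (h₁ : g₁ ∈ recipLattice A) (h₂ : g₂ ∈ recipLattice A) :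
    paramDeriv b H x (y + (g₁, g₂)) = paramDeriv b H x y := by
  rw [paramDeriv, ← iteratedFDeriv_comp_add_right]
  simp only [h.periodic x _ g₁ g₂ hx h₁ h₂]
  rfl

/-- By periodicity the parameters can be kept in a ball, and a closed ball of radius `r < δ` for the
transfer makes the domain compact. -/
theorem ParamSmooth.exists_mixed_bound (h : ParamSmooth A δ H) {r : ℝ} (hr : r < δ) (a b : ℕ) :
    ∃ C : ℝ, 0 ≤ C ∧ ∀ x y, ‖x‖ ≤ r →
      ‖iteratedFDeriv ℝ a (fun x' => paramDeriv b H x' y) x‖ ≤ C := by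
  set D := zoneBound A
  set K : Set (E3 × (E3 × E3)) := Metric.closedBall 0 r ×ˢ Metric.closedBall 0 D
  have hK : IsCompact K := (isCompact_closedBall _ _).prod (isCompact_closedBall _ _)
  obtain ⟨M, hM⟩ := hK.exists_bound_of_continuousOn (f := fun p : E3 × (E3 × E3) =>
      iteratedFDeriv ℝ a (fun x' => paramDeriv b H x' p.2) p.1) fun p hp =>
    (h.continuousAt_mixed a b ((mem_closedBall_zero_iff.1 hp.1).trans_lt hr)).continuousWithinAt
  refine ⟨|M|, abs_nonneg _, fun x y hx => ?_⟩
  obtain ⟨g₂, h₂, b₂⟩ := exists_reduce A y.1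
  obtain ⟨g₃, h₃, b₃⟩ := exists_reduce A y.2
  have e : (fun x' => paramDeriv b H x' (y + (-g₂, -g₃))) =ᶠ[nhds x]
      fun x' => paramDeriv b H x' y := by
    have : ∀ᶠ x' in nhds x, ‖x'‖ < δ :=
      continuous_norm.continuousAt.eventually (gt_mem_nhds (hx.trans_lt hr))
    filter_upwards [this] with x' hx'
    exact h.paramDeriv_periodic b hx' y (neg_mem h₂) (neg_mem h₃)
  rw [← (e.iteratedFDeriv ℝ a).self_of_nhds]
  refine (hM (x, y + (-g₂, -g₃)) ⟨mem_closedBall_zero_iff.2 hx, ?_⟩).trans (le_abs_self M)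
  rw [mem_closedBall_zero_iff, Prod.norm_def]
  simp only [Prod.fst_add, Prod.snd_add, ← sub_eq_add_neg]
  exact max_le b₂ b₃

theorem norm_fderiv_eq_norm_iteratedFDeriv_one {V W : Type} [NormedAddCommGroup V]
    [NormedSpace ℝ V] [NormedAddCommGroup W] [NormedSpace ℝ W] (f : V → W) (x : V) :
    ‖fderiv ℝ f x‖ = ‖iteratedFDeriv ℝ 1 f x‖ := by
  rw [← zero_add 1, ← norm_iteratedFDeriv_fderiv, norm_iteratedFDeriv_zero]

theorem ParamSmooth.exists_fderiv_bound (h : ParamSmooth A δ H) {r : ℝ} (hr : r < δ) (b : ℕ) :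
    ∃ C : ℝ, 0 ≤ C ∧ ∀ x y, ‖x‖ ≤ r → ‖fderiv ℝ (fun x' => paramDeriv b H x' y) x‖ ≤ C := by
  obtain ⟨C, hC, hC'⟩ := h.exists_mixed_bound hr 1 b
  refine ⟨C, hC, fun x y hx => ?_⟩
  rw [norm_fderiv_eq_norm_iteratedFDeriv_one]
  exact hC' x y hx

/-- All parameter derivatives of `H` vanish at `q = 0` to order `s`. -/
def VanishesToOrder (s : ℕ) (r : ℝ) (H : E3 × (E3 × E3) → ℂ) : Prop :=
  ∀ b : ℕ, ∃ C : ℝ, 0 ≤ C ∧ ∀ x y, ‖x‖ ≤ r → ‖paramDeriv b H x y‖ ≤ C * ‖x‖ ^ s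

theorem norm_le_of_fderiv_bound {W : Type} [NormedAddCommGroup W] [NormedSpace ℝ W] {f : E3 → W}
    {C ρ : ℝ} (hf : ∀ x, ‖x‖ ≤ ρ → DifferentiableAt ℝ f x)
    (hC : ∀ x, ‖x‖ ≤ ρ → ‖fderiv ℝ f x‖ ≤ C) (h0 : f 0 = 0) {x : E3} (hx : ‖x‖ ≤ ρ) :
    ‖f x‖ ≤ C * ‖x‖ := by
  have := (convex_closedBall (0 : E3) ρ).norm_image_sub_le_of_norm_fderiv_le (𝕜 := ℝ)
    (fun z hz => hf z (by simpa using hz)) (fun z hz => hC z (by simpa using hz))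
    (x := 0) (y := x) (by simpa using (norm_nonneg x).trans hx) (by simpa using hx)
  simpa [h0] using this

theorem ParamSmooth.differentiableAt (h : ParamSmooth A δ H) (b : ℕ) {x : E3} (hx : ‖x‖ < δ)
    (y : E3 × E3) : DifferentiableAt ℝ (fun x' => paramDeriv b H x' y) x :=
  (h.contDiffAt_paramDeriv_left b hx y).differentiableAt (by simp)

theorem ParamSmooth.vanishesToOrder_zero (h : ParamSmooth A δ H) {r : ℝ} (hr : r < δ) :
    VanishesToOrder 0 r H := fun b => by
  obtain ⟨C, hC, hC'⟩ := h.exists_mixed_bound hr 0 b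
  exact ⟨C, hC, fun x y hx => by simpa using hC' x y hx⟩

/-- If `H (0, ·)` is identically zero, so are all its parameter derivatives; the mean value
inequality in the transfer then gives the factor `‖x‖`. -/
theorem ParamSmooth.vanishesToOrder_one (h : ParamSmooth A δ H) {r : ℝ} (hr : r < δ)
    (h0 : ∀ y, H (0, y) = 0) : VanishesToOrder 1 r H := fun b => by
  obtain ⟨C, hC, hC'⟩ := h.exists_fderiv_bound hr b
  refine ⟨C, hC, fun x y hx => ?_⟩
  have h2 : paramDeriv b H 0 y = 0 := by
    simp only [paramDeriv, h0]
    exact congrFun (iteratedFDeriv_fun_zero (𝕜 := ℝ) (n := b)) y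
  rw [pow_one]
  exact norm_le_of_fderiv_bound (fun z hz => h.differentiableAt b (hz.trans_lt hr) y)
    (fun z hz => hC' z y hz) h2 hx

theorem VanishesToOrder.add (h : ParamSmooth A δ H) (h' : ParamSmooth A δ H') {s : ℕ} {r : ℝ}
    (hr : r < δ) (hv : VanishesToOrder s r H) (hv' : VanishesToOrder s r H') :
    VanishesToOrder s r fun p => H p + H' p := fun b => by
  obtain ⟨C, hC, hb⟩ := hv b
  obtain ⟨C', hC', hb'⟩ := hv' b
  refine ⟨C + C', by positivity, fun x y hx => ?_⟩
  have hx' := hx.trans_lt hr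
  have hle : ((b : ℕ) : ℕ∞ω) ≤ ∞ := by exact_mod_cast le_top
  have e : paramDeriv b (fun p => H p + H' p) x y = paramDeriv b H x y + paramDeriv b H' x y :=
    iteratedFDeriv_add_apply ((h.contDiff_param hx').of_le hle).contDiffAt
      ((h'.contDiff_param hx').of_le hle).contDiffAt
  rw [e, add_mul]
  exact (norm_add_le _ _).trans (add_le_add (hb x y hx) (hb' x y hx))

theorem VanishesToOrder.mul (h : ParamSmooth A δ H) (h' : ParamSmooth A δ H') {s s' : ℕ} {r : ℝ}
    (hr : r < δ) (hv : VanishesToOrder s r H) (hv' : VanishesToOrder s' r H') :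
    VanishesToOrder (s + s') r fun p => H p * H' p := fun b => by
  choose C hC hb using hv
  choose C' hC' hb' using hv'
  refine ⟨∑ i ∈ Finset.range (b + 1), (b.choose i : ℝ) * C i * C' (b - i),
    Finset.sum_nonneg fun i _ => mul_nonneg (mul_nonneg (by positivity) (hC _)) (hC' _),
    fun x y hx => ?_⟩
  have hx' := hx.trans_lt hr
  refine (norm_iteratedFDeriv_mul_le (h.contDiff_param hx') (h'.contDiff_param hx') y
    (n := b) (by exact_mod_cast le_top)).trans ?_
  rw [Finset.sum_mul]
  refine Finset.sum_le_sum fun i _ => ?_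
  have h1 := hb i x y hx
  have h2 := hb' (b - i) x y hx
  calc _ ≤ (b.choose i : ℝ) * (C i * ‖x‖ ^ s) * (C' (b - i) * ‖x‖ ^ s') := by
        refine mul_le_mul (mul_le_mul_of_nonneg_left h1 (by positivity)) h2 (norm_nonneg _) ?_
        exact mul_nonneg (by positivity) (mul_nonneg (hC i) (by positivity))
    _ = _ := by ring

/-- Each derivative in the transfer costs one order of vanishing. Only `a = 1` needs an argument;
for `a ≥ 2` the truncated exponent `2 - a` is 0 and boundedness is enough. -/
theorem ParamSmooth.exists_mixed_bound_of_vanishes (h : ParamSmooth A δ H) {r : ℝ} (hr0 : 0 < r)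
    (hr : r < δ) (hv : VanishesToOrder 2 r H) (a b : ℕ) :
    ∃ C : ℝ, 0 ≤ C ∧ ∀ x y, ‖x‖ ≤ r →
      ‖iteratedFDeriv ℝ a (fun x' => paramDeriv b H x' y) x‖ ≤ C * ‖x‖ ^ (2 - a) := by
  obtain ⟨C₀, hC₀, hb₀⟩ := hv b
  match a with
  | 0 => exact ⟨C₀, hC₀, fun x y hx => by simpa using hb₀ x y hx⟩
  | 1 =>
    obtain ⟨C, hC, hC'⟩ := h.exists_mixed_bound hr 2 b
    refine ⟨C, hC, fun x y hx => ?_⟩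
    set f := fun x' => paramDeriv b H x' y with hf
    have hfd : ∀ z, ‖z‖ ≤ r → ContDiffAt ℝ ∞ f z := fun z hz =>
      h.contDiffAt_paramDeriv_left b (hz.trans_lt hr) y
    -- A function that is `O(‖x‖ ^ 2)` has zero derivative at the origin; the bound on second
    -- derivatives then makes the first derivative `O(‖x‖)`.
    have h0 : fderiv ℝ f 0 = 0 := by
      have hO : f =O[nhds 0] fun x : E3 => ‖x - 0‖ ^ 2 := by
        refine Asymptotics.IsBigO.of_bound C₀ ?_
        filter_upwards [Metric.closedBall_mem_nhds (0 : E3) hr0] with z hz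
        have := hb₀ z y (by simpa using hz)
        simpa using this
      exact (hO.hasFDerivAt (by norm_num)).fderiv
    have h1 := norm_le_of_fderiv_bound (f := fderiv ℝ f) (C := C) (ρ := r)
      (fun z hz => ((hfd z hz).fderiv_right (m := ∞) (by norm_cast)).differentiableAt (by simp))
      (fun z hz => by
        rw [norm_fderiv_eq_norm_iteratedFDeriv_one, norm_iteratedFDeriv_fderiv]
        exact hC' z y hz) h0 hx
    rw [norm_fderiv_eq_norm_iteratedFDeriv_one] at h1
    simpa using h1
  | a + 2 =>
    obtain ⟨C, hC, hC'⟩ := h.exists_mixed_bound hr (a + 2) b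
    exact ⟨C, hC, fun x y hx => by simpa using hC' x y hx⟩

/-- In the Leibniz rule, `i` derivatives of the kernel give `‖x‖` to the power `-(i + 2)` and the
numerator gives the power `s - (a - i)`. Truncated subtraction only increases that exponent, which
is harmless since `‖x‖ ≤ 1`. -/
theorem hasAlgebraicSingularity_kernel_mul (h : ParamSmooth A δ H) {r : ℝ} (hr0 : 0 < r)
    (hr : r < δ) (hr1 : r ≤ 1) {s : ℕ}
    (hb : ∀ a b : ℕ, ∃ C : ℝ, 0 ≤ C ∧ ∀ x y, ‖x‖ ≤ r →
      ‖iteratedFDeriv ℝ a (fun x' => paramDeriv b H x' y) x‖ ≤ C * ‖x‖ ^ (s - a))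
    {f : E3 → E3 × E3 → ℂ} (hf : ∀ q y, q ≠ 0 → ‖q‖ < r → f q y = kernel q * H (q, y)) :
    HasAlgebraicSingularity ((s : ℝ) - 2) f 0 := by
  have hopen : IsOpen {q : E3 | q ≠ 0 ∧ ‖q‖ < r} :=
    isOpen_ne.inter (isOpen_lt continuous_norm continuous_const)
  have hle : ∀ n : ℕ, ((n : ℕ) : ℕ∞ω) ≤ ∞ := fun n => by exact_mod_cast le_top
  refine ⟨r, hr0, ?_, fun a b => ?_⟩
  · simp only [sub_zero]
    have : ContDiffOn ℝ ∞ (fun p : E3 × (E3 × E3) => kernel p.1 * H p)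
        {p | 0 < ‖p.1‖ ∧ ‖p.1‖ < r} := fun p hp =>
      (((contDiffAt_kernel (norm_pos_iff.1 hp.1)).comp p contDiffAt_fst).mul
        (h.contDiffAt p (hp.2.trans hr))).contDiffWithinAt
    exact this.congr fun p hp => hf p.1 p.2 (norm_pos_iff.1 hp.1) hp.2
  · choose M hM0 hM using exists_kernel_bound
    choose C hC hCb using hb
    refine ⟨∑ i ∈ Finset.range (a + 1), (a.choose i : ℝ) * M i * C (a - i) b,
      fun x y hx0 hx => ?_⟩
    rw [sub_zero] at hx0 hx ⊢
    have hxne : x ≠ 0 := norm_pos_iff.1 hx0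
    have e : (fun x' => iteratedFDeriv ℝ b (fun y' => f x' y') y) =ᶠ[nhds x]
        fun x' => kernel x' • paramDeriv b H x' y := by
      filter_upwards [hopen.mem_nhds ⟨hxne, hx⟩] with x' hx'
      have e2 : (fun y' => f x' y') = fun y' => kernel x' • H (x', y') := by
        funext y'
        rw [hf x' y' hx'.1 hx'.2, smul_eq_mul]
      rw [e2, iteratedFDeriv_const_smul_apply'
        ((h.contDiff_param (hx'.2.trans hr)).of_le (hle b)).contDiffAt]
      rfl
    rw [(e.iteratedFDeriv ℝ a).self_of_nhds]
    refine (norm_iteratedFDeriv_smul_le_of_contDiffAt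
      ((contDiffAt_kernel hxne).of_le (hle a))
      ((h.contDiffAt_paramDeriv_left b (hx.trans hr) y).of_le (hle a))).trans ?_
    rw [Finset.sum_mul]
    refine Finset.sum_le_sum fun i hi => ?_
    have hia : i ≤ a := Nat.lt_succ_iff.1 (Finset.mem_range.1 hi)
    have hpow : (‖x‖⁻¹) ^ (i + 2) * ‖x‖ ^ (s - (a - i)) ≤ ‖x‖ ^ ((s : ℝ) - 2 - a) := by
      rw [inv_pow, ← Real.rpow_natCast, ← Real.rpow_natCast, ← Real.rpow_neg hx0.le,
        ← Real.rpow_add hx0]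
      refine Real.rpow_le_rpow_of_exponent_ge hx0 (hx.le.trans hr1) ?_
      have h1 : s ≤ (s - (a - i)) + (a - i) := by omega
      have h2 : (s : ℝ) ≤ ((s - (a - i) : ℕ) : ℝ) + ((a : ℝ) - i) := by
        rw [← Nat.cast_sub hia]
        exact_mod_cast h1
      push_cast
      linarith
    calc _ ≤ (a.choose i : ℝ) * (M i * (‖x‖⁻¹) ^ (i + 2)) *
          (C (a - i) b * ‖x‖ ^ (s - (a - i))) := by
          refine mul_le_mul (mul_le_mul_of_nonneg_left (hM i x hxne) (by positivity))
            (hCb _ _ x y hx.le) (norm_nonneg _) ?_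
          exact mul_nonneg (by positivity) (mul_nonneg (hM0 i) (by positivity))
      _ = (a.choose i : ℝ) * M i * C (a - i) b *
          ((‖x‖⁻¹) ^ (i + 2) * ‖x‖ ^ (s - (a - i))) := by ring
      _ ≤ _ := by
          refine mul_le_mul_of_nonneg_left hpow ?_
          exact mul_nonneg (mul_nonneg (by positivity) (hM0 i)) (hC _ _)

end ParamSmooth

theorem ParamSmooth.const (δ : ℝ) (c : ℂ) : ParamSmooth A δ fun _ => c :=
  ⟨fun _ _ => contDiffAt_const, fun _ _ _ _ _ _ _ => rfl⟩

theorem ParamSmooth.normSq (δ : ℝ) : ParamSmooth A δ fun p => ((‖p.1‖ ^ 2 : ℝ) : ℂ) :=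
  ⟨fun p _ => Complex.ofRealCLM.contDiff.contDiffAt.comp p
    ((contDiff_norm_sq ℝ).contDiffAt.comp p contDiffAt_fst), fun _ _ _ _ _ _ _ => rfl⟩

theorem vanishesToOrder_normSq (r : ℝ) :
    VanishesToOrder 2 r fun p => ((‖p.1‖ ^ 2 : ℝ) : ℂ) := fun b => by
  refine ⟨1, zero_le_one, fun x y _ => ?_⟩
  rw [one_mul, paramDeriv]
  rcases Nat.eq_zero_or_pos b with rfl | hb
  · rw [norm_iteratedFDeriv_zero, Complex.norm_real, Real.norm_of_nonneg (by positivity)]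
  · rw [iteratedFDeriv_const_of_ne hb.ne' ((‖x‖ ^ 2 : ℝ) : ℂ), Pi.zero_apply, norm_zero]
    positivity

theorem exists_regular_radius (A : Basis (Fin 3) ℝ E3) :
    ∃ l : ℝ, 0 < l ∧ ∀ q : E3, ‖q‖ < l → Regular A q := by
  obtain ⟨l, hl, h⟩ := exists_norm_lower_bound A
  refine ⟨l, hl, fun q hq G hG hG0 h0 => ?_⟩
  have h1 := h G hG hG0
  rw [eq_neg_of_add_eq_zero_left h0, norm_neg] at hq
  linarith

namespace Insulator

/-! ### Periodicity of the electron repulsion integrals -/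

variable (S : Insulator A nocc nvir)

/-- A term of the lattice sum of the electron repulsion integral, as a function of `p = q + G`. -/
def eriTerm (n₁ n₂ n₃ n₄ : Band nocc nvir) (k₁ k₂ k₃ p : E3) : ℂ :=
  ((1 / ‖p‖ ^ 2 : ℝ) : ℂ) *
    (∫ r in unitCell A, conj (bloch (S.u n₁) k₁ r) * wave (-p) r * bloch (S.u n₃) k₃ r) *
    ∫ r in unitCell A, conj (bloch (S.u n₂) k₂ r) * wave p r * bloch (S.u n₄) (k₂ + k₁ - k₃) r

/-- The excluded term is 0 through `1 / 0 = 0`, which leaves a sum over all `G` that can be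
reindexed. Bloch orbitals are used because they, and not their cell-periodic parts, are periodic in
the momentum. -/
theorem eri_eq_tsum_eriTerm (n₁ n₂ n₃ n₄ : Band nocc nvir) (k₁ k₂ k₃ : E3) :
    S.eri n₁ n₂ n₃ n₄ k₁ k₂ k₃ = prefactor A *
      ∑' G : recipLattice A, S.eriTerm n₁ n₂ n₃ n₄ k₁ k₂ k₃ (k₃ - k₁ + G) := by
  rw [eri, prefactor]
  congr 1
  refine tsum_congr fun G => ?_
  have e₁ : k₁ - (k₁ + (k₃ - k₁)) - (G : E3) = -(k₃ - k₁ + G) := by abel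
  have e₂ : k₂ - (k₂ - (k₃ - k₁)) - -(G : E3) = k₃ - k₁ + G := by abel
  have e₃ : k₁ + (k₃ - k₁) = k₃ := by abel
  have e₄ : k₂ - (k₃ - k₁) = k₂ + k₁ - k₃ := by abel
  rw [pairProduct, pairProduct, eriTerm, e₁, e₂, e₃, e₄]
  split_ifs with h
  · simp [h]
  · rfl

theorem eriTerm_shift (n₁ n₂ n₃ n₄ : Band nocc nvir) (k₁ k₂ k₃ p : E3) {g₁ g₂ g₃ : E3}
    (h₁ : g₁ ∈ recipLattice A) (h₂ : g₂ ∈ recipLattice A) (h₃ : g₃ ∈ recipLattice A) :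
    S.eriTerm n₁ n₂ n₃ n₄ (k₁ + g₁) (k₂ + g₂) (k₃ + g₃) p =
      S.eriTerm n₁ n₂ n₃ n₄ k₁ k₂ k₃ p := by
  have e : k₂ + g₂ + (k₁ + g₁) - (k₃ + g₃) = (k₂ + k₁ - k₃) + (g₂ + g₁ - g₃) := by abel
  simp only [eriTerm, e, S.orbital_periodic _ _ _ _ h₁, S.orbital_periodic _ _ _ _ h₂,
    S.orbital_periodic _ _ _ _ h₃, S.orbital_periodic _ _ _ _ (sub_mem (add_mem h₂ h₁) h₃)]

/-- Lattice shifts of the momenta change the terms only through `q + G`, and that change is a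
relabelling of `G`. -/
theorem eri_shift (n₁ n₂ n₃ n₄ : Band nocc nvir) (k₁ k₂ k₃ : E3) {g₁ g₂ g₃ : E3}
    (h₁ : g₁ ∈ recipLattice A) (h₂ : g₂ ∈ recipLattice A) (h₃ : g₃ ∈ recipLattice A) :
    S.eri n₁ n₂ n₃ n₄ (k₁ + g₁) (k₂ + g₂) (k₃ + g₃) = S.eri n₁ n₂ n₃ n₄ k₁ k₂ k₃ := by
  rw [eri_eq_tsum_eriTerm, eri_eq_tsum_eriTerm]
  congr 1
  rw [← (Equiv.addRight (⟨g₃ - g₁, sub_mem h₃ h₁⟩ : recipLattice A)).tsum_eq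
    fun G : recipLattice A => S.eriTerm n₁ n₂ n₃ n₄ k₁ k₂ k₃ (k₃ - k₁ + G)]
  refine tsum_congr fun G => ?_
  rw [S.eriTerm_shift _ _ _ _ _ _ _ _ h₁ h₂ h₃]
  congr 1
  simp only [Equiv.coe_addRight, Submodule.coe_add]
  abel

theorem pairProduct_shift (n' n : Band nocc nvir) (k' k G : E3) {g : E3}
    (hg : g ∈ recipLattice A) :
    S.pairProduct n' (k' + g) n (k + g) G = S.pairProduct n' k' n k G := by
  simp only [pairProduct, S.orbital_periodic _ _ _ _ hg, add_sub_add_right_eq_sub]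

/-- This is where orthonormality of the orbitals enters; it decides between orders 0 and -2. -/
theorem charge_self (n' n : Band nocc nvir) (k : E3) :
    S.charge n' n k k = if n' = n then 1 else 0 := by
  rw [← S.orthonormal n' n k, charge, pairProduct]
  simp

theorem contDiff_charge (n' n : Band nocc nvir) :
    ContDiff ℝ ∞ fun k : E3 × E3 => S.charge n' n k.1 k.2 := by
  classical
  have e : (fun k : E3 × E3 => S.charge n' n k.1 k.2) = fun k =>
      inner ℂ (lp.single 2 (0 : recipLattice A) (1 : ℂ) : L2 A) (S.pairCoeffs n' n k) := by
    funext k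
    rw [lp.inner_single_left, charge, ← Submodule.coe_zero (p := recipLattice A), pairProduct_eq]
    simp
  rw [e]
  exact contDiff_const.inner ℂ (S.contDiff_pairCoeffs n' n)

/-! ### Singularities of the electron repulsion integrals -/

/-- The charge of the first pair at transfer `q`. -/
def charge₁ (n n' : Band nocc nvir) (p : E3 × (E3 × E3)) : ℂ :=
  S.charge n n' p.2.1 (p.2.1 + p.1)

/-- The charge of the second pair at transfer `q`. -/
def charge₂ (n n' : Band nocc nvir) (p : E3 × (E3 × E3)) : ℂ :=
  S.charge n n' p.2.2 (p.2.2 - p.1)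

theorem paramSmooth_charge₁ (n n' : Band nocc nvir) (δ : ℝ) :
    ParamSmooth A δ (S.charge₁ n n') where
  contDiffAt _ _ := ((S.contDiff_charge n n').comp
    (contDiff_snd.fst.prodMk (contDiff_snd.fst.add contDiff_fst))).contDiffAt
  periodic q y g₁ g₂ _ h₁ _ := by
    simp only [charge₁, Prod.fst_add, add_right_comm _ g₁ q]
    exact S.pairProduct_shift _ _ _ _ _ h₁

theorem paramSmooth_charge₂ (n n' : Band nocc nvir) (δ : ℝ) :
    ParamSmooth A δ (S.charge₂ n n') where
  contDiffAt _ _ := ((S.contDiff_charge n n').comp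
    (contDiff_snd.snd.prodMk (contDiff_snd.snd.sub contDiff_fst))).contDiffAt
  periodic q y g₁ g₂ _ _ h₂ := by
    simp only [charge₂, Prod.snd_add, add_sub_right_comm _ g₂ q]
    exact S.pairProduct_shift _ _ _ _ _ h₂

theorem paramSmooth_regularPart (n₁ n₂ n₃ n₄ : Band nocc nvir) {δ : ℝ}
    (hδ : ∀ q : E3, ‖q‖ < δ → Regular A q) : ParamSmooth A δ (S.regularPart n₁ n₂ n₃ n₄) where
  contDiffAt p hp := S.contDiffAt_regularPart n₁ n₂ n₃ n₄ (hδ _ hp)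
  periodic q y g₁ g₂ _ h₁ h₂ := by
    simp only [regularPart, Prod.fst_add, Prod.snd_add, add_right_comm _ g₁ q,
      add_sub_right_comm _ g₂ q, S.pairProduct_shift _ _ _ _ _ h₁,
      S.pairProduct_shift _ _ _ _ _ h₂]

/-- `|q|² ⟨n₁k₁, n₂k₂ | n₃(k₁+q), n₄(k₂-q)⟩`, extended smoothly to `q = 0`. -/
def eriNumerator (n₁ n₂ n₃ n₄ : Band nocc nvir) (p : E3 × (E3 × E3)) : ℂ :=
  prefactor A * (S.charge₁ n₁ n₃ p * S.charge₂ n₂ n₄ p +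
    ((‖p.1‖ ^ 2 : ℝ) : ℂ) * S.regularPart n₁ n₂ n₃ n₄ p)

theorem paramSmooth_eriNumerator (n₁ n₂ n₃ n₄ : Band nocc nvir) {δ : ℝ}
    (hδ : ∀ q : E3, ‖q‖ < δ → Regular A q) : ParamSmooth A δ (S.eriNumerator n₁ n₂ n₃ n₄) :=
  (ParamSmooth.const δ _).mul (((S.paramSmooth_charge₁ n₁ n₃ δ).mul
    (S.paramSmooth_charge₂ n₂ n₄ δ)).add
      ((ParamSmooth.normSq δ).mul (S.paramSmooth_regularPart n₁ n₂ n₃ n₄ hδ)))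

theorem eri_eq_kernel_mul (n₁ n₂ n₃ n₄ : Band nocc nvir) {q : E3} (hq : Regular A q) (hq0 : q ≠ 0)
    (y : E3 × E3) :
    S.eri n₁ n₂ n₃ n₄ y.1 y.2 (y.1 + q) = kernel q * S.eriNumerator n₁ n₂ n₃ n₄ (q, y) := by
  have h : kernel q * ((‖q‖ ^ 2 : ℝ) : ℂ) = 1 := by
    have : ‖q‖ ≠ 0 := norm_ne_zero_iff.2 hq0
    rw [kernel, ← Complex.ofReal_mul, one_div, inv_mul_cancel₀ (pow_ne_zero 2 this),
      Complex.ofReal_one]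
  rw [S.eri_eq n₁ n₂ n₃ n₄ hq, eriNumerator, charge₁, charge₂]
  change prefactor A * (kernel q * _ + _) = _
  linear_combination (-prefactor A * S.regularPart n₁ n₂ n₃ n₄ (q, y)) * h

/-- Both charges vanish at `q = 0` by orthogonality, so their product has order 2; the regular part
carries an explicit factor `‖q‖ ^ 2`. -/
theorem vanishesToOrder_eriNumerator {n₁ n₂ n₃ n₄ : Band nocc nvir} (h₁ : n₁ ≠ n₃) (h₂ : n₂ ≠ n₄)
    {δ r : ℝ} (hδ : ∀ q : E3, ‖q‖ < δ → Regular A q) (hr : r < δ) :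
    VanishesToOrder 2 r (S.eriNumerator n₁ n₂ n₃ n₄) := by
  have s₁ := S.paramSmooth_charge₁ n₁ n₃ δ
  have s₂ := S.paramSmooth_charge₂ n₂ n₄ δ
  have s₃ := S.paramSmooth_regularPart n₁ n₂ n₃ n₄ hδ
  have v₁ := s₁.vanishesToOrder_one hr fun y => by
    simp only [charge₁, add_zero, charge_self, if_neg h₁]
  have v₂ := s₂.vanishesToOrder_one hr fun y => by
    simp only [charge₂, sub_zero, charge_self, if_neg h₂]
  have v₃ := (vanishesToOrder_normSq r).mul (ParamSmooth.normSq δ) s₃ hr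
    (s₃.vanishesToOrder_zero hr)
  have v := (v₁.mul s₁ s₂ hr v₂).add (s₁.mul s₂) ((ParamSmooth.normSq δ).mul s₃) hr v₃
  have c := ParamSmooth.const (A := A) δ (prefactor A)
  exact (c.vanishesToOrder_zero hr).mul c
    ((s₁.mul s₂).add ((ParamSmooth.normSq δ).mul s₃)) hr v

theorem eri_singular_two (n₁ n₂ n₃ n₄ : Band nocc nvir) :
    HasAlgebraicSingularity (-2) (fun (q : E3) (k : E3 × E3) =>
      S.eri n₁ n₂ n₃ n₄ k.1 k.2 (k.1 + q)) 0 := by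
  obtain ⟨l, hl, hreg⟩ := exists_regular_radius A
  have hr : min (l / 2) 1 < l := (min_le_left _ _).trans_lt (half_lt_self hl)
  have hs := S.paramSmooth_eriNumerator n₁ n₂ n₃ n₄ hreg
  have := hasAlgebraicSingularity_kernel_mul hs (by positivity) hr (min_le_right _ _) (s := 0)
    (fun a b => by simpa using hs.exists_mixed_bound hr a b)
    (fun q y hq0 hq => S.eri_eq_kernel_mul n₁ n₂ n₃ n₄ (hreg q (hq.trans hr)) hq0 y)
  simpa using this

theorem eri_singular_zero {n₁ n₂ n₃ n₄ : Band nocc nvir} (h₁ : n₁ ≠ n₃) (h₂ : n₂ ≠ n₄) :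
    HasAlgebraicSingularity 0 (fun (q : E3) (k : E3 × E3) =>
      S.eri n₁ n₂ n₃ n₄ k.1 k.2 (k.1 + q)) 0 := by
  obtain ⟨l, hl, hreg⟩ := exists_regular_radius A
  have hr : min (l / 2) 1 < l := (min_le_left _ _).trans_lt (half_lt_self hl)
  have hs := S.paramSmooth_eriNumerator n₁ n₂ n₃ n₄ hreg
  have hr0 : 0 < min (l / 2) 1 := by positivity
  have := hasAlgebraicSingularity_kernel_mul hs hr0 hr (min_le_right _ _) (s := 2)
    (hs.exists_mixed_bound_of_vanishes hr0 hr (S.vanishesToOrder_eriNumerator h₁ h₂ hreg hr))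
    (fun q y hq0 hq => S.eri_eq_kernel_mul n₁ n₂ n₃ n₄ (hreg q (hq.trans hr)) hq0 y)
  simpa using this

/-- Only the order of the singularity depends on the bands. The factorization into kernel and
numerator holds at every transfer off the lattice, and at zero transfer the ERI reduces to the
regular part. -/
theorem eri_singSpace {n₁ n₂ n₃ n₄ : Band nocc nvir} {s : ℕ}
    (h : HasAlgebraicSingularity (-(s : ℝ)) (fun (q : E3) (k : E3 × E3) =>
      S.eri n₁ n₂ n₃ n₄ k.1 k.2 (k.1 + q)) 0) : SingSpace A s (S.eri n₁ n₂ n₃ n₄) where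
  periodic_i k₁ k₂ k₃ G hG := by
    simpa using S.eri_shift n₁ n₂ n₃ n₄ k₁ k₂ k₃ hG (zero_mem _) (zero_mem _)
  periodic_j k₁ k₂ k₃ G hG := by
    simpa using S.eri_shift n₁ n₂ n₃ n₄ k₁ k₂ k₃ (zero_mem _) hG (zero_mem _)
  periodic_a k₁ k₂ k₃ G hG := by
    simpa using S.eri_shift n₁ n₂ n₃ n₄ k₁ k₂ k₃ (zero_mem _) (zero_mem _) hG
  smooth_off := by
    have : ContDiffOn ℝ ∞ (fun p : E3 × E3 × E3 => kernel (p.2.2 - p.1) *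
        S.eriNumerator n₁ n₂ n₃ n₄ (p.2.2 - p.1, (p.1, p.2.1)))
        {p | p.2.2 - p.1 ∉ recipLattice A} := fun p hp => by
      have hq0 : p.2.2 - p.1 ≠ 0 := fun h0 => hp (h0 ▸ zero_mem _)
      have h1 : ContDiffAt ℝ ∞ (fun p : E3 × E3 × E3 => p.2.2 - p.1) p :=
        contDiffAt_snd.snd.sub contDiffAt_fst
      have h2 : ContDiffAt ℝ ∞ (S.regularPart n₁ n₂ n₃ n₄) (p.2.2 - p.1, (p.1, p.2.1)) :=
        S.contDiffAt_regularPart n₁ n₂ n₃ n₄ (regular_of_notMem hp)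
      have h3 : ContDiffAt ℝ ∞ (S.eriNumerator n₁ n₂ n₃ n₄) (p.2.2 - p.1, (p.1, p.2.1)) := by
        refine contDiffAt_const.mul (ContDiffAt.add (ContDiffAt.mul ?_ ?_)
          (ContDiffAt.mul ?_ h2))
        · exact (S.paramSmooth_charge₁ n₁ n₃ (‖p.2.2 - p.1‖ + 1)).contDiffAt _ (by simp)
        · exact (S.paramSmooth_charge₂ n₂ n₄ (‖p.2.2 - p.1‖ + 1)).contDiffAt _ (by simp)
        · exact (ParamSmooth.normSq (A := A) (‖p.2.2 - p.1‖ + 1)).contDiffAt _ (by simp)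
      exact (((contDiffAt_kernel hq0).comp p h1).mul (h3.comp p (h1.prodMk
        (contDiffAt_fst.prodMk contDiffAt_snd.fst)))).contDiffWithinAt
    refine this.congr fun p hp => ?_
    have hq0 : p.2.2 - p.1 ≠ 0 := fun h0 => hp (h0 ▸ zero_mem _)
    have e := S.eri_eq_kernel_mul n₁ n₂ n₃ n₄ (regular_of_notMem hp) hq0 (p.1, p.2.1)
    simpa using e
  singular := h
  smooth_on := by
    obtain ⟨l, hl, hreg⟩ := exists_regular_radius A
    have h0 : Regular A 0 := hreg 0 (by simpa using hl)
    have e : (fun k : E3 × E3 => S.eri n₁ n₂ n₃ n₄ k.1 k.2 k.1) = fun k =>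
        prefactor A * S.regularPart n₁ n₂ n₃ n₄ (0, k) := by
      funext k
      have := S.eri_eq n₁ n₂ n₃ n₄ h0 k.1 k.2
      simpa using this
    rw [e]
    exact contDiff_const.mul ((S.paramSmooth_regularPart n₁ n₂ n₃ n₄ hreg).contDiff_param
      (by simpa using hl))

theorem eri_singSpace_two (n₁ n₂ n₃ n₄ : Band nocc nvir) :
    SingSpace A 2 (S.eri n₁ n₂ n₃ n₄) :=
  S.eri_singSpace (by simpa using S.eri_singular_two n₁ n₂ n₃ n₄)

theorem eri_singSpace_zero {n₁ n₂ n₃ n₄ : Band nocc nvir} (h₁ : n₁ ≠ n₃) (h₂ : n₂ ≠ n₄) :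
    SingSpace A 0 (S.eri n₁ n₂ n₃ n₄) :=
  S.eri_singSpace (by simpa using S.eri_singular_zero h₁ h₂)

/-- Along a ray, `‖q‖ ^ 2` times the ERI tends to the nonzero prefactor because both charges tend to
1, whereas order `γ` would bound it by a multiple of `‖q‖ ^ (γ + 2)`, which tends to 0. -/
theorem eri_not_singular (n₁ n₂ : Band nocc nvir) {γ : ℝ} (hγ : -2 < γ) :
    ¬ HasAlgebraicSingularity γ (fun (q : E3) (k : E3 × E3) =>
      S.eri n₁ n₂ n₁ n₂ k.1 k.2 (k.1 + q)) 0 := by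
  rintro ⟨δ, hδ, -, hb⟩
  obtain ⟨C, hC⟩ := hb 0 0
  simp only [sub_zero, norm_iteratedFDeriv_zero, Nat.cast_zero] at hC
  obtain ⟨l, hl, hreg⟩ := exists_regular_radius A
  have hs := S.paramSmooth_eriNumerator n₁ n₂ n₁ n₂ hreg
  set e : E3 := EuclideanSpace.single 0 1
  have he : ‖e‖ = 1 := by simp [e]
  have hcont : Filter.Tendsto (fun x : ℝ => ‖S.eriNumerator n₁ n₂ n₁ n₂ (x • e, 0)‖)
      (nhdsWithin 0 (Set.Ioi 0)) (nhds ‖prefactor A‖) := by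
    have h1 : ContinuousAt (S.eriNumerator n₁ n₂ n₁ n₂) ((0 : ℝ) • e, 0) :=
      (hs.contDiffAt _ (by simpa using hl)).continuousAt
    have h2 : ContinuousAt (fun x : ℝ => S.eriNumerator n₁ n₂ n₁ n₂ (x • e, 0)) 0 :=
      h1.comp (f := fun x : ℝ => (x • e, (0 : E3 × E3))) (x := 0) (by fun_prop)
    have h3 : S.eriNumerator n₁ n₂ n₁ n₂ ((0 : ℝ) • e, 0) = prefactor A := by
      simp [eriNumerator, charge₁, charge₂, charge_self]
    have := h2.norm.tendsto.mono_left (nhdsWithin_le_nhds (s := Set.Ioi (0 : ℝ)))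
    simpa only [h3] using this
  have hzero : Filter.Tendsto (fun x : ℝ => C * x ^ (γ + 2))
      (nhdsWithin 0 (Set.Ioi 0)) (nhds 0) := by
    have : ContinuousAt (fun x : ℝ => C * x ^ (γ + 2)) 0 :=
      continuousAt_const.mul (Real.continuousAt_rpow_const 0 _ (Or.inr (by linarith)))
    have h := this.tendsto.mono_left (nhdsWithin_le_nhds (s := Set.Ioi (0 : ℝ)))
    simpa [Real.zero_rpow (by linarith : γ + 2 ≠ 0)] using h
  have hle : ‖prefactor A‖ ≤ 0 := by
    refine le_of_tendsto_of_tendsto hcont hzero ?_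
    filter_upwards [Ioo_mem_nhdsGT (lt_min hδ hl)] with x hx
    have hx0 : 0 < x := hx.1
    have hn : ‖x • e‖ = x := by rw [norm_smul, he, mul_one, Real.norm_of_nonneg hx0.le]
    have h1 := hC (x • e) 0 (by rwa [hn]) (by rw [hn]; exact hx.2.trans_le (min_le_left _ _))
    rw [S.eri_eq_kernel_mul n₁ n₂ n₁ n₂
      (hreg _ (by rw [hn]; exact hx.2.trans_le (min_le_right _ _)))
      (norm_pos_iff.1 (by rwa [hn])), norm_mul, kernel, Complex.norm_real, hn,
      Real.norm_of_nonneg (by positivity)] at h1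
    rw [Real.rpow_add hx0, Real.rpow_two]
    field_simp at h1
    linarith
  exact prefactor_ne_zero (norm_le_zero_iff.1 hle)

end Insulator

/-! ### Splitting of the iteration map and the error of each of its terms -/

/-! ### Linear averages -/

/-- `avg` is linear on the functions in the class `I`. -/
structure IsAverage (avg : (E3 → ℂ) → ℂ) (I : (E3 → ℂ) → Prop) : Prop where
  zero : I (fun _ => 0) ∧ avg (fun _ => 0) = 0
  add : ∀ F G, I F → I G → I (fun x => F x + G x) ∧ avg (fun x => F x + G x) = avg F + avg G
  const_mul : ∀ c F, I F → I (fun x => c * F x) ∧ avg (fun x => c * F x) = c * avg F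

theorem isAverage_meshMean (A : Basis (Fin 3) ℝ E3) (m : ℕ) [NeZero m] (k₀ : E3) :
    IsAverage (meshMean A m k₀) fun _ => True :=
  ⟨⟨trivial, meshMean_const m k₀ 0⟩, fun F G _ _ => ⟨trivial, meshMean_add m k₀ F G⟩,
    fun c F _ => ⟨trivial, meshMean_const_mul m k₀ c F⟩⟩

theorem isAverage_zoneAvg (A : Basis (Fin 3) ℝ E3) :
    IsAverage (zoneAvg A) fun F => IntegrableOn F (brillouinZone A) :=
  ⟨⟨integrableOn_zero, zoneAvg_const 0⟩, fun _ _ hF hG => ⟨hF.add hG, zoneAvg_add hF hG⟩,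
    fun c F hF => ⟨hF.const_mul c, zoneAvg_const_mul c F⟩⟩

/-- `F` is in the class `I` and its average is `z`. -/
def HasAverage (avg : (E3 → ℂ) → ℂ) (I : (E3 → ℂ) → Prop) (F : E3 → ℂ) (z : ℂ) : Prop :=
  I F ∧ avg F = z

section HasAverage

variable {avg : (E3 → ℂ) → ℂ} {I : (E3 → ℂ) → Prop} {F G : E3 → ℂ} {z w : ℂ}

theorem HasAverage.add (H : IsAverage avg I) (hF : HasAverage avg I F z)
    (hG : HasAverage avg I G w) : HasAverage avg I (fun x => F x + G x) (z + w) := by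
  have := H.add F G hF.1 hG.1
  rw [hF.2, hG.2] at this
  exact this

theorem HasAverage.const_mul (H : IsAverage avg I) (c : ℂ) (hF : HasAverage avg I F z) :
    HasAverage avg I (fun x => c * F x) (c * z) := by
  have := H.const_mul c F hF.1
  rw [hF.2] at this
  exact this

theorem HasAverage.mul_const (H : IsAverage avg I) (hF : HasAverage avg I F z) (c : ℂ) :
    HasAverage avg I (fun x => F x * c) (z * c) := by
  simpa only [mul_comm c] using hF.const_mul H c

theorem HasAverage.sub (H : IsAverage avg I) (hF : HasAverage avg I F z)
    (hG : HasAverage avg I G w) : HasAverage avg I (fun x => F x - G x) (z - w) := by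
  simpa only [neg_one_mul, ← sub_eq_add_neg] using hF.add H (hG.const_mul H (-1))

theorem HasAverage.sum (H : IsAverage avg I) {κ : Type} [Fintype κ] {F : κ → E3 → ℂ} {z : κ → ℂ}
    (hF : ∀ k, HasAverage avg I (F k) (z k)) :
    HasAverage avg I (fun x => ∑ k, F k x) (∑ k, z k) := by
  classical
  suffices h : ∀ s : Finset κ, HasAverage avg I (fun x => ∑ k ∈ s, F k x) (∑ k ∈ s, z k) from
    h Finset.univ
  intro s
  induction s using Finset.induction with
  | empty =>
    simp only [Finset.sum_empty]
    exact H.zero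
  | insert k s hk ih =>
    simp only [Finset.sum_insert hk]
    exact (hF k).add H ih

end HasAverage

/-! ### Decomposition of the iteration map -/

section Decomposition

open Sum (inl inr)

variable (v : (n₁ n₂ n₃ n₄ : Band nocc nvir) → (k₁ k₂ k₃ : E3) → ℂ) (t : Amp nocc nvir E3)

/-- The averaged function in `chiOV`. -/
def ovKernel (i : Fin nocc) (c a : Fin nvir) (k : Fin nocc) (xi xa xk xl : E3) : ℂ :=
  ∑ l, ∑ d,
    ((2 * v (inl l) (inl k) (inr d) (inr c) xl xk (xi + xl - xa)
        - v (inl l) (inl k) (inr c) (inr d) xl xk (xa + xk - xi)) * t i l a d xi xl xa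
      - v (inl l) (inl k) (inr d) (inr c) xl xk (xi + xl - xa) * t i l d a xi xl (xi + xl - xa))

/-- The averaged function in `chiVO`. -/
def voKernel (c : Fin nvir) (i : Fin nocc) (a : Fin nvir) (k : Fin nocc) (xi xa xk xl : E3) : ℂ :=
  ∑ l, ∑ d, v (inl l) (inl k) (inr c) (inr d) xl xk (xa + xk - xi) *
    t i l d a xi xl (xi + xl - xa)

/-- The linear non-ladder part of `ringTerm`. -/
def ringLinear (i j : Fin nocc) (a b : Fin nvir) (xi xj xa xk : E3) : ℂ :=
  ∑ k, ∑ c, (2 * v (inr a) (inl k) (inl i) (inr c) xa xk xi * t k j c b xk xj (xa + xk - xi)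
    - v (inr a) (inl k) (inl i) (inr c) xa xk xi * t k j b c xk xj (xi + xj - xa))

/-- The ladder part of `ringTerm`, with the opposite sign. -/
def ringLadder (i j : Fin nocc) (a b : Fin nvir) (xi xj xa xk : E3) : ℂ :=
  ∑ k, ∑ c, (v (inr a) (inl k) (inr c) (inl i) xa xk (xa + xk - xi) *
      t k j c b xk xj (xa + xk - xi)
    + v (inr a) (inl k) (inr c) (inl j) xa xk (xa + xk - xj) * t k i b c xk xi (xi + xj - xa))

/-- The quadratic part of `ringTerm`. -/
def ringQuad (i j : Fin nocc) (a b : Fin nvir) (xi xj xa xk xl : E3) : ℂ :=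
  ∑ k, ∑ c, ((ovKernel v t i c a k xi xa xk xl + (1 / 2) * voKernel v t c i a k xi xa xk xl) *
      t k j c b xk xj (xa + xk - xi)
    - (1 / 2) * ovKernel v t i c a k xi xa xk xl * t k j b c xk xj (xi + xj - xa)
    + (1 / 2) * voKernel v t c j a k xj xa xk xl * t k i b c xk xi (xi + xj - xa))

/-- The linear part of the term with `chiOO`. -/
def ooLadder (i j : Fin nocc) (a b : Fin nvir) (xi xj xa xk : E3) : ℂ :=
  ∑ k, ∑ l, v (inl k) (inl l) (inl i) (inl j) xk (xi + xj - xk) xi *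
    t k l a b xk (xi + xj - xk) xa

/-- The averaged function in `chiOO`. -/
def ooKernel (i j k l : Fin nocc) (xi xj xk xc : E3) : ℂ :=
  ∑ c, ∑ d, v (inl k) (inl l) (inr c) (inr d) xk (xi + xj - xk) xc * t i j c d xi xj xc

/-- The quadratic part of the term with `chiOO`. -/
def ooQuad (i j : Fin nocc) (a b : Fin nvir) (xi xj xa xk xc : E3) : ℂ :=
  ∑ k, ∑ l, ooKernel v t i j k l xi xj xk xc * t k l a b xk (xi + xj - xk) xa

/-- The ladder term of the virtual bands. -/
def vvLadder (i j : Fin nocc) (a b : Fin nvir) (xi xj xa xc : E3) : ℂ :=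
  ∑ c, ∑ d, v (inr a) (inr b) (inr c) (inr d) xa (xi + xj - xa) xc * t i j c d xi xj xc

variable {v t} {avg : (E3 → ℂ) → ℂ} {I : (E3 → ℂ) → Prop}

/-- Isolates the bare integrals of `chiVO`, which pair virtual with virtual and occupied with
occupied bands. All ERIs in the other two parts pair an occupied with a virtual band. -/
theorem ringTerm_eq (H : IsAverage avg I) {i j : Fin nocc} {a b : Fin nvir} {xi xj xa : E3}
    (hov : ∀ i c a k xi xa xk, I (ovKernel v t i c a k xi xa xk))
    (hvo : ∀ c i a k xi xa xk, I (voKernel v t c i a k xi xa xk))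
    (h₁ : I (ringLinear v t i j a b xi xj xa)) (h₂ : I (ringLadder v t i j a b xi xj xa))
    (h₃ : I fun xk => avg (ringQuad v t i j a b xi xj xa xk)) :
    ringTerm avg v t i j a b xi xj xa = avg (ringLinear v t i j a b xi xj xa)
      + (avg fun xk => avg (ringQuad v t i j a b xi xj xa xk))
      - avg (ringLadder v t i j a b xi xj xa) := by
  have e := ((HasAverage.add H ⟨h₁, rfl⟩ ⟨h₃, rfl⟩).sub H ⟨h₂, rfl⟩).2
  rw [← e, ringTerm]
  congr 1
  funext xk
  have ov : ∀ i c a k xi xa xk, HasAverage avg I (fun xl => ovKernel v t i c a k xi xa xk xl)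
      (avg (ovKernel v t i c a k xi xa xk)) := fun i c a k xi xa xk => ⟨hov i c a k xi xa xk, rfl⟩
  have vo : ∀ c i a k xi xa xk, HasAverage avg I (fun xl => voKernel v t c i a k xi xa xk xl)
      (avg (voKernel v t c i a k xi xa xk)) := fun i c a k xi xa xk => ⟨hvo i c a k xi xa xk, rfl⟩
  -- The inner average is moved out of the products with amplitudes, which do not depend on `xl`, so
  -- that the quadratic part becomes a genuine double average.
  have q : avg (ringQuad v t i j a b xi xj xa xk) = ∑ k, ∑ c,
      ((avg (ovKernel v t i c a k xi xa xk) + (1 / 2) * avg (voKernel v t c i a k xi xa xk)) *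
        t k j c b xk xj (xa + xk - xi)
      - (1 / 2) * avg (ovKernel v t i c a k xi xa xk) * t k j b c xk xj (xi + xj - xa)
      + (1 / 2) * avg (voKernel v t c j a k xj xa xk) * t k i b c xk xi (xi + xj - xa)) :=
    (HasAverage.sum H fun k => HasAverage.sum H fun c =>
      (((((ov i c a k xi xa xk).add H ((vo c i a k xi xa xk).const_mul H (1 / 2))).mul_const H
        (t k j c b xk xj (xa + xk - xi)))).sub H
        (((ov i c a k xi xa xk).const_mul H (1 / 2)).mul_const H
          (t k j b c xk xj (xi + xj - xa)))).add H
        (((vo c j a k xj xa xk).const_mul H (1 / 2)).mul_const H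
          (t k i b c xk xi (xi + xj - xa)))).2
  rw [q, ringLinear, ringLadder]
  simp only [← Finset.sum_sub_distrib, ← Finset.sum_add_distrib]
  refine Finset.sum_congr rfl fun k _ => Finset.sum_congr rfl fun c _ => ?_
  change ((2 * (v (inr a) (inl k) (inl i) (inr c) xa xk xi +
      (1 / 2) * avg (ovKernel v t i c a k xi xa xk)) -
      (v (inr a) (inl k) (inr c) (inl i) xa xk (xa + xk - xi) -
        (1 / 2) * avg (voKernel v t c i a k xi xa xk))) * t k j c b xk xj (xa + xk - xi)
    - (v (inr a) (inl k) (inl i) (inr c) xa xk xi +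
      (1 / 2) * avg (ovKernel v t i c a k xi xa xk)) * t k j b c xk xj (xi + xj - xa)
    - (v (inr a) (inl k) (inr c) (inl j) xa xk (xa + xk - xj) -
        (1 / 2) * avg (voKernel v t c j a k xj xa xk)) * t k i b c xk xi (xi + xj - xa)) = _
  ring

theorem chiOO_average_eq (H : IsAverage avg I) {i j : Fin nocc} {a b : Fin nvir} {xi xj xa : E3}
    (hoo : ∀ k l xk, I (ooKernel v t i j k l xi xj xk))
    (h₁ : I (ooLadder v t i j a b xi xj xa))
    (h₂ : I fun xk => avg (ooQuad v t i j a b xi xj xa xk)) :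
    (avg fun xk => ∑ k, ∑ l, chiOO avg v t i j k l xi xj xk * t k l a b xk (xi + xj - xk) xa) =
      avg (ooLadder v t i j a b xi xj xa) +
        avg fun xk => avg (ooQuad v t i j a b xi xj xa xk) := by
  rw [← (HasAverage.add H ⟨h₁, rfl⟩ ⟨h₂, rfl⟩).2]
  congr 1
  funext xk
  have q : avg (ooQuad v t i j a b xi xj xa xk) = ∑ k, ∑ l,
      avg (ooKernel v t i j k l xi xj xk) * t k l a b xk (xi + xj - xk) xa :=
    (HasAverage.sum H fun k => HasAverage.sum H fun l =>
      HasAverage.mul_const H ⟨hoo k l xk, rfl⟩ (t k l a b xk (xi + xj - xk) xa)).2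
  rw [q, ooLadder]
  simp only [← Finset.sum_add_distrib, ← add_mul]
  rfl

/-- The terms of the iteration map other than the ladder terms. -/
def restSum (avg : (E3 → ℂ) → ℂ)
    (v : (n₁ n₂ n₃ n₄ : Band nocc nvir) → (k₁ k₂ k₃ : E3) → ℂ) (t : Amp nocc nvir E3) :
    Amp nocc nvir E3 := fun i j a b xi xj xa =>
  v (inr a) (inr b) (inl i) (inl j) xa (xi + xj - xa) xi
    + perm (kappaTerm avg v t) i j a b xi xj xa
    + (avg fun xk => avg (ooQuad v t i j a b xi xj xa xk))
    + perm (fun i j a b xi xj xa => avg (ringLinear v t i j a b xi xj xa)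
      + avg fun xk => avg (ringQuad v t i j a b xi xj xa xk)) i j a b xi xj xa

/-- A purely algebraic identity for mesh and zone alike. The conditions `I` are there because the
integral is additive only on integrable functions. -/
theorem ccdMap_sub_ladderMap (H : IsAverage avg I) (ε : Band nocc nvir → E3 → ℝ)
    (hov : ∀ i c a k xi xa xk, I (ovKernel v t i c a k xi xa xk))
    (hvo : ∀ c i a k xi xa xk, I (voKernel v t c i a k xi xa xk))
    (hoo : ∀ i j k l xi xj xk, I (ooKernel v t i j k l xi xj xk))
    (h₁ : ∀ i j a b xi xj xa, I (ringLinear v t i j a b xi xj xa))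
    (h₂ : ∀ i j a b xi xj xa, I (ringLadder v t i j a b xi xj xa))
    (h₃ : ∀ i j a b xi xj xa, I fun xk => avg (ringQuad v t i j a b xi xj xa xk))
    (h₄ : ∀ i j a b xi xj xa, I (ooLadder v t i j a b xi xj xa))
    (h₅ : ∀ i j a b xi xj xa, I fun xk => avg (ooQuad v t i j a b xi xj xa xk))
    (i j : Fin nocc) (a b : Fin nvir) (xi xj xa : E3) :
    ccdMap avg ε v t i j a b xi xj xa - ladderMap avg ε v t i j a b xi xj xa =
      ((energyDenom ε i j a b xi xj xa : ℝ) : ℂ)⁻¹ * restSum avg v t i j a b xi xj xa := by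
  have hr : ∀ i j a b xi xj xa, ringTerm avg v t i j a b xi xj xa = _ :=
    fun i j a b xi xj xa => ringTerm_eq H hov hvo (h₁ i j a b xi xj xa) (h₂ i j a b xi xj xa)
      (h₃ i j a b xi xj xa)
  have hl : ladderMap avg ε v t i j a b xi xj xa = ((energyDenom ε i j a b xi xj xa : ℝ) : ℂ)⁻¹ *
      (avg (ooLadder v t i j a b xi xj xa) + avg (vvLadder v t i j a b xi xj xa)
        - (avg (ringLadder v t i j a b xi xj xa) +
          avg (ringLadder v t j i b a xj xi (xi + xj - xa)))) := rfl
  have hv : (avg fun xc => ∑ c, ∑ d, v (inr a) (inr b) (inr c) (inr d) xa (xi + xj - xa) xc *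
      t i j c d xi xj xc) = avg (vvLadder v t i j a b xi xj xa) := rfl
  rw [ccdMap, hl, chiOO_average_eq H (fun k l xk => hoo i j k l xi xj xk)
    (h₄ i j a b xi xj xa) (h₅ i j a b xi xj xa), hv, restSum]
  simp only [perm, hr]
  ring

end Decomposition

/-! ### Approximation of averages to the order of the volume of a mesh cell -/

/-- The quantity `X` computed with mesh averages approximates the one computed with zone averages
to order `m⁻³`. -/
def CubeApprox {ι : Type} (A : Basis (Fin 3) ℝ E3) (X : ((E3 → ℂ) → ℂ) → ι → ℂ) : Prop :=
  ∃ C : ℝ, 0 ≤ C ∧ ∀ (m : ℕ) [NeZero m] (k₀ : E3) (p : ι),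
    ‖X (meshMean A m k₀) p - X (zoneAvg A) p‖ ≤ C * ((m : ℝ) ^ 3)⁻¹

section CubeApprox

variable {ι κ : Type} {X Y : ((E3 → ℂ) → ℂ) → ι → ℂ}

theorem CubeApprox.const (w : ι → ℂ) : CubeApprox A fun _ => w :=
  ⟨0, le_rfl, fun m _ k₀ p => by simp⟩

theorem CubeApprox.add (hX : CubeApprox A X) (hY : CubeApprox A Y) :
    CubeApprox A fun avg p => X avg p + Y avg p := by
  obtain ⟨C, hC, h⟩ := hX
  obtain ⟨C', hC', h'⟩ := hY
  refine ⟨C + C', by positivity, fun m _ k₀ p => ?_⟩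
  rw [add_sub_add_comm, add_mul]
  exact (norm_add_le _ _).trans (add_le_add (h m k₀ p) (h' m k₀ p))

theorem CubeApprox.neg (hX : CubeApprox A X) : CubeApprox A fun avg p => -X avg p := by
  obtain ⟨C, hC, h⟩ := hX
  refine ⟨C, hC, fun m _ k₀ p => ?_⟩
  rw [← neg_sub', norm_neg]
  exact h m k₀ p

theorem CubeApprox.sub (hX : CubeApprox A X) (hY : CubeApprox A Y) :
    CubeApprox A fun avg p => X avg p - Y avg p := by
  simpa only [sub_eq_add_neg] using hX.add hY.neg

theorem CubeApprox.mul_bounded (hX : CubeApprox A X) {w : ι → ℂ} (hw : ∃ B : ℝ, ∀ p, ‖w p‖ ≤ B) :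
    CubeApprox A fun avg p => X avg p * w p := by
  obtain ⟨C, hC, h⟩ := hX
  obtain ⟨B, hB⟩ := hw
  refine ⟨C * |B|, by positivity, fun m _ k₀ p => ?_⟩
  rw [← sub_mul, norm_mul]
  calc _ ≤ C * ((m : ℝ) ^ 3)⁻¹ * |B| :=
        mul_le_mul (h m k₀ p) ((hB p).trans (le_abs_self B)) (norm_nonneg _) (by positivity)
    _ = _ := by ring

theorem CubeApprox.comp (hX : CubeApprox A X) (φ : κ → ι) :
    CubeApprox A fun avg p => X avg (φ p) := by
  obtain ⟨C, hC, h⟩ := hX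
  exact ⟨C, hC, fun m _ k₀ p => h m k₀ _⟩

theorem CubeApprox.sum [Fintype κ] {X : κ → ((E3 → ℂ) → ℂ) → ι → ℂ}
    (hX : ∀ k, CubeApprox A (X k)) : CubeApprox A fun avg p => ∑ k, X k avg p := by
  choose C hC h using hX
  refine ⟨∑ k, C k, Finset.sum_nonneg fun k _ => hC k, fun m _ k₀ p => ?_⟩
  rw [← Finset.sum_sub_distrib, Finset.sum_mul]
  exact (norm_sum_le _ _).trans (Finset.sum_le_sum fun k _ => h k m k₀ p)

theorem Reg₂.cubeApprox {D : ι → E3 → E3 → ℂ} (h : Reg₂ A D) :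
    CubeApprox A fun avg p => avg fun x => avg fun y => D p x y :=
  h.exists_quadrature_bound

theorem Reg₂.cubeApprox_left {D : ι → E3 → ℂ} (h : Reg₂ A fun p x _ => D p x) :
    CubeApprox A fun avg p => avg (D p) :=
  (h.fst.comp fun p : ι => (p, (0 : E3))).exists_quadrature_bound fun p => h.measurable_left p 0

end CubeApprox

/-! ### Sections of two momenta -/

/-- A family of affine functions of two momenta with linear parts `x ↦ a x`, `y ↦ b y`. -/
def Aff₂ {ι : Type} (a b : ℤ) (k : ι → E3 → E3 → E3) : Prop :=
  ∀ p x y, k p x y = k p 0 0 + (a : ℝ) • x + (b : ℝ) • y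

section Aff₂

variable {ι : Type} {a b : ℤ} {k : ι → E3 → E3 → E3}

theorem Aff₂.left (h : Aff₂ a b k) : Aff a fun (p : ι × E3) x => k p.1 x p.2 := fun p x => by
  simp only
  rw [h p.1 x p.2, h p.1 0 p.2]
  module

theorem Aff₂.right (h : Aff₂ a b k) : Aff b fun (p : ι × E3) y => k p.1 p.2 y := fun p y => by
  simp only
  rw [h p.1 p.2 y, h p.1 p.2 0]
  module

theorem Aff₂.measurable (h : Aff₂ a b k) (p : ι) : Measurable fun z : E3 × E3 => k p z.1 z.2 := by
  have : (fun z : E3 × E3 => k p z.1 z.2) =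
      fun z => k p 0 0 + (a : ℝ) • z.1 + (b : ℝ) • z.2 := funext fun z => h p z.1 z.2
  rw [this]
  fun_prop

/-- The six integers are the slopes in `x` and in `y` of the first, second and third momentum. The
remaining hypotheses are checked automatically, so each factor of a term is settled by listing its
slopes. -/
theorem SingSpace.reg₂ {f : E3 → E3 → E3 → ℂ} (h : SingSpace A 0 f) {k₁ k₂ k₃ : ι → E3 → E3 → E3}
    (a₁ b₁ a₂ b₂ a₃ b₃ : ℤ)
    (h₁ : Aff₂ a₁ b₁ k₁ := by intro p x y; push_cast; module)
    (h₂ : Aff₂ a₂ b₂ k₂ := by intro p x y; push_cast; module)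
    (h₃ : Aff₂ a₃ b₃ k₃ := by intro p x y; push_cast; module)
    (ha : |a₁| ≤ 1 ∧ |a₂| ≤ 1 ∧ |a₃ - a₁| ≤ 1 := by norm_num)
    (hb : |b₁| ≤ 1 ∧ |b₂| ≤ 1 ∧ |b₃ - b₁| ≤ 1 := by norm_num) :
    Reg₂ A fun p x y => f (k₁ p x y) (k₂ p x y) (k₃ p x y) :=
  ⟨fun p => h.measurable (h₁.measurable p) (h₂.measurable p) (h₃.measurable p),
    h.uReg h₁.left h₂.left h₃.left ha.1 ha.2.1 ha.2.2,
    h.uReg h₁.right h₂.right h₃.right hb.1 hb.2.1 hb.2.2⟩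

end Aff₂

/-! ### The terms without ladder singularities -/

/-- Three external momenta. -/
abbrev Ext : Type := E3 × E3 × E3

/-- The external momenta of the permuted term. -/
def swapExt (p : Ext) : Ext := (p.2.1, p.1, p.1 + p.2.1 - p.2.2)

theorem SingSpace.bounded {f : E3 → E3 → E3 → ℂ} (h : SingSpace A 0 f) {ι : Type}
    (k₁ k₂ k₃ : ι → E3) : ∃ B : ℝ, ∀ p, ‖f (k₁ p) (k₂ p) (k₃ p)‖ ≤ B := by
  have hr : Reg₂ A fun (p : ι) (_ _ : E3) => f (k₁ p) (k₂ p) (k₃ p) := h.reg₂ 0 0 0 0 0 0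
  obtain ⟨B, hB⟩ := hr.exists_bound
  exact ⟨B, fun p => hB p 0 0⟩

section Terms

open Sum (inl inr)

variable (S : Insulator A nocc nvir) {t : Amp nocc nvir E3}

namespace Insulator

theorem ov_singSpace (n₁ n₂ : Fin nocc) (n₃ n₄ : Fin nvir) :
    SingSpace A 0 (S.eri (inl n₁) (inl n₂) (inr n₃) (inr n₄)) :=
  S.eri_singSpace_zero (by simp) (by simp)

theorem vo_singSpace (n₁ : Fin nvir) (n₂ n₃ : Fin nocc) (n₄ : Fin nvir) :
    SingSpace A 0 (S.eri (inr n₁) (inl n₂) (inl n₃) (inr n₄)) :=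
  S.eri_singSpace_zero (by simp) (by simp)

theorem reg₂_ovKernel (ht : ∀ i j a b, SingSpace A 0 (t i j a b)) (i : Fin nocc) (c a : Fin nvir) (k : Fin nocc) {ι : Type} (xi xa : ι → E3) :
    Reg₂ A fun (p : ι) xk xl => ovKernel S.eri t i c a k (xi p) (xa p) xk xl := by
  refine Reg₂.sum fun l => Reg₂.sum fun d => Reg₂.sub (Reg₂.mul (Reg₂.sub (Reg₂.const_mul 2 ?_) ?_)
    ?_) (Reg₂.mul ?_ ?_)
  · exact (S.ov_singSpace l k d c).reg₂ 0 1 1 0 0 1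
  · exact (S.ov_singSpace l k c d).reg₂ 0 1 1 0 1 0
  · exact (ht i l a d).reg₂ 0 0 0 1 0 0
  · exact (S.ov_singSpace l k d c).reg₂ 0 1 1 0 0 1
  · exact (ht i l d a).reg₂ 0 0 0 1 0 1

theorem reg₂_voKernel (ht : ∀ i j a b, SingSpace A 0 (t i j a b)) (c : Fin nvir) (i : Fin nocc) (a : Fin nvir) (k : Fin nocc) {ι : Type}
    (xi xa : ι → E3) :
    Reg₂ A fun (p : ι) xk xl => voKernel S.eri t c i a k (xi p) (xa p) xk xl := by
  refine Reg₂.sum fun l => Reg₂.sum fun d => Reg₂.mul ?_ ?_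
  · exact (S.ov_singSpace l k c d).reg₂ 0 1 1 0 1 0
  · exact (ht i l d a).reg₂ 0 0 0 1 0 1

theorem reg₂_ooKernel (ht : ∀ i j a b, SingSpace A 0 (t i j a b)) (i j k l : Fin nocc) :
    Reg₂ A fun (p : E3 × E3) xk xc => ooKernel S.eri t i j k l p.1 p.2 xk xc := by
  refine Reg₂.sum fun c => Reg₂.sum fun d => Reg₂.mul ?_ ?_
  · exact (S.ov_singSpace k l c d).reg₂ 1 0 (-1) 0 0 1
  · exact (ht i j c d).reg₂ 0 0 0 0 0 1

theorem reg₂_ooQuad (ht : ∀ i j a b, SingSpace A 0 (t i j a b)) (i j : Fin nocc) (a b : Fin nvir) :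
    Reg₂ A fun (p : Ext) xk xc => ooQuad S.eri t i j a b p.1 p.2.1 p.2.2 xk xc := by
  refine Reg₂.sum fun k => Reg₂.sum fun l => Reg₂.mul (Reg₂.sum fun c => Reg₂.sum fun d =>
    Reg₂.mul ?_ ?_) ?_
  · exact (S.ov_singSpace k l c d).reg₂ 1 0 (-1) 0 0 1
  · exact (ht i j c d).reg₂ 0 0 0 0 0 1
  · exact (ht k l a b).reg₂ 1 0 (-1) 0 0 0

theorem reg₂_ringLinear (ht : ∀ i j a b, SingSpace A 0 (t i j a b)) (i j : Fin nocc) (a b : Fin nvir) :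
    Reg₂ A fun (p : Ext) xk _ => ringLinear S.eri t i j a b p.1 p.2.1 p.2.2 xk := by
  refine Reg₂.sum fun k => Reg₂.sum fun c => Reg₂.sub (Reg₂.mul (Reg₂.const_mul 2 ?_) ?_)
    (Reg₂.mul ?_ ?_)
  · exact (S.vo_singSpace a k i c).reg₂ 0 0 1 0 0 0
  · exact (ht k j c b).reg₂ 1 0 0 0 1 0
  · exact (S.vo_singSpace a k i c).reg₂ 0 0 1 0 0 0
  · exact (ht k j b c).reg₂ 1 0 0 0 0 0

theorem reg₂_ringQuad (ht : ∀ i j a b, SingSpace A 0 (t i j a b)) (i j : Fin nocc) (a b : Fin nvir) :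
    Reg₂ A fun (p : Ext) xk xl => ringQuad S.eri t i j a b p.1 p.2.1 p.2.2 xk xl := by
  refine Reg₂.sum fun k => Reg₂.sum fun c => Reg₂.add (Reg₂.sub (Reg₂.mul (Reg₂.add
    (S.reg₂_ovKernel ht i c a k _ _) (Reg₂.const_mul _ (S.reg₂_voKernel ht c i a k _ _))) ?_)
    (Reg₂.mul (Reg₂.const_mul _ (S.reg₂_ovKernel ht i c a k _ _)) ?_))
    (Reg₂.mul (Reg₂.const_mul _ (S.reg₂_voKernel ht c j a k _ _)) ?_)
  · exact (ht k j c b).reg₂ 1 0 0 0 1 0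
  · exact (ht k j b c).reg₂ 1 0 0 0 0 0
  · exact (ht k i b c).reg₂ 1 0 0 0 0 0

theorem cubeApprox_kappaVir (ht : ∀ i j a b, SingSpace A 0 (t i j a b)) (c a : Fin nvir) :
    CubeApprox A fun avg xa => kappaVir avg S.eri t c a xa := by
  refine CubeApprox.neg (Reg₂.cubeApprox ?_)
  refine Reg₂.sum fun k => Reg₂.sum fun l => Reg₂.sum fun d => Reg₂.mul (Reg₂.sub
    (Reg₂.const_mul 2 ?_) ?_) ?_
  · exact (S.ov_singSpace k l c d).reg₂ 1 0 0 1 0 0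
  · exact (S.ov_singSpace k l d c).reg₂ 1 0 0 1 1 1
  · exact (ht k l a d).reg₂ 1 0 0 1 0 0

theorem cubeApprox_kappaOcc (ht : ∀ i j a b, SingSpace A 0 (t i j a b)) (i k : Fin nocc) :
    CubeApprox A fun avg xi => kappaOcc avg S.eri t i k xi := by
  refine Reg₂.cubeApprox ?_
  refine Reg₂.sum fun l => Reg₂.sum fun c => Reg₂.sum fun d => Reg₂.mul (Reg₂.sub
    (Reg₂.const_mul 2 ?_) ?_) ?_
  · exact (S.ov_singSpace k l c d).reg₂ 0 0 1 1 1 0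
  · exact (S.ov_singSpace k l d c).reg₂ 0 0 1 1 0 1
  · exact (ht i l c d).reg₂ 0 0 1 1 1 0

/-- The amplitudes stand outside the averages, so they need only be bounded. -/
theorem cubeApprox_kappaTerm (ht : ∀ i j a b, SingSpace A 0 (t i j a b)) (i j : Fin nocc) (a b : Fin nvir) :
    CubeApprox A fun avg (p : Ext) => kappaTerm avg S.eri t i j a b p.1 p.2.1 p.2.2 := by
  refine CubeApprox.sub (CubeApprox.sum fun c => ?_) (CubeApprox.sum fun k => ?_)
  · exact ((S.cubeApprox_kappaVir ht c a).comp fun p : Ext => p.2.2).mul_bounded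
      ((ht i j c b).bounded _ _ _)
  · exact ((S.cubeApprox_kappaOcc ht i k).comp fun p : Ext => p.1).mul_bounded
      ((ht k j a b).bounded _ _ _)

theorem cubeApprox_restSum (ht : ∀ i j a b, SingSpace A 0 (t i j a b)) (i j : Fin nocc) (a b : Fin nvir) :
    CubeApprox A fun avg (p : Ext) => restSum avg S.eri t i j a b p.1 p.2.1 p.2.2 := by
  have hring : ∀ i j a b, CubeApprox A fun avg (p : Ext) =>
      avg (ringLinear S.eri t i j a b p.1 p.2.1 p.2.2)
        + avg fun xk => avg (ringQuad S.eri t i j a b p.1 p.2.1 p.2.2 xk) := fun i j a b =>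
    (S.reg₂_ringLinear ht i j a b).cubeApprox_left.add (S.reg₂_ringQuad ht i j a b).cubeApprox
  refine (((CubeApprox.const _).add ?_).add (S.reg₂_ooQuad ht i j a b).cubeApprox).add ?_
  · exact (S.cubeApprox_kappaTerm ht i j a b).add ((S.cubeApprox_kappaTerm ht j i b a).comp swapExt)
  · exact (hring i j a b).add ((hring j i b a).comp swapExt)

end Insulator

end Terms

/-! ### The ladder terms -/

/-- `q` is a point of the mesh modulo the reciprocal lattice (up to a multiple of the mesh size). -/
def OnMesh (A : Basis (Fin 3) ℝ E3) (m : ℕ) (k₀ q : E3) : Prop :=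
  ∀ x : Mesh m, (m : ℝ) • (meshPoint A m k₀ x - q) ∈ recipLattice A

/-- The external momenta are points of the mesh. -/
def ExtOnMesh (A : Basis (Fin 3) ℝ E3) (m : ℕ) (k₀ : E3) (p : Ext) : Prop :=
  OnMesh A m k₀ p.1 ∧ OnMesh A m k₀ p.2.1 ∧ OnMesh A m k₀ p.2.2

theorem ExtOnMesh.swapExt {m : ℕ} {k₀ : E3} {p : Ext} (h : ExtOnMesh A m k₀ p) :
    ExtOnMesh A m k₀ (swapExt p) := by
  refine ⟨h.2.1, h.1, fun x => ?_⟩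
  have e : (m : ℝ) • (meshPoint A m k₀ x - (p.1 + p.2.1 - p.2.2)) =
      (m : ℝ) • (meshPoint A m k₀ x - p.1) + (m : ℝ) • (meshPoint A m k₀ x - p.2.1) -
        (m : ℝ) • (meshPoint A m k₀ x - p.2.2) := by module
  change (m : ℝ) • (meshPoint A m k₀ x - (p.1 + p.2.1 - p.2.2)) ∈ _
  rw [e]
  exact sub_mem (add_mem (h.1 x) (h.2.1 x)) (h.2.2 x)

/-- Families of integrable functions whose mesh averages are accurate to order `m⁻¹` for external
momenta on the mesh. -/
structure LadderLike (A : Basis (Fin 3) ℝ E3) (G : Ext → E3 → ℂ) : Prop where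
  integrable : ∀ p, IntegrableOn (G p) (brillouinZone A)
  bound : ∃ C : ℝ, 0 ≤ C ∧ ∀ (m : ℕ) [NeZero m] (k₀ : E3) (p : Ext), ExtOnMesh A m k₀ p →
    ‖meshMean A m k₀ (G p) - zoneAvg A (G p)‖ ≤ C * (m : ℝ)⁻¹

theorem LadderLike.add {G G' : Ext → E3 → ℂ} (h : LadderLike A G) (h' : LadderLike A G') :
    LadderLike A fun p x => G p x + G' p x := by
  refine ⟨fun p => (h.integrable p).add (h'.integrable p), ?_⟩
  obtain ⟨C, hC, hb⟩ := h.bound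
  obtain ⟨C', hC', hb'⟩ := h'.bound
  refine ⟨C + C', by positivity, fun m _ k₀ p hp => ?_⟩
  rw [meshMean_add, zoneAvg_add (h.integrable p) (h'.integrable p), add_sub_add_comm, add_mul]
  exact (norm_add_le _ _).trans (add_le_add (hb m k₀ p hp) (hb' m k₀ p hp))

theorem LadderLike.sum {κ : Type} [Fintype κ] {G : κ → Ext → E3 → ℂ}
    (h : ∀ k, LadderLike A (G k)) : LadderLike A fun p x => ∑ k, G k p x := by
  classical
  suffices hs : ∀ s : Finset κ, LadderLike A fun p x => ∑ k ∈ s, G k p x from hs Finset.univ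
  intro s
  induction s using Finset.induction with
  | empty =>
    simp only [Finset.sum_empty]
    exact ⟨fun p => integrableOn_zero, 0, le_rfl, fun m _ k₀ p _ => by
      rw [meshMean_const, zoneAvg_const]
      simp⟩
  | insert k s hk ih =>
    simp only [Finset.sum_insert hk]
    exact (h k).add ih

/-- The integers `e` are the slopes of the momenta in the ERI and `d` those in the amplitude. The
one condition left to the caller is that the pole lies on the mesh when the external momenta do. -/
theorem SingSpace.ladderLike {f g : E3 → E3 → E3 → ℂ} (hf : SingSpace A 2 f) (hg : SingSpace A 0 g)
    {k₁ k₂ k₃ l₁ l₂ l₃ : Ext → E3 → E3} (e₁ e₂ e₃ d₁ d₂ d₃ : ℤ)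
    (hp : ∀ m k₀ p, ExtOnMesh A m k₀ p → OnMesh A m k₀ (pole (e₃ - e₁) k₁ k₃ p))
    (h₁ : Aff e₁ k₁ := by intro p x; push_cast; module)
    (h₂ : Aff e₂ k₂ := by intro p x; push_cast; module)
    (h₃ : Aff e₃ k₃ := by intro p x; push_cast; module)
    (i₁ : Aff d₁ l₁ := by intro p x; push_cast; module)
    (i₂ : Aff d₂ l₂ := by intro p x; push_cast; module)
    (i₃ : Aff d₃ l₃ := by intro p x; push_cast; module)
    (he : |e₁| ≤ 1 ∧ |e₂| ≤ 1 ∧ |e₃ - e₁| = 1 := by norm_num)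
    (hd : |d₁| ≤ 1 ∧ |d₂| ≤ 1 ∧ |d₃ - d₁| ≤ 1 := by norm_num) :
    LadderLike A fun p x => f (k₁ p x) (k₂ p x) (k₃ p x) * g (l₁ p x) (l₂ p x) (l₃ p x) := by
  obtain ⟨B, hB⟩ := hf.doublePole h₁ h₂ h₃ he.1 he.2.1 he.2.2
  obtain ⟨B', hB'⟩ := hg.uReg i₁ i₂ i₃ hd.1 hd.2.1 hd.2.2
  have hm : ∀ {e : ℤ} {k : Ext → E3 → E3}, Aff e k → ∀ p, Measurable (k p) := fun {e k} h p => by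
    have : k p = fun x => k p 0 + (e : ℝ) • x := funext fun x => h p x
    rw [this]
    fun_prop
  have hV := fun p => (hB p).mono (le_max_left B B')
  have hτ := fun p => (hB' p).mono (le_max_right B B')
  have hVm := fun p => hf.measurable (hm h₁ p) (hm h₂ p) (hm h₃ p)
  have hτm := fun p => hg.measurable (hm i₁ p) (hm i₂ p) (hm i₃ p)
  obtain ⟨C, hC, hq⟩ := exists_doublePole_quadrature_bound A (max B B')
  exact ⟨fun p => (hV p).integrable_mul (hτ p) (hVm p) (hτm p), C, hC, fun m _ k₀ p hmesh =>
    hq m k₀ _ _ _ (hV p) (hτ p) (hVm p) (hτm p) (hp m k₀ p hmesh)⟩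

section Terms

open Sum (inl inr)

namespace Insulator

variable (S : Insulator A nocc nvir) {t : Amp nocc nvir E3}

/-- The transfer is `xi - xk`, so the pole in `xk` is the external momentum `xi`. -/
theorem ladderLike_ooLadder (ht : ∀ i j a b, SingSpace A 0 (t i j a b)) (i j : Fin nocc)
    (a b : Fin nvir) :
    LadderLike A fun p => ooLadder S.eri t i j a b p.1 p.2.1 p.2.2 := by
  refine LadderLike.sum fun k => LadderLike.sum fun l => ?_
  refine (S.eri_singSpace_two (inl k) (inl l) (inl i) (inl j)).ladderLike (ht k l a b)
    1 (-1) 0 1 (-1) 0 fun m k₀ p h => ?_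
  convert h.1 using 1
  simp [pole]

theorem ladderLike_vvLadder (ht : ∀ i j a b, SingSpace A 0 (t i j a b)) (i j : Fin nocc)
    (a b : Fin nvir) :
    LadderLike A fun p => vvLadder S.eri t i j a b p.1 p.2.1 p.2.2 := by
  refine LadderLike.sum fun c => LadderLike.sum fun d => ?_
  refine (S.eri_singSpace_two (inr a) (inr b) (inr c) (inr d)).ladderLike (ht i j c d)
    0 0 1 0 0 1 fun m k₀ p h => ?_
  convert h.2.2 using 1
  simp [pole]

/-- The transfers are `xk - xi` and `xk - xj`, with poles at the external momenta `xi` and `xj`. -/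
theorem ladderLike_ringLadder (ht : ∀ i j a b, SingSpace A 0 (t i j a b)) (i j : Fin nocc)
    (a b : Fin nvir) :
    LadderLike A fun p => ringLadder S.eri t i j a b p.1 p.2.1 p.2.2 := by
  refine LadderLike.sum fun k => LadderLike.sum fun c => LadderLike.add ?_ ?_
  · refine (S.eri_singSpace_two (inr a) (inl k) (inr c) (inl i)).ladderLike (ht k j c b)
      0 1 1 1 0 1 fun m k₀ p h => ?_
    convert h.1 using 1
    simp [pole]
  · refine (S.eri_singSpace_two (inr a) (inl k) (inr c) (inl j)).ladderLike (ht k i b c)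
      0 1 1 1 0 0 fun m k₀ p h => ?_
    convert h.2.1 using 1
    simp [pole]

/-! ### The energy denominators -/

/-- Periodicity and continuity make the gap attain its minimum, so the pointwise strict inequality
becomes uniform. -/
theorem exists_gap (i : Fin nocc) (a : Fin nvir) :
    ∃ c : ℝ, 0 < c ∧ ∀ k k', c ≤ S.ε (inr a) k' - S.ε (inl i) k := by
  set K : Set (E3 × E3) := Metric.closedBall 0 (zoneBound A)
  have hK : IsCompact K := isCompact_closedBall _ _
  have h0 : (0 : E3 × E3) ∈ K := by
    rw [mem_closedBall_zero_iff, norm_zero]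
    linarith [zoneBound_pos (A := A)]
  have hc : Continuous fun p : E3 × E3 => S.ε (inr a) p.2 - S.ε (inl i) p.1 :=
    ((S.energy_smooth _).continuous.comp continuous_snd).sub
      ((S.energy_smooth _).continuous.comp continuous_fst)
  obtain ⟨p, -, hp⟩ := hK.exists_isMinOn ⟨0, h0⟩ hc.continuousOn
  refine ⟨_, sub_pos.2 (S.gap i a p.1 p.2), fun k k' => ?_⟩
  obtain ⟨g, hg, b⟩ := exists_reduce A k
  obtain ⟨g', hg', b'⟩ := exists_reduce A k'
  have := hp (show (k - g, k' - g') ∈ K by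
    rw [mem_closedBall_zero_iff, Prod.norm_def]
    exact max_le b b')
  simpa only [sub_eq_add_neg, S.energy_periodic _ _ _ (neg_mem hg),
    S.energy_periodic _ _ _ (neg_mem hg'), Set.mem_ofPred_eq] using this

theorem exists_energyDenom_bound (i j : Fin nocc) (a b : Fin nvir) :
    ∃ C : ℝ, 0 ≤ C ∧ ∀ xi xj xa, ‖((energyDenom S.ε i j a b xi xj xa : ℝ) : ℂ)⁻¹‖ ≤ C := by
  obtain ⟨c, hc, h⟩ := S.exists_gap i a
  obtain ⟨c', hc', h'⟩ := S.exists_gap j b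
  refine ⟨c⁻¹, by positivity, fun xi xj xa => ?_⟩
  rw [norm_inv, Complex.norm_real]
  have h1 := h xi xa
  have h2 := h' xj (xi + xj - xa)
  refine inv_anti₀ hc ?_
  rw [Real.norm_eq_abs, abs_of_neg (by unfold energyDenom; linarith)]
  unfold energyDenom
  linarith

/-! ### Errors of the averages -/

theorem exists_ladder_bound (ht : ∀ i j a b, SingSpace A 0 (t i j a b)) (i j : Fin nocc)
    (a b : Fin nvir) :
    ∃ C : ℝ, 0 ≤ C ∧ ∀ (m : ℕ) [NeZero m] (k₀ : E3) (p : Ext), ExtOnMesh A m k₀ p →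
      ‖ladderMap (zoneAvg A) S.ε S.eri t i j a b p.1 p.2.1 p.2.2 -
        ladderMap (meshMean A m k₀) S.ε S.eri t i j a b p.1 p.2.1 p.2.2‖ ≤ C * (m : ℝ)⁻¹ := by
  obtain ⟨D, hD, hd⟩ := S.exists_energyDenom_bound i j a b
  obtain ⟨C₁, hC₁, h₁⟩ := (S.ladderLike_ooLadder ht i j a b).bound
  obtain ⟨C₂, hC₂, h₂⟩ := (S.ladderLike_vvLadder ht i j a b).bound
  obtain ⟨C₃, hC₃, h₃⟩ := (S.ladderLike_ringLadder ht i j a b).bound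
  obtain ⟨C₄, hC₄, h₄⟩ := (S.ladderLike_ringLadder ht j i b a).bound
  refine ⟨D * (C₁ + C₂ + (C₃ + C₄)), by positivity, fun m _ k₀ p hp => ?_⟩
  have e : ∀ avg : (E3 → ℂ) → ℂ, ladderMap avg S.ε S.eri t i j a b p.1 p.2.1 p.2.2 =
      ((energyDenom S.ε i j a b p.1 p.2.1 p.2.2 : ℝ) : ℂ)⁻¹ *
      (avg (ooLadder S.eri t i j a b p.1 p.2.1 p.2.2) +
        avg (vvLadder S.eri t i j a b p.1 p.2.1 p.2.2)
        - (avg (ringLadder S.eri t i j a b p.1 p.2.1 p.2.2) +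
          avg (ringLadder S.eri t j i b a (swapExt p).1 (swapExt p).2.1 (swapExt p).2.2))) :=
    fun avg => rfl
  rw [e, e, ← mul_sub, norm_mul, mul_assoc]
  refine mul_le_mul (hd _ _ _) ?_ (norm_nonneg _) hD
  rw [norm_sub_rev, sub_sub_sub_comm, add_sub_add_comm, add_sub_add_comm, add_mul, add_mul, add_mul]
  refine (norm_sub_le _ _).trans (add_le_add ?_ ?_)
  · exact (norm_add_le _ _).trans (add_le_add (h₁ m k₀ p hp) (h₂ m k₀ p hp))
  · exact (norm_add_le _ _).trans (add_le_add (h₃ m k₀ p hp) (h₄ m k₀ _ hp.swapExt))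

theorem ccdMap_sub_ladderMap_meshMean (m : ℕ) [NeZero m] (k₀ : E3) (i j : Fin nocc)
    (a b : Fin nvir) (p : Ext) :
    ccdMap (meshMean A m k₀) S.ε S.eri t i j a b p.1 p.2.1 p.2.2 -
      ladderMap (meshMean A m k₀) S.ε S.eri t i j a b p.1 p.2.1 p.2.2 =
      ((energyDenom S.ε i j a b p.1 p.2.1 p.2.2 : ℝ) : ℂ)⁻¹ *
        restSum (meshMean A m k₀) S.eri t i j a b p.1 p.2.1 p.2.2 := by
  apply ccdMap_sub_ladderMap (isAverage_meshMean A m k₀) <;> intros <;> trivial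

/-- Here the conditions of the splitting are true integrability statements; for the ladder
integrands they rest on local integrability of `|x|⁻²` in dimension three. -/
theorem ccdMap_sub_ladderMap_zoneAvg (ht : ∀ i j a b, SingSpace A 0 (t i j a b)) (i j : Fin nocc)
    (a b : Fin nvir) (p : Ext) :
    ccdMap (zoneAvg A) S.ε S.eri t i j a b p.1 p.2.1 p.2.2 -
      ladderMap (zoneAvg A) S.ε S.eri t i j a b p.1 p.2.1 p.2.2 =
      ((energyDenom S.ε i j a b p.1 p.2.1 p.2.2 : ℝ) : ℂ)⁻¹ *
        restSum (zoneAvg A) S.eri t i j a b p.1 p.2.1 p.2.2 := by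
  apply ccdMap_sub_ladderMap (isAverage_zoneAvg A)
  · intro i c a k xi xa xk
    exact (S.reg₂_ovKernel ht i c a k (fun _ : Unit => xi) fun _ => xa).integrable_right () xk
  · intro c i a k xi xa xk
    exact (S.reg₂_voKernel ht c i a k (fun _ : Unit => xi) fun _ => xa).integrable_right () xk
  · intro i j k l xi xj xk
    exact (S.reg₂_ooKernel ht i j k l).integrable_right (xi, xj) xk
  · intro i j a b xi xj xa
    have h := S.reg₂_ringLinear ht i j a b
    obtain ⟨B, hB⟩ := h.exists_bound
    exact integrableOn_zone (h.measurable_left (xi, xj, xa) 0) fun x => hB (xi, xj, xa) x 0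
  · intro i j a b xi xj xa
    exact (S.ladderLike_ringLadder ht i j a b).integrable (xi, xj, xa)
  · intro i j a b xi xj xa
    exact (S.reg₂_ringQuad ht i j a b).integrable_zoneAvg (xi, xj, xa)
  · intro i j a b xi xj xa
    exact (S.ladderLike_ooLadder ht i j a b).integrable (xi, xj, xa)
  · intro i j a b xi xj xa
    exact (S.reg₂_ooQuad ht i j a b).integrable_zoneAvg (xi, xj, xa)

theorem exists_rest_bound (ht : ∀ i j a b, SingSpace A 0 (t i j a b)) (i j : Fin nocc)
    (a b : Fin nvir) :
    ∃ C : ℝ, 0 ≤ C ∧ ∀ (m : ℕ) [NeZero m] (k₀ : E3) (p : Ext),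
      ‖(ccdMap (zoneAvg A) S.ε S.eri t i j a b p.1 p.2.1 p.2.2 -
          ccdMap (meshMean A m k₀) S.ε S.eri t i j a b p.1 p.2.1 p.2.2) -
        (ladderMap (zoneAvg A) S.ε S.eri t i j a b p.1 p.2.1 p.2.2 -
          ladderMap (meshMean A m k₀) S.ε S.eri t i j a b p.1 p.2.1 p.2.2)‖ ≤
        C * ((m : ℝ) ^ 3)⁻¹ := by
  obtain ⟨D, hD, hd⟩ := S.exists_energyDenom_bound i j a b
  obtain ⟨C, hC, h⟩ := S.cubeApprox_restSum ht i j a b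
  refine ⟨D * C, by positivity, fun m _ k₀ p => ?_⟩
  rw [sub_sub_sub_comm, S.ccdMap_sub_ladderMap_zoneAvg ht, S.ccdMap_sub_ladderMap_meshMean,
    ← mul_sub, norm_mul, norm_sub_rev, mul_assoc]
  exact mul_le_mul (hd _ _ _) (h m k₀ p) (norm_nonneg _) hD

end Insulator

end Terms

/-! ### Passage from momenta to mesh labels, and conclusion -/

/-! ### Sampling on the mesh -/

theorem LatPeriodic.exists_factor {E : Type} {F : E3 → E} (h : LatPeriodic A F) :
    ∃ w : E3 ⧸ recipLattice A → E, ∀ x, F x = w ((recipLattice A).mkQ x) := by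
  refine ⟨fun y => F (Function.surjInv (recipLattice A).mkQ_surjective y), fun x => ?_⟩
  refine h.eq_of_sub_mem ?_
  rw [← Submodule.Quotient.eq]
  exact (Function.surjInv_eq (recipLattice A).mkQ_surjective _).symm

theorem SingSpace.exists_factor {s : ℕ} {f : E3 → E3 → E3 → ℂ} (h : SingSpace A s f) :
    ∃ w : E3 ⧸ recipLattice A → E3 ⧸ recipLattice A → E3 ⧸ recipLattice A → ℂ, ∀ x y z,
      f x y z = w ((recipLattice A).mkQ x) ((recipLattice A).mkQ y) ((recipLattice A).mkQ z) := by
  set σ := Function.surjInv (recipLattice A).mkQ_surjective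
  have hσ : ∀ x, x - σ ((recipLattice A).mkQ x) ∈ recipLattice A := fun x => by
    rw [← Submodule.Quotient.eq]
    exact (Function.surjInv_eq (recipLattice A).mkQ_surjective _).symm
  refine ⟨fun x y z => f (σ x) (σ y) (σ z), fun x y z => ?_⟩
  have h₁ := h.periodic_i (σ ((recipLattice A).mkQ x)) y z _ (hσ x)
  have h₂ := h.periodic_j (σ ((recipLattice A).mkQ x)) (σ ((recipLattice A).mkQ y)) z _ (hσ y)
  have h₃ := h.periodic_a (σ ((recipLattice A).mkQ x)) (σ ((recipLattice A).mkQ y))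
    (σ ((recipLattice A).mkQ z)) _ (hσ z)
  rw [add_sub_cancel] at h₁ h₂ h₃
  rw [h₁, h₂, h₃]

theorem mkQ_meshPoint (m : ℕ) [NeZero m] (k₀ : E3) (x y z : Mesh m) :
    (recipLattice A).mkQ (meshPoint A m k₀ (x + y - z)) =
      (recipLattice A).mkQ (meshPoint A m k₀ x) + (recipLattice A).mkQ (meshPoint A m k₀ y) -
        (recipLattice A).mkQ (meshPoint A m k₀ z) := by
  rw [← map_add, ← map_sub]
  exact (Submodule.Quotient.eq _).2 (meshPoint_comb_mem m k₀ x y z)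

namespace Insulator

variable (S : Insulator A nocc nvir) {t : Amp nocc nvir E3}

/-- All ingredients are periodic and factor through the quotient by the reciprocal lattice, where
arithmetic of labels modulo `m` agrees exactly with arithmetic of momenta. Both sides then unfold to
the same expression. -/
theorem ccdMap_meshPoint (ht : ∀ i j a b, SingSpace A 0 (t i j a b)) (m : ℕ) [NeZero m] (k₀ : E3)
    (i j : Fin nocc) (a b : Fin nvir) (xi xj xa : Mesh m) :
    ccdMap (meshMean A m k₀) S.ε S.eri t i j a b (meshPoint A m k₀ xi) (meshPoint A m k₀ xj)
      (meshPoint A m k₀ xa) = S.ccdFinite m k₀ (sample A m k₀ t) i j a b xi xj xa := by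
  have hε := fun n => LatPeriodic.exists_factor (A := A) fun k g hg => S.energy_periodic n k g hg
  have hv := fun n₁ n₂ n₃ n₄ => (S.eri_singSpace_two n₁ n₂ n₃ n₄).exists_factor
  have hτ := fun i j a b => (ht i j a b).exists_factor
  choose e he using hε
  choose w hw using hv
  choose τ hτ using hτ
  simp only [ccdFinite, ccdMap, perm, kappaTerm, kappaVir, kappaOcc, ringTerm, chiOO, chiOV, chiVO,
    energyDenom, meshMean, meshEri, meshEnergy, sample, hw, hτ, he, map_add, map_sub, mkQ_meshPoint]

theorem ladderMap_meshPoint (ht : ∀ i j a b, SingSpace A 0 (t i j a b)) (m : ℕ) [NeZero m]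
    (k₀ : E3) (i j : Fin nocc) (a b : Fin nvir) (xi xj xa : Mesh m) :
    ladderMap (meshMean A m k₀) S.ε S.eri t i j a b (meshPoint A m k₀ xi) (meshPoint A m k₀ xj)
      (meshPoint A m k₀ xa) = S.ladderFinite m k₀ (sample A m k₀ t) i j a b xi xj xa := by
  have hε := fun n => LatPeriodic.exists_factor (A := A) fun k g hg => S.energy_periodic n k g hg
  have hv := fun n₁ n₂ n₃ n₄ => (S.eri_singSpace_two n₁ n₂ n₃ n₄).exists_factor
  have hτ := fun i j a b => (ht i j a b).exists_factor
  choose e he using hε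
  choose w hw using hv
  choose τ hτ using hτ
  simp only [ladderFinite, ladderMap, perm, energyDenom, meshMean, meshEri, meshEnergy, sample, hw,
    hτ, he, map_add, map_sub, mkQ_meshPoint]

end Insulator

/-! ### Assembly -/

theorem maxNorm_le {m : ℕ} [NeZero m] {T : Amp nocc nvir (Mesh m)} {K : ℝ} (hK : 0 ≤ K)
    (h : ∀ i j a b xi xj xa, ‖T i j a b xi xj xa‖ ≤ K) : maxNorm T ≤ K :=
  (pi_norm_le_iff_of_nonneg hK).2 fun p => h _ _ _ _ _ _ _

/-- There are finitely many bands, so the sum of the nonnegative constants serves for all of them.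
-/
theorem exists_band_bound {f : Fin nocc → Fin nocc → Fin nvir → Fin nvir → ℝ → Prop}
    (hf : ∀ i j a b, ∃ C : ℝ, 0 ≤ C ∧ f i j a b C)
    (hmono : ∀ i j a b C C', C ≤ C' → f i j a b C → f i j a b C') :
    ∃ C : ℝ, 0 ≤ C ∧ ∀ i j a b, f i j a b C := by
  choose C hC h using hf
  refine ⟨∑ i, ∑ j, ∑ a, ∑ b, C i j a b, Finset.sum_nonneg fun i _ => Finset.sum_nonneg fun j _ =>
    Finset.sum_nonneg fun a _ => Finset.sum_nonneg fun b _ => hC i j a b,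
    fun i j a b => hmono i j a b _ _ ?_ (h i j a b)⟩
  refine le_trans ?_ (Finset.single_le_sum (f := fun i => ∑ j, ∑ a, ∑ b, C i j a b)
    (fun i _ => Finset.sum_nonneg fun j _ => Finset.sum_nonneg fun a _ =>
      Finset.sum_nonneg fun b _ => hC i j a b) (Finset.mem_univ i))
  refine le_trans ?_ (Finset.single_le_sum (f := fun j => ∑ a, ∑ b, C i j a b)
    (fun j _ => Finset.sum_nonneg fun a _ => Finset.sum_nonneg fun b _ => hC i j a b)
    (Finset.mem_univ j))
  refine le_trans ?_ (Finset.single_le_sum (f := fun a => ∑ b, C i j a b)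
    (fun a _ => Finset.sum_nonneg fun b _ => hC i j a b) (Finset.mem_univ a))
  exact Finset.single_le_sum (f := fun b => C i j a b) (fun b _ => hC i j a b) (Finset.mem_univ b)

theorem onMesh_meshPoint (m : ℕ) [NeZero m] (k₀ : E3) (y : Mesh m) :
    OnMesh A m k₀ (meshPoint A m k₀ y) := fun x => meshPoint_sub_mem m k₀ x y

namespace Insulator

variable (S : Insulator A nocc nvir) {t : Amp nocc nvir E3}

theorem exists_maxNorm_rest_bound (ht : ∀ i j a b, SingSpace A 0 (t i j a b)) :
    ∃ C : ℝ, 0 ≤ C ∧ ∀ (m : ℕ) [NeZero m] (k₀ : E3),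
      maxNorm ((sample A m k₀ (S.ccdTDL t) - S.ccdFinite m k₀ (sample A m k₀ t))
        - (sample A m k₀ (S.ladderTDL t) - S.ladderFinite m k₀ (sample A m k₀ t))) ≤
        C * ((m : ℝ) ^ 3)⁻¹ := by
  obtain ⟨C, hC, h⟩ := exists_band_bound (S.exists_rest_bound ht) fun i j a b C C' hCC h m _ k₀ _ =>
    (h m k₀ _).trans (by gcongr)
  refine ⟨C, hC, fun m _ k₀ => maxNorm_le (by positivity) fun i j a b xi xj xa => ?_⟩
  simp only [Pi.sub_apply, ← S.ccdMap_meshPoint ht, ← S.ladderMap_meshPoint ht]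
  exact h i j a b m k₀ (meshPoint A m k₀ xi, meshPoint A m k₀ xj, meshPoint A m k₀ xa)

theorem exists_maxNorm_ladder_bound (ht : ∀ i j a b, SingSpace A 0 (t i j a b)) :
    ∃ C : ℝ, 0 ≤ C ∧ ∀ (m : ℕ) [NeZero m] (k₀ : E3),
      maxNorm (sample A m k₀ (S.ladderTDL t) - S.ladderFinite m k₀ (sample A m k₀ t)) ≤
        C * (m : ℝ)⁻¹ := by
  obtain ⟨C, hC, h⟩ := exists_band_bound (S.exists_ladder_bound ht)
    fun i j a b C C' hCC h m _ k₀ _ hp => (h m k₀ _ hp).trans (by gcongr)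
  refine ⟨C, hC, fun m _ k₀ => maxNorm_le (by positivity) fun i j a b xi xj xa => ?_⟩
  simp only [Pi.sub_apply, ← S.ladderMap_meshPoint ht]
  exact h i j a b m k₀ (meshPoint A m k₀ xi, meshPoint A m k₀ xj, meshPoint A m k₀ xa)
    ⟨onMesh_meshPoint m k₀ xi, onMesh_meshPoint m k₀ xj, onMesh_meshPoint m k₀ xa⟩

theorem exists_maxNorm_bound (ht : ∀ i j a b, SingSpace A 0 (t i j a b)) :
    ∃ C : ℝ, 0 ≤ C ∧ ∀ (m : ℕ) [NeZero m] (k₀ : E3),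
      maxNorm (sample A m k₀ (S.ccdTDL t) - S.ccdFinite m k₀ (sample A m k₀ t)) ≤
        C * (m : ℝ)⁻¹ := by
  obtain ⟨C, hC, h⟩ := S.exists_maxNorm_rest_bound ht
  obtain ⟨C', hC', h'⟩ := S.exists_maxNorm_ladder_bound ht
  refine ⟨C + C', by positivity, fun m _ k₀ => ?_⟩
  have hm : (1 : ℝ) ≤ m := Nat.one_le_cast.2 (NeZero.pos m)
  have hle : ((m : ℝ) ^ 3)⁻¹ ≤ (m : ℝ)⁻¹ :=
    inv_anti₀ (by positivity) (le_self_pow₀ hm (by norm_num))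
  have htri : ∀ X Y : Amp nocc nvir (Mesh m), maxNorm X ≤ maxNorm (X - Y) + maxNorm Y :=
    fun X Y => by
      refine maxNorm_le (by unfold maxNorm; positivity) fun i j a b xi xj xa => ?_
      have hX : ∀ Z : Amp nocc nvir (Mesh m), ‖Z i j a b xi xj xa‖ ≤ maxNorm Z := fun Z =>
        norm_le_pi_norm (fun p : (Fin nocc × Fin nocc × Fin nvir × Fin nvir) ×
          (Mesh m × Mesh m × Mesh m) =>
          Z p.1.1 p.1.2.1 p.1.2.2.1 p.1.2.2.2 p.2.1 p.2.2.1 p.2.2.2) ((i, j, a, b), (xi, xj, xa))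
      have e : X i j a b xi xj xa = (X - Y) i j a b xi xj xa + Y i j a b xi xj xa := by
        simp only [Pi.sub_apply, sub_add_cancel]
      rw [e]
      exact (norm_add_le _ _).trans (add_le_add (hX _) (hX _))
  refine (htri _ (sample A m k₀ (S.ladderTDL t) - S.ladderFinite m k₀ (sample A m k₀ t))).trans ?_
  rw [add_mul]
  exact add_le_add ((h m k₀).trans (by gcongr)) (h' m k₀)

end Insulator

end PeriodicCCD

end

theorem mainTheorem6 (A : Module.Basis (Fin 3) ℝ PeriodicCCD.E3) (nocc nvir : ℕ)
    (S : PeriodicCCD.Insulator A nocc nvir)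
    (t : PeriodicCCD.Amp nocc nvir PeriodicCCD.E3)
    (ht : ∀ i j a b, PeriodicCCD.InAmplitudeSpace A (t i j a b)) :
    -- the amplitude error in a single iteration, in the entrywise max norm, with `N = m ^ 3`
    (∃ C : ℝ, ∀ (m : ℕ) [NeZero m] (k₀ : PeriodicCCD.E3),
      PeriodicCCD.maxNorm (PeriodicCCD.sample A m k₀ (S.ccdTDL t)
          - S.ccdFinite m k₀ (PeriodicCCD.sample A m k₀ t))
        ≤ C * ((m ^ 3 : ℕ) : ℝ) ^ (-(1 / 3 : ℝ))) ∧
    -- all terms other than the ladder-type linear ones contribute an error of lower order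
    (∃ C : ℝ, ∀ (m : ℕ) [NeZero m] (k₀ : PeriodicCCD.E3),
      PeriodicCCD.maxNorm ((PeriodicCCD.sample A m k₀ (S.ccdTDL t)
            - S.ccdFinite m k₀ (PeriodicCCD.sample A m k₀ t))
          - (PeriodicCCD.sample A m k₀ (S.ladderTDL t)
            - S.ladderFinite m k₀ (PeriodicCCD.sample A m k₀ t)))
        ≤ C * ((m ^ 3 : ℕ) : ℝ) ^ (-1 : ℝ)) ∧
    -- ERIs with matching band indices have order exactly `-2` at zero momentum transfer
    (∀ n₁ n₂ : PeriodicCCD.Band nocc nvir,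
      PeriodicCCD.HasAlgebraicSingularity (-2)
          (fun (q : PeriodicCCD.E3) (k : PeriodicCCD.E3 × PeriodicCCD.E3) =>
            S.eri n₁ n₂ n₁ n₂ k.1 k.2 (k.1 + q)) 0 ∧
        ∀ γ : ℝ, -2 < γ → ¬ PeriodicCCD.HasAlgebraicSingularity γ
          (fun (q : PeriodicCCD.E3) (k : PeriodicCCD.E3 × PeriodicCCD.E3) =>
            S.eri n₁ n₂ n₁ n₂ k.1 k.2 (k.1 + q)) 0) := by
  have ht' := fun i j a b => (ht i j a b).singSpace
  refine ⟨?_, ?_, fun n₁ n₂ => ⟨S.eri_singular_two n₁ n₂ n₁ n₂, fun γ hγ =>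
    S.eri_not_singular n₁ n₂ hγ⟩⟩
  · obtain ⟨C, -, h⟩ := S.exists_maxNorm_bound ht'
    refine ⟨C, fun m _ k₀ => ?_⟩
    -- With `N = m ^ 3`, the rate `N ^ (-1/3)` is the mesh width.
    have e : ((m ^ 3 : ℕ) : ℝ) ^ (-(1 / 3 : ℝ)) = (m : ℝ)⁻¹ := by
      rw [Nat.cast_pow, ← Real.rpow_natCast, ← Real.rpow_mul (Nat.cast_nonneg m)]
      norm_num [Real.rpow_neg_one]
    rw [e]
    exact h m k₀
  · obtain ⟨C, -, h⟩ := S.exists_maxNorm_rest_bound ht'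
    refine ⟨C, fun m _ k₀ => ?_⟩
    rw [Real.rpow_neg_one, Nat.cast_pow]
    exact h m k₀
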